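/- All notions are local. An ODE is $y''=f(x,y,y')$ with $f$ a real-valued function, real analytic near a jet $p=(x_0,y_0,y_0')$ of the first jet space $J^1=\mathbb{R}^3$. An area-preserving transformation is a local real-analytic map $\Phi=(\chi,\phi)$ of the plane with $\chi_x\phi_y-\chi_y\phi_x\equiv 1$; it is used near jets where $\chi_x+y'\chi_y\neq 0$, and its prolongation is $(x,y,y')\mapsto\bigl(\chi,\phi,\tfrac{\phi_x+y'\phi_y}{\chi_x+y'\chi_y}\bigr)$. The equation $y''=f$ near $p$ is equivalent to $\bar y''=g$ near $q$ if some such $\Phi$, defined near $(x_0,y_0)$ and with prolongation sending $p$ to $q$, carries the solutions of the first equation with 1-jets near $p$ to solutions of the second: a function with 1-jets near $p$ solves $y''=f$ if and only if the function whose graph is the image of its graph under $\Phi$ solves $\bar y''=g$. A symmetry is a self-equivalence (possibly moving $p$). A Lie group of symmetries of $y''=f$ near $p$ of dimension $r$ is an $r$-dimensional real-analytic local Lie group together with a (locally) effective real-analytic local action near $(x_0,y_0)$ by area-preserving transformations which map $y''=f$ near $p$ to itself. Let $$ASL(2,\mathbb{R})=\left\{\begin{pmatrix}1&0\\ v&M\end{pmatrix}: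 v\in\mathbb{R}^2,\ M\in SL(2,\mathbb{R})\right\},$$ and say that $y''=f$ admits $ASL(2,\mathbb{R})$ near $p$ if it has there a Lie group of symmetries locally isomorphic to $ASL(2,\mathbb{R})$. **Corollary 3.3.** (1) Let $f$ be real analytic near $p$. Then $y''=f(x,y,y')$ is equivalent near $p$ to $y''=0$ (near some jet) under an area-preserving transformation if and only if there are functions $A,B,C,D$ of $(x,y)$, real analytic near $(x_0,y_0)$, such that $$f(x,y,y')=A(x,y)\,y'^3+3B(x,y)\,y'^2+3C(x,y)\,y'+D(x,y)$$ near $p$ and $$D_y-C_x=2(BD-C^2),\qquad C_y-B_x=AD-BC,\qquad B_y-A_x=2(AC-B^2)$$ near $(x_0,y_0)$. More globally, if $f$ is real analytic on an open set $\Omega\subset J^1$ all of whose fibres $\{y':(x,y,y')\in\Omega\}$ are connected (possibly empty), then $y''=f$ is equivalent to $y''=0$ near every jet of $\Omega$ if and only if such $A,B,C,D$ exist, real analytic on the projection $U$ of $\Omega$ to the $(x,y)$-plane, with the first identity holding on $\Omega$ and the other three on $U$. (2) The symmetries of $y''=0$ near a jet $p$ are exactly the germs at $(x_0,y_0)$ of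 the special affine transformations of the plane, $z\mapsto Mz+v$ with $M\in SL(2,\mathbb{R})$ and $v\in\mathbb{R}^2$, for which $\chi_x+y'\chi_y\neq0$ at $p$. For every $f$ real analytic near $p$, a Lie group of symmetries of $y''=f$ near $p$ has dimension at most $5=\dim ASL(2,\mathbb{R})$; and the following are equivalent: $y''=f$ has near $p$ a Lie group of symmetries of dimension $5$; $y''=f$ admits $ASL(2,\mathbb{R})$ near $p$; $y''=f$ is equivalent near $p$ to $y''=0$. Moreover, if $y''=f$ near $p$ and $y''=g$ near $q$ ($f$, $g$ real analytic there) both admit $ASL(2,\mathbb{R})$, then they are equivalent, by a transformation whose prolongation sends $p$ to $q$. So the equations admitting the maximal symmetry group $ASL(2,\mathbb{R})$ form exactly one equivalence class, that of $y''=0$. -/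

import Mathlib

open Filter Topology Set

/-! Points of the plane are pairs `(x, y) : ℝ × ℝ`; points of the first jet space are triples
`(x, y, y') : ℝ × ℝ × ℝ`.  A scalar second order equation `y'' = f (x, y, y')` is given by its right
hand side `f : ℝ × ℝ × ℝ → ℝ`.  Everything is local around a point of the jet space. -/

/-- Partial derivative with respect to `x` of a function of `(x, y)`. -/
noncomputable def partialX (F : ℝ × ℝ → ℝ) (z : ℝ × ℝ) : ℝ := fderiv ℝ F z (1, 0)

/-- Partial derivative with respect to `y` of a function of `(x, y)`. -/
noncomputable def partialY (F : ℝ × ℝ → ℝ) (z : ℝ × ℝ) : ℝ := fderiv ℝ F z (0, 1)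

/-- The projection `(x, y, y') ↦ (x, y)` of the first jet space onto the plane. -/
def jetBase (p : ℝ × ℝ × ℝ) : ℝ × ℝ := (p.1, p.2.1)

/-- The Jacobian `J = χ_x φ_y - χ_y φ_x` of the point transformation `Φ = (χ, φ)`. -/
noncomputable def pointJacobian (Φ : ℝ × ℝ → ℝ × ℝ) (z : ℝ × ℝ) : ℝ :=
  partialX (fun w => (Φ w).1) z * partialY (fun w => (Φ w).2) z -
    partialY (fun w => (Φ w).1) z * partialX (fun w => (Φ w).2) z

/-- For `F = F (x, y)`, the function `F_x + y' F_y` on the first jet space. -/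
noncomputable def alongJet (F : ℝ × ℝ → ℝ) (p : ℝ × ℝ × ℝ) : ℝ :=
  partialX F (jetBase p) + p.2.2 * partialY F (jetBase p)

/-- The first prolongation of the point transformation `Φ = (χ, φ)`:
`(x, y, y') ↦ (χ, φ, (φ_x + y' φ_y) / (χ_x + y' χ_y))`
(meaningful where `χ_x + y' χ_y ≠ 0`). -/
noncomputable def prolongation (Φ : ℝ × ℝ → ℝ × ℝ) (p : ℝ × ℝ × ℝ) : ℝ × ℝ × ℝ :=
  ((Φ (jetBase p)).1, (Φ (jetBase p)).2,
    alongJet (fun w => (Φ w).2) p / alongJet (fun w => (Φ w).1) p)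

/-- `u` is a solution of `u'' = f (t, u, u')` on the (open) set `s`. -/
def IsSolutionOn (f : ℝ × ℝ × ℝ → ℝ) (u : ℝ → ℝ) (s : Set ℝ) : Prop :=
  ∀ t ∈ s, DifferentiableAt ℝ u t ∧ HasDerivAt (deriv u) (f (t, u t, deriv u t)) t

/-- On the region `W` of the first jet space, `Φ` is a real analytic area-preserving point
transformation (with a well-defined first prolongation) that carries the equation `y'' = f` to the
equation `y'' = g`: a function `u` whose 1-jets lie in `W` is a solution of `y'' = f` if and only if
the function `v` whose graph is the image under `Φ` of the graph of `u` is a solution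
of `y'' = g`. -/
structure CarriesEquationOn (Φ : ℝ × ℝ → ℝ × ℝ) (f g : ℝ × ℝ × ℝ → ℝ)
    (W : Set (ℝ × ℝ × ℝ)) : Prop where
  analytic : ∀ p ∈ W, AnalyticAt ℝ Φ (jetBase p)
  areaPreserving : ∀ p ∈ W, pointJacobian Φ (jetBase p) = 1
  transversal : ∀ p ∈ W, alongJet (fun w => (Φ w).1) p ≠ 0
  solutions : ∀ (a b : ℝ) (u v : ℝ → ℝ),
    (∀ t ∈ Ioo a b, DifferentiableAt ℝ u t ∧ (t, u t, deriv u t) ∈ W) →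
    (∀ t ∈ Ioo a b, v (Φ (t, u t)).1 = (Φ (t, u t)).2) →
    (IsSolutionOn f u (Ioo a b) ↔
      IsSolutionOn g v ((fun t => (Φ (t, u t)).1) '' Ioo a b))

/-- The equation `y'' = f` near the jet `p` and the equation `y'' = g` near the jet `q` are
equivalent under a local real analytic area-preserving point transformation, whose prolongation maps
`p` to `q`. -/
def AreaEquivalentAt (f : ℝ × ℝ × ℝ → ℝ) (p : ℝ × ℝ × ℝ) (g : ℝ × ℝ × ℝ → ℝ)
    (q : ℝ × ℝ × ℝ) : Prop :=
  ∃ Φ : ℝ × ℝ → ℝ × ℝ, ∃ W ∈ 𝓝 p, CarriesEquationOn Φ f g W ∧ prolongation Φ p = q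

/-- Near the jet `p`, the equation `y'' = f` is equivalent to `y'' = 0` under a local real analytic
area-preserving point transformation. -/
def EquivalentToFreeAt (f : ℝ × ℝ × ℝ → ℝ) (p : ℝ × ℝ × ℝ) : Prop :=
  ∃ q : ℝ × ℝ × ℝ, AreaEquivalentAt f p (fun _ => 0) q

/-- `f = A y'^3 + 3 B y'^2 + 3 C y' + D` at the jet `p`. -/
def IsCubicAt (A B C D : ℝ × ℝ → ℝ) (f : ℝ × ℝ × ℝ → ℝ) (p : ℝ × ℝ × ℝ) : Prop :=
  f p = A (jetBase p) * p.2.2 ^ 3 + 3 * B (jetBase p) * p.2.2 ^ 2 +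
    3 * C (jetBase p) * p.2.2 + D (jetBase p)

/-- The three differential relations between the coefficients, at the point `z`. -/
def CoefficientRelationsAt (A B C D : ℝ × ℝ → ℝ) (z : ℝ × ℝ) : Prop :=
  partialY D z - partialX C z = 2 * (B z * D z - C z ^ 2) ∧
  partialY C z - partialX B z = A z * D z - B z * C z ∧
  partialY B z - partialX A z = 2 * (A z * C z - B z ^ 2)

/-- The group `ASL(2, ℝ)` of special affine transformations in its standard representation by
`3 × 3` matrices. -/
def ASL2 : Set (Matrix (Fin 3) (Fin 3) ℝ) :=
  {M | ∃ (x₁ x₂ : ℝ) (A : Matrix.SpecialLinearGroup (Fin 2) ℝ),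
    M = !![1, 0, 0; x₁, A.1 0 0, A.1 0 1; x₂, A.1 1 0, A.1 1 1]}

/-- The affine map of the plane given by a matrix in `ASL2`, namely
`(1, x, y)ᵀ ↦ M (1, x, y)ᵀ = (1, x̄, ȳ)ᵀ`. -/
def affineAction (M : Matrix (Fin 3) (Fin 3) ℝ) (z : ℝ × ℝ) : ℝ × ℝ :=
  ((M.mulVec ![1, z.1, z.2]) 1, (M.mulVec ![1, z.1, z.2]) 2)

/-- `m` is the multiplication of an `r`-dimensional real analytic local Lie group, in coordinates
around the identity element `0`.  (Local inverses exist by the implicit function theorem.) -/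
structure IsLocalLieGroup {r : ℕ} (m : (Fin r → ℝ) → (Fin r → ℝ) → (Fin r → ℝ)) : Prop where
  analytic : AnalyticAt ℝ (fun w : (Fin r → ℝ) × (Fin r → ℝ) => m w.1 w.2) (0, 0)
  zero_left : ∀ᶠ g in 𝓝 (0 : Fin r → ℝ), m 0 g = g
  zero_right : ∀ᶠ g in 𝓝 (0 : Fin r → ℝ), m g 0 = g
  assoc : ∀ᶠ w in 𝓝 ((0, 0, 0) : (Fin r → ℝ) × (Fin r → ℝ) × (Fin r → ℝ)),
    m (m w.1 w.2.1) w.2.2 = m w.1 (m w.2.1 w.2.2)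

/-- The local Lie group `m` is locally isomorphic to the Lie group `ASL(2, ℝ)`: around the identity
there is a real analytic multiplicative homeomorphism `ι` onto a neighbourhood of the identity matrix
in `ASL(2, ℝ)`. -/
def IsLocallyASL2 {r : ℕ} (m : (Fin r → ℝ) → (Fin r → ℝ) → (Fin r → ℝ)) : Prop :=
  ∃ ι : (Fin r → ℝ) → Matrix (Fin 3) (Fin 3) ℝ,
    (∀ i j, AnalyticAt ℝ (fun g => ι g i j) 0) ∧
    ι 0 = 1 ∧
    (∀ᶠ g in 𝓝 0, ι g ∈ ASL2) ∧
    (∀ᶠ w in 𝓝 ((0, 0) : (Fin r → ℝ) × (Fin r → ℝ)), ι (m w.1 w.2) = ι w.1 * ι w.2) ∧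
    (∃ V ∈ 𝓝 0, InjOn ι V) ∧
    (∀ V ∈ 𝓝 0, ι '' V ∈ 𝓝[ASL2] 1)

/-- The local Lie group `m` acts, through `α`, effectively and real analytically near the base point
of the jet `p`, by area-preserving symmetries of the equation `y'' = f` near `p`. -/
structure IsLocalSymmetryGroup (f : ℝ × ℝ × ℝ → ℝ) (p : ℝ × ℝ × ℝ) {r : ℕ}
    (m : (Fin r → ℝ) → (Fin r → ℝ) → (Fin r → ℝ))
    (α : (Fin r → ℝ) → ℝ × ℝ → ℝ × ℝ) : Prop where
  isLocalLieGroup : IsLocalLieGroup m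
  analytic : AnalyticAt ℝ (fun w : (Fin r → ℝ) × (ℝ × ℝ) => α w.1 w.2) (0, jetBase p)
  zero_act : ∀ᶠ z in 𝓝 (jetBase p), α 0 z = z
  act_act : ∀ᶠ w in 𝓝 ((0, 0, jetBase p) : (Fin r → ℝ) × (Fin r → ℝ) × (ℝ × ℝ)),
    α w.1 (α w.2.1 w.2.2) = α (m w.1 w.2.1) w.2.2
  effective : ∀ᶠ g in 𝓝 (0 : Fin r → ℝ), (∀ᶠ z in 𝓝 (jetBase p), α g z = z) → g = 0
  symmetry : ∃ W ∈ 𝓝 p, ∀ᶠ g in 𝓝 (0 : Fin r → ℝ), CarriesEquationOn (α g) f f W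

/-- Near the jet `p`, the equation `y'' = f` admits the (five-dimensional) Lie group `ASL(2, ℝ)` as a
group of area-preserving symmetries.  The action is not supposed to be the standard affine one. -/
def AdmitsASL2At (f : ℝ × ℝ × ℝ → ℝ) (p : ℝ × ℝ × ℝ) : Prop :=
  ∃ (m : (Fin 5 → ℝ) → (Fin 5 → ℝ) → (Fin 5 → ℝ)) (α : (Fin 5 → ℝ) → ℝ × ℝ → ℝ × ℝ),
    IsLocalSymmetryGroup f p m α ∧ IsLocallyASL2 m

/-! The chain rule turns the equivalence problem into a pointwise identity. An area-preserving `Φ =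
(χ, φ)` carries `y'' = f` to `y'' = g` near a jet exactly when `g (prolongation Φ p) * (χ_x + y'
χ_y) ^ 3 = f p + N p` at all nearby jets, where `N = prolongationCubic Φ` is built from first and
second derivatives of `Φ` (`CarriesEquationOn.of_forall_carriesAt`, `CarriesEquationOn.carriesAt`).
Composition and inversion of equivalences then become identities between derivatives.

For `g = 0` the identity reads `f = -N`. Since the Jacobian is constant, `N` is a cubic in `y'` with
only four independent coefficients (`prolongationCubic_eq_coeff`). Geometrically, solutions of `y''
= f` are the unparametrized geodesics of the torsion-free connection pulled back from the flat plane
by `Φ`, and this connection preserves `dx ∧ dy`. The functions `A, B, C, D` are its Christoffel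
symbols up to sign, and the three relations say that its curvature, a trace-free matrix, vanishes
(`coefficientRelationsAt_coeff`). Conversely, vanishing curvature makes the linear system for an
affine function `χ` and its two first derivatives completely integrable.
`exists_analytic_solution_of_flat` solves it analytically, and two solutions with independent
differentials form the required transformation (`equivalentToFreeAt_of_coefficients`). With `f = 0`
all coefficients vanish, so symmetries of `y'' = 0` have zero second derivatives and are affine.

For the bound on the dimension, infinitesimal symmetries are divergence-free fields `(ξ, η)`. The
symmetry condition, read at four slopes over one point, expresses their second derivatives linearly
through their first jet, so by a Gronwall estimate the field is determined by its first jet at one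
point (`IsSymmetryField.fieldJet_eq_zero`). Such a jet has five components, and effectiveness makes
the passage from tangent vectors of the group to fields injective
(`eq_zero_of_fundamentalField_eq_zero`); hence `r ≤ 5`.

If `r = 5`, every first jet is realized at every nearby point. Fields vanishing at a point force `f`
to be cubic over it (`exists_cubic_of_isotropy`), and the compatibility of their third derivatives
forces the curvature to vanish there (`coefficientRelationsAt_of_transitive`). So the equation is
equivalent to `y'' = 0`. In the other direction the affine group is conjugated by `Φ`
(`EquivalentToFreeAt.admitsASL2At`). A single equivalence class results because affine maps act
transitively on jets (`areaEquivalentAt_free`). -/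

/-! ### Partial derivatives -/

section PartialDerivatives

variable {F G : ℝ × ℝ → ℝ} {z : ℝ × ℝ}

@[fun_prop]
theorem AnalyticAt.fst_comp {E G H : Type*} [NormedAddCommGroup E] [NormedSpace ℝ E]
    [NormedAddCommGroup G] [NormedSpace ℝ G] [NormedAddCommGroup H] [NormedSpace ℝ H]
    {Φ : E → G × H} {z : E} (h : AnalyticAt ℝ Φ z) :
    AnalyticAt ℝ (fun w => (Φ w).1) z := analyticAt_fst.comp h

@[fun_prop]
theorem AnalyticAt.snd_comp {E G H : Type*} [NormedAddCommGroup E] [NormedSpace ℝ E]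
    [NormedAddCommGroup G] [NormedSpace ℝ G] [NormedAddCommGroup H] [NormedSpace ℝ H]
    {Φ : E → G × H} {z : E} (h : AnalyticAt ℝ Φ z) :
    AnalyticAt ℝ (fun w => (Φ w).2) z := analyticAt_snd.comp h

@[fun_prop]
theorem analyticAt_jetBase (p : ℝ × ℝ × ℝ) : AnalyticAt ℝ jetBase p := by
  unfold jetBase; fun_prop

@[fun_prop]
theorem AnalyticAt.partialX (hF : AnalyticAt ℝ F z) : AnalyticAt ℝ (partialX F) z :=
  ((ContinuousLinearMap.apply ℝ ℝ ((1, 0) : ℝ × ℝ)).analyticAt _).comp hF.fderiv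

@[fun_prop]
theorem AnalyticAt.partialY (hF : AnalyticAt ℝ F z) : AnalyticAt ℝ (partialY F) z :=
  ((ContinuousLinearMap.apply ℝ ℝ ((0, 1) : ℝ × ℝ)).analyticAt _).comp hF.fderiv

theorem fderiv_eq_partials (F : ℝ × ℝ → ℝ) (z h : ℝ × ℝ) :
    fderiv ℝ F z h = h.1 * partialX F z + h.2 * partialY F z := by
  have : h = h.1 • ((1, 0) : ℝ × ℝ) + h.2 • ((0, 1) : ℝ × ℝ) := by ext <;> simp
  conv_lhs => rw [this]
  rw [map_add, map_smul, map_smul]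
  rfl

theorem Filter.EventuallyEq.partialX_eq (h : F =ᶠ[𝓝 z] G) : _root_.partialX F z = _root_.partialX G z := by
  unfold _root_.partialX; rw [h.fderiv_eq]

theorem Filter.EventuallyEq.partialY_eq (h : F =ᶠ[𝓝 z] G) : _root_.partialY F z = _root_.partialY G z := by
  unfold _root_.partialY; rw [h.fderiv_eq]

theorem Filter.EventuallyEq.partialX (h : F =ᶠ[𝓝 z] G) :
    _root_.partialX F =ᶠ[𝓝 z] _root_.partialX G := by
  filter_upwards [h.fderiv (𝕜 := ℝ)] with w hw
  unfold _root_.partialX; rw [hw]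

theorem Filter.EventuallyEq.partialY (h : F =ᶠ[𝓝 z] G) :
    _root_.partialY F =ᶠ[𝓝 z] _root_.partialY G := by
  filter_upwards [h.fderiv (𝕜 := ℝ)] with w hw
  unfold _root_.partialY; rw [hw]

theorem partialX_const (c : ℝ) (z : ℝ × ℝ) : partialX (fun _ => c) z = 0 := by simp [partialX]
theorem partialY_const (c : ℝ) (z : ℝ × ℝ) : partialY (fun _ => c) z = 0 := by simp [partialY]

theorem partialX_fst (z : ℝ × ℝ) : partialX (fun w => w.1) z = 1 := by
  simp [partialX, fderiv_fst]
theorem partialY_fst (z : ℝ × ℝ) : partialY (fun w => w.1) z = 0 := by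
  simp [partialY, fderiv_fst]
theorem partialX_snd (z : ℝ × ℝ) : partialX (fun w => w.2) z = 0 := by
  simp [partialX, fderiv_snd]
theorem partialY_snd (z : ℝ × ℝ) : partialY (fun w => w.2) z = 1 := by
  simp [partialY, fderiv_snd]

theorem partialX_add (hF : AnalyticAt ℝ F z) (hG : AnalyticAt ℝ G z) :
    partialX (fun w => F w + G w) z = partialX F z + partialX G z := by
  simp [partialX, fderiv_fun_add hF.differentiableAt hG.differentiableAt]
theorem partialY_add (hF : AnalyticAt ℝ F z) (hG : AnalyticAt ℝ G z) :
    partialY (fun w => F w + G w) z = partialY F z + partialY G z := by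
  simp [partialY, fderiv_fun_add hF.differentiableAt hG.differentiableAt]
theorem partialX_sub (hF : AnalyticAt ℝ F z) (hG : AnalyticAt ℝ G z) :
    partialX (fun w => F w - G w) z = partialX F z - partialX G z := by
  simp [partialX, fderiv_fun_sub hF.differentiableAt hG.differentiableAt]
theorem partialY_sub (hF : AnalyticAt ℝ F z) (hG : AnalyticAt ℝ G z) :
    partialY (fun w => F w - G w) z = partialY F z - partialY G z := by
  simp [partialY, fderiv_fun_sub hF.differentiableAt hG.differentiableAt]
theorem partialX_neg : partialX (fun w => -F w) z = -partialX F z := by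
  simp [partialX, fderiv_fun_neg]
theorem partialY_neg : partialY (fun w => -F w) z = -partialY F z := by
  simp [partialY, fderiv_fun_neg]
theorem partialX_mul (hF : AnalyticAt ℝ F z) (hG : AnalyticAt ℝ G z) :
    partialX (fun w => F w * G w) z = F z * partialX G z + partialX F z * G z := by
  simp [partialX, fderiv_fun_mul hF.differentiableAt hG.differentiableAt, mul_comm]
theorem partialY_mul (hF : AnalyticAt ℝ F z) (hG : AnalyticAt ℝ G z) :
    partialY (fun w => F w * G w) z = F z * partialY G z + partialY F z * G z := by
  simp [partialY, fderiv_fun_mul hF.differentiableAt hG.differentiableAt, mul_comm]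

/-- Derivatives of an analytic function in two constant directions commute. -/
theorem AnalyticAt.fderiv_fderiv_comm {E : Type*} [NormedAddCommGroup E] [NormedSpace ℝ E]
    {F : E → ℝ} {z : E} (hF : AnalyticAt ℝ F z) (v w : E) :
    fderiv ℝ (fun x => fderiv ℝ F x v) z w = fderiv ℝ (fun x => fderiv ℝ F x w) z v := by
  have hs : IsSymmSndFDerivAt ℝ F z := (hF.contDiffAt (n := 2)).isSymmSndFDerivAt (by simp)
  have hd : DifferentiableAt ℝ (fderiv ℝ F) z := hF.fderiv.differentiableAt
  have key : ∀ v w, fderiv ℝ (fun x => fderiv ℝ F x v) z w = fderiv ℝ (fderiv ℝ F) z w v := by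
    intro v w
    rw [fderiv_clm_apply hd (differentiableAt_const _)]
    simp
  rw [key, key, hs.eq]

theorem partialX_partialY_comm (hF : AnalyticAt ℝ F z) :
    partialX (partialY F) z = partialY (partialX F) z :=
  hF.fderiv_fderiv_comm (0, 1) (1, 0)

theorem HasDerivAt.comp_partials {c d : ℝ → ℝ} {c' d' t : ℝ}
    (hF : AnalyticAt ℝ F (c t, d t)) (hc : HasDerivAt c c' t) (hd : HasDerivAt d d' t) :
    HasDerivAt (fun s => F (c s, d s))
      (c' * _root_.partialX F (c t, d t) + d' * _root_.partialY F (c t, d t)) t := by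
  have h := hF.differentiableAt.hasFDerivAt.comp_hasDerivAt t (hc.prodMk hd)
  rw [fderiv_eq_partials] at h
  exact h

theorem fderiv_comp_pair {c d : ℝ × ℝ → ℝ} (hF : AnalyticAt ℝ F (c z, d z))
    (hc : AnalyticAt ℝ c z) (hd : AnalyticAt ℝ d z) (h : ℝ × ℝ) :
    fderiv ℝ (fun w => F (c w, d w)) z h =
      partialX F (c z, d z) * fderiv ℝ c z h + partialY F (c z, d z) * fderiv ℝ d z h := by
  have := (HasFDerivAt.comp (g := F) (f := fun w => (c w, d w)) z hF.differentiableAt.hasFDerivAt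
    (hc.differentiableAt.hasFDerivAt.prodMk hd.differentiableAt.hasFDerivAt)).fderiv
  change fderiv ℝ (fun w => F (c w, d w)) z = _ at this
  rw [this, ContinuousLinearMap.comp_apply, fderiv_eq_partials]
  simp [mul_comm]

theorem partialX_comp_pair {c d : ℝ × ℝ → ℝ} (hF : AnalyticAt ℝ F (c z, d z))
    (hc : AnalyticAt ℝ c z) (hd : AnalyticAt ℝ d z) :
    partialX (fun w => F (c w, d w)) z =
      partialX F (c z, d z) * partialX c z + partialY F (c z, d z) * partialX d z :=
  fderiv_comp_pair hF hc hd (1, 0)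

theorem partialY_comp_pair {c d : ℝ × ℝ → ℝ} (hF : AnalyticAt ℝ F (c z, d z))
    (hc : AnalyticAt ℝ c z) (hd : AnalyticAt ℝ d z) :
    partialY (fun w => F (c w, d w)) z =
      partialX F (c z, d z) * partialY c z + partialY F (c z, d z) * partialY d z :=
  fderiv_comp_pair hF hc hd (0, 1)

theorem continuous_jetBase : Continuous jetBase := by unfold jetBase; fun_prop

theorem eventually_jetBase {P : ℝ × ℝ → Prop} {p : ℝ × ℝ × ℝ} (h : ∀ᶠ z in 𝓝 (jetBase p), P z) :
    ∀ᶠ p' in 𝓝 p, P (jetBase p') :=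
  continuous_jetBase.continuousAt.eventually h

theorem AnalyticAt.comp_jetBase {p : ℝ × ℝ × ℝ} (h : AnalyticAt ℝ F (jetBase p)) :
    AnalyticAt ℝ (fun p => F (jetBase p)) p := by
  exact AnalyticAt.comp (g := F) (f := jetBase) h (analyticAt_jetBase p)

theorem AnalyticAt.alongJet {p : ℝ × ℝ × ℝ} (h : AnalyticAt ℝ F (jetBase p)) :
    AnalyticAt ℝ (alongJet F) p := by
  have h1 := h.partialX.comp_jetBase
  have h2 := h.partialY.comp_jetBase
  unfold _root_.alongJet; fun_prop

/-- The second order part of the second total derivative of `F = F (x, y)`. -/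
noncomputable def quadJet (F : ℝ × ℝ → ℝ) (p : ℝ × ℝ × ℝ) : ℝ :=
  partialX (partialX F) (jetBase p) + 2 * p.2.2 * partialX (partialY F) (jetBase p) +
    p.2.2 ^ 2 * partialY (partialY F) (jetBase p)

/-- The term free of `y''` in the second prolongation of the point transformation `Φ`. -/
noncomputable def prolongationCubic (Φ : ℝ × ℝ → ℝ × ℝ) (p : ℝ × ℝ × ℝ) : ℝ :=
  alongJet (fun w => (Φ w).1) p * quadJet (fun w => (Φ w).2) p -
    alongJet (fun w => (Φ w).2) p * quadJet (fun w => (Φ w).1) p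

/-- A column operation: the terms with `y'` cancel. This is why `y''` enters the second prolongation
multiplied by the Jacobian. -/
theorem alongJet_det (Φ : ℝ × ℝ → ℝ × ℝ) (p : ℝ × ℝ × ℝ) :
    alongJet (fun w => (Φ w).1) p * partialY (fun w => (Φ w).2) (jetBase p) -
      alongJet (fun w => (Φ w).2) p * partialY (fun w => (Φ w).1) (jetBase p) =
      pointJacobian Φ (jetBase p) := by
  unfold alongJet pointJacobian; ring

theorem Filter.EventuallyEq.alongJet_eq {p : ℝ × ℝ × ℝ} (h : F =ᶠ[𝓝 (jetBase p)] G) :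
    _root_.alongJet F p = _root_.alongJet G p := by
  unfold _root_.alongJet; rw [h.partialX_eq, h.partialY_eq]

theorem Filter.EventuallyEq.quadJet_eq {p : ℝ × ℝ × ℝ} (h : F =ᶠ[𝓝 (jetBase p)] G) :
    quadJet F p = quadJet G p := by
  unfold quadJet; rw [h.partialX.partialX_eq, h.partialY.partialX_eq, h.partialY.partialY_eq]

theorem hasDerivAt_alongJet {u : ℝ → ℝ} {t s : ℝ} (hF : AnalyticAt ℝ F (t, u t))
    (hu : DifferentiableAt ℝ u t) (hs : HasDerivAt (deriv u) s t) :
    HasDerivAt (fun t => alongJet F (t, u t, deriv u t))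
      (quadJet F (t, u t, deriv u t) + s * partialY F (t, u t)) t := by
  have h1 := HasDerivAt.comp_partials (F := partialX F) hF.partialX (hasDerivAt_id t) hu.hasDerivAt
  have h2 := HasDerivAt.comp_partials (F := partialY F) hF.partialY (hasDerivAt_id t) hu.hasDerivAt
  refine (h1.add (hs.mul h2)).congr_deriv ?_
  simp only [quadJet, jetBase, id]
  rw [partialX_partialY_comm hF]
  ring

theorem hasDerivAt_along {u : ℝ → ℝ} {t : ℝ} (hF : AnalyticAt ℝ F (t, u t))
    (hu : DifferentiableAt ℝ u t) :
    HasDerivAt (fun t => F (t, u t)) (alongJet F (t, u t, deriv u t)) t := by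
  refine (HasDerivAt.comp_partials (F := F) hF (hasDerivAt_id t) hu.hasDerivAt).congr_deriv ?_
  simp [alongJet, jetBase]

end PartialDerivatives

/-! ### The action of a point transformation on jets of functions -/

section JetTransform

/-- The curves fed into this are only differentiable, with no continuity of `X'`, so the inverse
function theorem is not available. Strict monotonicity gives injectivity, the intermediate value
theorem gives an open image, and monotonicity gives continuity of the inverse. -/
theorem exists_local_inverse_Ioo_of_pos {X X' : ℝ → ℝ} {a b : ℝ}
    (hX : ∀ t ∈ Ioo a b, HasDerivAt X (X' t) t) (hpos : ∀ t ∈ Ioo a b, 0 < X' t) :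
    ∃ σ : ℝ → ℝ, IsOpen (X '' Ioo a b) ∧ (∀ t ∈ Ioo a b, σ (X t) = t) ∧
      ∀ t ∈ Ioo a b, HasDerivAt σ (X' t)⁻¹ (X t) := by
  have hmono : StrictMonoOn X (Ioo a b) := by
    refine strictMonoOn_of_deriv_pos (convex_Ioo a b)
      (fun t ht => (hX t ht).continuousAt.continuousWithinAt) fun t ht => ?_
    rw [interior_Ioo] at ht
    rw [(hX t ht).deriv]; exact hpos t ht
  have hopen : IsOpen (X '' Ioo a b) := by
    rw [isOpen_iff_mem_nhds]
    rintro _ ⟨t, ht, rfl⟩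
    obtain ⟨c, hac, hct⟩ := exists_between ht.1
    obtain ⟨d, htd, hdb⟩ := exists_between ht.2
    have hcd : c ≤ d := (hct.trans htd).le
    have hsub : Icc c d ⊆ Ioo a b := fun s hs => ⟨hac.trans_le hs.1, hs.2.trans_lt hdb⟩
    have hiv := intermediate_value_Icc hcd
      (fun s hs => (hX s (hsub hs)).continuousAt.continuousWithinAt)
    refine mem_of_superset (Icc_mem_nhds ?_ ?_) (hiv.trans (image_mono hsub))
    · exact hmono (hsub ⟨le_rfl, hcd⟩) ht hct
    · exact hmono ht (hsub ⟨hcd, le_rfl⟩) htd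
  have hinv : ∀ t ∈ Ioo a b, Function.invFunOn X (Ioo a b) (X t) = t := fun t ht =>
    hmono.injOn.leftInvOn_invFunOn ht
  refine ⟨Function.invFunOn X (Ioo a b), hopen, hinv, fun t ht => ?_⟩
  have hσmono : StrictMonoOn (Function.invFunOn X (Ioo a b)) (X '' Ioo a b) := by
    rintro _ ⟨s, hs, rfl⟩ _ ⟨t, ht, rfl⟩ hst
    rw [hinv s hs, hinv t ht]
    exact (hmono.lt_iff_lt hs ht).1 hst
  have himg : Function.invFunOn X (Ioo a b) '' (X '' Ioo a b) = Ioo a b := by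
    rw [image_image]
    exact (image_congr fun t ht => hinv t ht).trans (image_id' _)
  have hmem : X '' Ioo a b ∈ 𝓝 (X t) := hopen.mem_nhds (mem_image_of_mem X ht)
  have hcont : ContinuousAt (Function.invFunOn X (Ioo a b)) (X t) := by
    refine hσmono.continuousAt_of_image_mem_nhds hmem ?_
    rw [himg, hinv t ht]
    exact Ioo_mem_nhds ht.1 ht.2
  refine HasDerivAt.of_local_left_inverse (f := X) hcont ?_ (hpos t ht).ne' ?_
  · rw [hinv t ht]; exact hX t ht
  · filter_upwards [hmem]
    rintro _ ⟨s, hs, rfl⟩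
    rw [hinv s hs]

/-- A function on an interval with nowhere vanishing derivative has open range and a differentiable
inverse. -/
theorem exists_local_inverse_Ioo {X X' : ℝ → ℝ} {a b : ℝ}
    (hX : ∀ t ∈ Ioo a b, HasDerivAt X (X' t) t) (hne : ∀ t ∈ Ioo a b, X' t ≠ 0) :
    ∃ σ : ℝ → ℝ, IsOpen (X '' Ioo a b) ∧ (∀ t ∈ Ioo a b, σ (X t) = t) ∧
      ∀ t ∈ Ioo a b, HasDerivAt σ (X' t)⁻¹ (X t) := by
  -- Darboux: a nowhere vanishing derivative has constant sign, even if it is not continuous.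
  rcases hasDerivWithinAt_forall_lt_or_forall_gt_of_forall_ne (convex_Ioo a b)
    (fun t ht => (hX t ht).hasDerivWithinAt) hne with h | h
  · obtain ⟨σ, ho, h1, h2⟩ := exists_local_inverse_Ioo_of_pos (X := fun t => -X t)
      (X' := fun t => -X' t) (fun t ht => (hX t ht).fun_neg) (fun t ht => neg_pos.2 (h t ht))
    refine ⟨fun y => σ (-y), ?_, h1, fun t ht => ?_⟩
    · have : X '' Ioo a b = Neg.neg ⁻¹' ((fun t => -X t) '' Ioo a b) := by
        ext y
        simp only [mem_image, mem_preimage, neg_inj]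
      rw [this]
      exact ho.preimage continuous_neg
    · have := (h2 t ht).scomp (X t) (hasDerivAt_neg (X t))
      refine this.congr_deriv ?_
      simp [inv_neg]
  · exact exists_local_inverse_Ioo_of_pos hX h

variable {Φ : ℝ × ℝ → ℝ × ℝ} {u v : ℝ → ℝ} {a b : ℝ}

/-- First derivative of the transformed function. -/
theorem hasDerivAt_transform
    (hu : ∀ t ∈ Ioo a b, DifferentiableAt ℝ u t) (hΦ : ∀ t ∈ Ioo a b, AnalyticAt ℝ Φ (t, u t))
    (hT : ∀ t ∈ Ioo a b, alongJet (fun w => (Φ w).1) (t, u t, deriv u t) ≠ 0)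
    (hv : ∀ t ∈ Ioo a b, v (Φ (t, u t)).1 = (Φ (t, u t)).2) :
    IsOpen ((fun t => (Φ (t, u t)).1) '' Ioo a b) ∧
    (∀ t ∈ Ioo a b, HasDerivAt v (prolongation Φ (t, u t, deriv u t)).2.2 (Φ (t, u t)).1) ∧
    ∃ σ : ℝ → ℝ, (∀ t ∈ Ioo a b, σ (Φ (t, u t)).1 = t) ∧
      ∀ t ∈ Ioo a b, HasDerivAt σ (alongJet (fun w => (Φ w).1) (t, u t, deriv u t))⁻¹
        (Φ (t, u t)).1 := by
  have hX : ∀ t ∈ Ioo a b, HasDerivAt (fun t => (Φ (t, u t)).1)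
      (alongJet (fun w => (Φ w).1) (t, u t, deriv u t)) t := fun t ht =>
    hasDerivAt_along (F := fun w => (Φ w).1) (hΦ t ht).fst_comp (hu t ht)
  have hY : ∀ t ∈ Ioo a b, HasDerivAt (fun t => (Φ (t, u t)).2)
      (alongJet (fun w => (Φ w).2) (t, u t, deriv u t)) t := fun t ht =>
    hasDerivAt_along (F := fun w => (Φ w).2) (hΦ t ht).snd_comp (hu t ht)
  obtain ⟨σ, ho, h1, h2⟩ := exists_local_inverse_Ioo hX hT
  refine ⟨ho, fun t ht => ?_, σ, h1, h2⟩
  have h3 : HasDerivAt (fun t => (Φ (t, u t)).2)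
      (alongJet (fun w => (Φ w).2) (t, u t, deriv u t)) (σ (Φ (t, u t)).1) := by
    rw [h1 t ht]; exact hY t ht
  have h4 := h3.comp (Φ (t, u t)).1 (h2 t ht)
  refine (h4.congr_of_eventuallyEq ?_).congr_deriv ?_
  · filter_upwards [ho.mem_nhds (mem_image_of_mem _ ht)]
    rintro _ ⟨s, hs, rfl⟩
    simp only [Function.comp]
    rw [h1 s hs, hv s hs]
  · rw [prolongation, div_eq_mul_inv]

/-- Second derivative of the transformed function. -/
theorem hasDerivAt_deriv_transform
    (hu : ∀ t ∈ Ioo a b, DifferentiableAt ℝ u t) (hΦ : ∀ t ∈ Ioo a b, AnalyticAt ℝ Φ (t, u t))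
    (hT : ∀ t ∈ Ioo a b, alongJet (fun w => (Φ w).1) (t, u t, deriv u t) ≠ 0)
    (hv : ∀ t ∈ Ioo a b, v (Φ (t, u t)).1 = (Φ (t, u t)).2)
    {t s : ℝ} (ht : t ∈ Ioo a b) (hs : HasDerivAt (deriv u) s t) :
    HasDerivAt (deriv v)
      ((pointJacobian Φ (t, u t) * s + prolongationCubic Φ (t, u t, deriv u t)) /
        alongJet (fun w => (Φ w).1) (t, u t, deriv u t) ^ 3) (Φ (t, u t)).1 := by
  obtain ⟨ho, hd, σ, h1, h2⟩ := hasDerivAt_transform hu hΦ hT hv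
  have hX := hasDerivAt_alongJet (F := fun w => (Φ w).1) (hΦ t ht).fst_comp (hu t ht) hs
  have hY := hasDerivAt_alongJet (F := fun w => (Φ w).2) (hΦ t ht).snd_comp (hu t ht) hs
  have hq := hY.fun_div hX (hT t ht)
  have h4 := hq.comp_of_eq (Φ (t, u t)).1 (h2 t ht) (h1 t ht).symm
  refine (h4.congr_of_eventuallyEq ?_).congr_deriv ?_
  · filter_upwards [ho.mem_nhds (mem_image_of_mem _ ht)]
    rintro _ ⟨r, hr, rfl⟩
    simp only [Function.comp]
    rw [h1 r hr, (hd r hr).deriv]; rfl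
  · have hne := hT t ht
    have hdet := alongJet_det Φ (t, u t, deriv u t)
    simp only [jetBase] at hdet
    rw [← hdet, prolongationCubic]
    field_simp
    ring

/-- If the transformed function is twice differentiable, so is the original one. -/
theorem exists_hasDerivAt_deriv_of_transform
    (hu : ∀ t ∈ Ioo a b, DifferentiableAt ℝ u t) (hΦ : ∀ t ∈ Ioo a b, AnalyticAt ℝ Φ (t, u t))
    (hT : ∀ t ∈ Ioo a b, alongJet (fun w => (Φ w).1) (t, u t, deriv u t) ≠ 0)
    (hJ : ∀ t ∈ Ioo a b, pointJacobian Φ (t, u t) ≠ 0)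
    (hv : ∀ t ∈ Ioo a b, v (Φ (t, u t)).1 = (Φ (t, u t)).2)
    {t s : ℝ} (ht : t ∈ Ioo a b) (hs : HasDerivAt (deriv v) s (Φ (t, u t)).1) :
    ∃ s', HasDerivAt (deriv u) s' t := by
  obtain ⟨ho, hd, σ, h1, h2⟩ := hasDerivAt_transform hu hΦ hT hv
  have hX := hasDerivAt_along (F := fun w => (Φ w).1) (hΦ t ht).fst_comp (hu t ht)
  have hV : DifferentiableAt ℝ (fun t => deriv v (Φ (t, u t)).1) t :=
    (HasDerivAt.comp (h₂ := deriv v) (h := fun t => (Φ (t, u t)).1) t hs hX).differentiableAt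
  have hx1 := (hasDerivAt_along (hΦ t ht).fst_comp.partialX (hu t ht)).differentiableAt
  have hy1 := (hasDerivAt_along (hΦ t ht).fst_comp.partialY (hu t ht)).differentiableAt
  have hx2 := (hasDerivAt_along (hΦ t ht).snd_comp.partialX (hu t ht)).differentiableAt
  have hy2 := (hasDerivAt_along (hΦ t ht).snd_comp.partialY (hu t ht)).differentiableAt
  -- The new slope is a Möbius function of `u'` with determinant the Jacobian, so it can be solved
  -- for `u'`. The right-hand side only involves `u` and the differentiable function `v'`, hence
  -- `u'` is differentiable.
  have key : ∀ r ∈ Ioo a b,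
      partialY (fun w => (Φ w).1) (r, u r) * deriv v (Φ (r, u r)).1 -
        partialY (fun w => (Φ w).2) (r, u r) ≠ 0 ∧
      deriv u r = (partialX (fun w => (Φ w).2) (r, u r) -
        partialX (fun w => (Φ w).1) (r, u r) * deriv v (Φ (r, u r)).1) /
        (partialY (fun w => (Φ w).1) (r, u r) * deriv v (Φ (r, u r)).1 -
        partialY (fun w => (Φ w).2) (r, u r)) := by
    intro r hr
    have hne := hT r hr
    have hJ' := hJ r hr
    have e1 : deriv v (Φ (r, u r)).1 * alongJet (fun w => (Φ w).1) (r, u r, deriv u r) =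
        alongJet (fun w => (Φ w).2) (r, u r, deriv u r) := by
      rw [(hd r hr).deriv, prolongation]
      field_simp
    have hne' : partialY (fun w => (Φ w).1) (r, u r) * deriv v (Φ (r, u r)).1 -
        partialY (fun w => (Φ w).2) (r, u r) ≠ 0 := by
      intro h0
      apply hJ'
      have hdet := alongJet_det Φ (r, u r, deriv u r)
      simp only [jetBase] at hdet
      rw [← hdet, ← e1]
      linear_combination -alongJet (fun w => (Φ w).1) (r, u r, deriv u r) * h0
    refine ⟨hne', ?_⟩
    rw [eq_div_iff hne']
    simp only [alongJet, jetBase] at e1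
    linear_combination e1
  have hD := ((hx2.fun_sub (hx1.fun_mul hV)).fun_div ((hy1.fun_mul hV).fun_sub hy2) (key t ht).1).hasDerivAt
  refine ⟨_, hD.congr_of_eventuallyEq ?_⟩
  filter_upwards [Ioo_mem_nhds ht.1 ht.2] with r hr
  exact (key r hr).2

end JetTransform

/-! ### Pointwise form of the equivalence of equations -/

section CarriesAt

/-- The pointwise form, at the jet `p`, of the condition that the area-preserving transformation `Φ`
carries `y'' = f` to `y'' = g`. -/
structure CarriesAt (Φ : ℝ × ℝ → ℝ × ℝ) (f g : ℝ × ℝ × ℝ → ℝ) (p : ℝ × ℝ × ℝ) : Prop where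
  analytic : AnalyticAt ℝ Φ (jetBase p)
  areaPreserving : pointJacobian Φ (jetBase p) = 1
  transversal : alongJet (fun w => (Φ w).1) p ≠ 0
  eq : g (prolongation Φ p) * alongJet (fun w => (Φ w).1) p ^ 3 = f p + prolongationCubic Φ p

variable {Φ Ψ : ℝ × ℝ → ℝ × ℝ} {f g h : ℝ × ℝ × ℝ → ℝ} {W : Set (ℝ × ℝ × ℝ)} {p q : ℝ × ℝ × ℝ}

/-- The transformed second derivative is `(u'' + N) / (χ_x + y' χ_y) ^ 3`, so the pointwise identity
matches the two equations along any curve. The return direction first has to produce `u''`, as `u`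
is only assumed differentiable there. -/
theorem CarriesEquationOn.of_forall_carriesAt (H : ∀ p ∈ W, CarriesAt Φ f g p) :
    CarriesEquationOn Φ f g W := by
  refine ⟨fun p hp => (H p hp).analytic, fun p hp => (H p hp).areaPreserving,
    fun p hp => (H p hp).transversal, fun a b u v hu hv => ?_⟩
  have hu1 : ∀ t ∈ Ioo a b, DifferentiableAt ℝ u t := fun t ht => (hu t ht).1
  have hΦ : ∀ t ∈ Ioo a b, AnalyticAt ℝ Φ (t, u t) := fun t ht => (H _ (hu t ht).2).analytic
  have hT : ∀ t ∈ Ioo a b, alongJet (fun w => (Φ w).1) (t, u t, deriv u t) ≠ 0 :=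
    fun t ht => (H _ (hu t ht).2).transversal
  have hJ : ∀ t ∈ Ioo a b, pointJacobian Φ (t, u t) = 1 :=
    fun t ht => (H _ (hu t ht).2).areaPreserving
  obtain ⟨ho, hd, -⟩ := hasDerivAt_transform hu1 hΦ hT hv
  have hjet : ∀ t ∈ Ioo a b, ((Φ (t, u t)).1, v (Φ (t, u t)).1, deriv v (Φ (t, u t)).1) =
      prolongation Φ (t, u t, deriv u t) := fun t ht => by
    rw [hv t ht, (hd t ht).deriv]; rfl
  constructor
  · rintro hs _ ⟨t, ht, rfl⟩
    refine ⟨(hd t ht).differentiableAt, ?_⟩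
    have h2 := hasDerivAt_deriv_transform hu1 hΦ hT hv ht (hs t ht).2
    refine h2.congr_deriv ?_
    simp only []
    rw [hjet t ht, hJ t ht, div_eq_iff (pow_ne_zero 3 (hT t ht)), (H _ (hu t ht).2).eq]
    ring
  · intro hs t ht
    refine ⟨hu1 t ht, ?_⟩
    have hv2 := (hs _ (mem_image_of_mem _ ht)).2
    obtain ⟨s, hs'⟩ := exists_hasDerivAt_deriv_of_transform hu1 hΦ hT
      (fun t ht => by rw [hJ t ht]; exact one_ne_zero) hv ht hv2
    have h2 := (hasDerivAt_deriv_transform hu1 hΦ hT hv ht hs').unique hv2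
    rw [hjet t ht, hJ t ht, div_eq_iff (pow_ne_zero 3 (hT t ht)), (H _ (hu t ht).2).eq] at h2
    exact hs'.congr_deriv (by linarith)

theorem HasDerivAt.fst_comp {E F : Type*} [NormedAddCommGroup E] [NormedSpace ℝ E]
    [NormedAddCommGroup F] [NormedSpace ℝ F] {γ : ℝ → E × F} {γ' : E × F} {t : ℝ}
    (h : HasDerivAt γ γ' t) : HasDerivAt (fun t => (γ t).1) γ'.1 t :=
  (ContinuousLinearMap.fst ℝ E F).hasFDerivAt.comp_hasDerivAt t h

theorem HasDerivAt.snd_comp {E F : Type*} [NormedAddCommGroup E] [NormedSpace ℝ E]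
    [NormedAddCommGroup F] [NormedSpace ℝ F] {γ : ℝ → E × F} {γ' : E × F} {t : ℝ}
    (h : HasDerivAt γ γ' t) : HasDerivAt (fun t => (γ t).2) γ'.2 t :=
  (ContinuousLinearMap.snd ℝ E F).hasFDerivAt.comp_hasDerivAt t h

/-- Through every jet passes a solution. -/
theorem exists_solution_through_jet (hf : AnalyticAt ℝ f p) (hW : W ∈ 𝓝 p) :
    ∃ (u : ℝ → ℝ) (a b : ℝ), p.1 ∈ Ioo a b ∧ u p.1 = p.2.1 ∧ deriv u p.1 = p.2.2 ∧
      IsSolutionOn f u (Ioo a b) ∧ ∀ t ∈ Ioo a b, (t, u t, deriv u t) ∈ W := by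
  -- The equation as an autonomous first order system on the jet space, with the independent
  -- variable as first component; Picard–Lindelöf then applies.
  have hF : ContDiffAt ℝ 1 (fun q : ℝ × ℝ × ℝ => ((1 : ℝ), q.2.2, f q)) p := by
    have : AnalyticAt ℝ (fun q : ℝ × ℝ × ℝ => ((1 : ℝ), q.2.2, f q)) p := by fun_prop
    exact this.contDiffAt
  obtain ⟨γ, h0, ε, hε, hγ⟩ :=
    hF.exists_forall_mem_closedBall_exists_eq_forall_mem_Ioo_hasDerivAt₀ p.1
  have hmem0 : p.1 ∈ Ioo (p.1 - ε) (p.1 + ε) := ⟨by linarith, by linarith⟩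
  have hcont : ContinuousAt γ p.1 := (hγ _ hmem0).continuousAt
  have hW' : γ ⁻¹' W ∈ 𝓝 p.1 := hcont.preimage_mem_nhds (by rw [h0]; exact hW)
  obtain ⟨δ, hδ, hball⟩ := Metric.mem_nhds_iff.1 hW'
  rw [Real.ball_eq_Ioo] at hball
  have h1 : ∀ t ∈ Ioo (p.1 - ε) (p.1 + ε), HasDerivAt (fun t => (γ t).1) 1 t :=
    fun t ht => (hγ t ht).fst_comp
  have h2 : ∀ t ∈ Ioo (p.1 - ε) (p.1 + ε), HasDerivAt (fun t => (γ t).2.1) (γ t).2.2 t :=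
    fun t ht => (hγ t ht).snd_comp.fst_comp
  have h3 : ∀ t ∈ Ioo (p.1 - ε) (p.1 + ε), HasDerivAt (fun t => (γ t).2.2) (f (γ t)) t :=
    fun t ht => (hγ t ht).snd_comp.snd_comp
  have hfst : ∀ t ∈ Ioo (p.1 - ε) (p.1 + ε), (γ t).1 = t := by
    intro t ht
    have hc := isOpen_Ioo.is_const_of_deriv_eq_zero isPreconnected_Ioo
      (f := fun t => (γ t).1 - t) (fun s hs =>
        ((h1 s hs).fun_sub (hasDerivAt_id' s)).differentiableAt.differentiableWithinAt)
      (fun s hs => by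
        have := ((h1 s hs).fun_sub (hasDerivAt_id' s)).deriv
        simpa using this) ht hmem0
    simp only [h0, sub_self] at hc
    linarith
  have hjet : ∀ t ∈ Ioo (p.1 - ε) (p.1 + ε), (t, (γ t).2.1, deriv (fun t => (γ t).2.1) t) = γ t := by
    intro t ht
    rw [(h2 t ht).deriv]
    ext <;> simp [hfst t ht]
  set r := min ε δ
  have hr : 0 < r := lt_min hε hδ
  have hsub : Ioo (p.1 - r) (p.1 + r) ⊆ Ioo (p.1 - ε) (p.1 + ε) :=
    Ioo_subset_Ioo (by linarith [min_le_left ε δ]) (by linarith [min_le_left ε δ])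
  have hsub' : Ioo (p.1 - r) (p.1 + r) ⊆ Ioo (p.1 - δ) (p.1 + δ) :=
    Ioo_subset_Ioo (by linarith [min_le_right ε δ]) (by linarith [min_le_right ε δ])
  refine ⟨fun t => (γ t).2.1, p.1 - r, p.1 + r, ⟨by linarith, by linarith⟩, by simp [h0], ?_,
    fun t ht => ⟨(h2 t (hsub ht)).differentiableAt, ?_⟩, fun t ht => ?_⟩
  · rw [(h2 _ hmem0).deriv, h0]
  · rw [hjet t (hsub ht)]
    refine (h3 t (hsub ht)).congr_of_eventuallyEq ?_
    filter_upwards [isOpen_Ioo.mem_nhds (hsub ht)] with s hs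
    exact (h2 s hs).deriv
  · rw [hjet t (hsub ht)]
    exact hball (hsub' ht)

/-- Test the hypothesis on a solution through `p` and compare two values of the second derivative of
its image: one from the chain rule, one from the equation with right-hand side `g`. Nothing is
required of `g`. -/
theorem CarriesEquationOn.carriesAt (H : CarriesEquationOn Φ f g W) (hW : W ∈ 𝓝 p)
    (hf : AnalyticAt ℝ f p) : CarriesAt Φ f g p := by
  have hp : p ∈ W := mem_of_mem_nhds hW
  refine ⟨H.analytic p hp, H.areaPreserving p hp, H.transversal p hp, ?_⟩
  obtain ⟨u, a, b, hmem, hu0, hu1, hsol, hjet⟩ := exists_solution_through_jet hf hW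
  have hud : ∀ t ∈ Ioo a b, DifferentiableAt ℝ u t := fun t ht => (hsol t ht).1
  have hΦ : ∀ t ∈ Ioo a b, AnalyticAt ℝ Φ (t, u t) := fun t ht => H.analytic _ (hjet t ht)
  have hT : ∀ t ∈ Ioo a b, alongJet (fun w => (Φ w).1) (t, u t, deriv u t) ≠ 0 :=
    fun t ht => H.transversal _ (hjet t ht)
  obtain ⟨σ, ho, hσ, -⟩ := exists_local_inverse_Ioo (fun t ht =>
    hasDerivAt_along (F := fun w => (Φ w).1) (hΦ t ht).fst_comp (hud t ht)) hT
  set v : ℝ → ℝ := fun y => (Φ (σ y, u (σ y))).2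
  have hv : ∀ t ∈ Ioo a b, v (Φ (t, u t)).1 = (Φ (t, u t)).2 := fun t ht => by
    simp only [v]; rw [hσ t ht]
  have hsol' := (H.solutions a b u v (fun t ht => ⟨hud t ht, hjet t ht⟩) hv).1 hsol
  obtain ⟨-, hd, -⟩ := hasDerivAt_transform hud hΦ hT hv
  have hpj : ((p.1, u p.1, deriv u p.1) : ℝ × ℝ × ℝ) = p := by rw [hu0, hu1]
  have hpb : ((p.1, u p.1) : ℝ × ℝ) = jetBase p := by rw [hu0]; rfl
  have e1 := (hasDerivAt_deriv_transform hud hΦ hT hv hmem (hsol _ hmem).2).unique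
    (hsol' _ (mem_image_of_mem _ hmem)).2
  have e2 : ((Φ (p.1, u p.1)).1, v (Φ (p.1, u p.1)).1, deriv v (Φ (p.1, u p.1)).1) =
      prolongation Φ p := by
    rw [hv _ hmem, (hd _ hmem).deriv, hpj, hpb]; rfl
  rw [e2, hpj, hpb, H.areaPreserving p hp, div_eq_iff (pow_ne_zero 3 (H.transversal p hp))] at e1
  linarith

/-- The bridge from solutions to jets: after it, local equivalence is handled only through
derivatives of `Φ`. -/
theorem carriesAt_eventually_iff (hf : AnalyticAt ℝ f p) :
    (∃ W ∈ 𝓝 p, CarriesEquationOn Φ f g W) ↔ ∀ᶠ p' in 𝓝 p, CarriesAt Φ f g p' := by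
  constructor
  · rintro ⟨W, hW, H⟩
    filter_upwards [eventually_mem_nhds_iff.2 hW, hf.eventually_analyticAt] with p' h1 h2
    exact H.carriesAt h1 h2
  · intro h
    exact ⟨_, h, CarriesEquationOn.of_forall_carriesAt fun p hp => hp⟩

theorem areaEquivalentAt_iff (hf : AnalyticAt ℝ f p) :
    AreaEquivalentAt f p g q ↔
      ∃ Φ, (∀ᶠ p' in 𝓝 p, CarriesAt Φ f g p') ∧ prolongation Φ p = q := by
  constructor
  · rintro ⟨Φ, W, hW, H, hq⟩
    exact ⟨Φ, (carriesAt_eventually_iff hf).1 ⟨W, hW, H⟩, hq⟩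
  · rintro ⟨Φ, H, hq⟩
    obtain ⟨W, hW, H'⟩ := (carriesAt_eventually_iff hf).2 H
    exact ⟨Φ, W, hW, H', hq⟩

end CarriesAt

/-! ### Composition and inversion -/

section Composition

variable {Φ Ψ : ℝ × ℝ → ℝ × ℝ} {f g h : ℝ × ℝ × ℝ → ℝ} {p q : ℝ × ℝ × ℝ} {F : ℝ × ℝ → ℝ} {z : ℝ × ℝ}

theorem partialX_comp (hF : AnalyticAt ℝ F (Φ z)) (hΦ : AnalyticAt ℝ Φ z) :
    partialX (fun w => F (Φ w)) z = partialX F (Φ z) * partialX (fun w => (Φ w).1) z +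
      partialY F (Φ z) * partialX (fun w => (Φ w).2) z :=
  partialX_comp_pair (c := fun w => (Φ w).1) (d := fun w => (Φ w).2) hF hΦ.fst_comp hΦ.snd_comp

theorem partialY_comp (hF : AnalyticAt ℝ F (Φ z)) (hΦ : AnalyticAt ℝ Φ z) :
    partialY (fun w => F (Φ w)) z = partialX F (Φ z) * partialY (fun w => (Φ w).1) z +
      partialY F (Φ z) * partialY (fun w => (Φ w).2) z :=
  partialY_comp_pair (c := fun w => (Φ w).1) (d := fun w => (Φ w).2) hF hΦ.fst_comp hΦ.snd_comp

theorem pointJacobian_comp (hΨ : AnalyticAt ℝ Ψ (Φ z)) (hΦ : AnalyticAt ℝ Φ z) :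
    pointJacobian (fun w => Ψ (Φ w)) z = pointJacobian Ψ (Φ z) * pointJacobian Φ z := by
  unfold pointJacobian
  rw [partialX_comp hΨ.fst_comp hΦ, partialX_comp hΨ.snd_comp hΦ, partialY_comp hΨ.fst_comp hΦ,
    partialY_comp hΨ.snd_comp hΦ]
  ring

theorem jetBase_prolongation : jetBase (prolongation Φ p) = Φ (jetBase p) := rfl

theorem alongJet_comp (hF : AnalyticAt ℝ F (Φ (jetBase p))) (hΦ : AnalyticAt ℝ Φ (jetBase p))
    (hT : alongJet (fun w => (Φ w).1) p ≠ 0) :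
    alongJet (fun w => F (Φ w)) p =
      alongJet (fun w => (Φ w).1) p * alongJet F (prolongation Φ p) := by
  have h1 : alongJet (fun w => F (Φ w)) p =
      partialX F (Φ (jetBase p)) * alongJet (fun w => (Φ w).1) p +
        partialY F (Φ (jetBase p)) * alongJet (fun w => (Φ w).2) p := by
    unfold alongJet
    rw [partialX_comp hF hΦ, partialY_comp hF hΦ]
    ring
  have h2 : alongJet F (prolongation Φ p) = partialX F (Φ (jetBase p)) +
      alongJet (fun w => (Φ w).2) p / alongJet (fun w => (Φ w).1) p *
        partialY F (Φ (jetBase p)) := rfl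
  rw [h1, h2]
  field_simp

theorem prolongation_comp (hΨ : AnalyticAt ℝ Ψ (Φ (jetBase p))) (hΦ : AnalyticAt ℝ Φ (jetBase p))
    (hT : alongJet (fun w => (Φ w).1) p ≠ 0) :
    prolongation (fun w => Ψ (Φ w)) p = prolongation Ψ (prolongation Φ p) := by
  have h : prolongation (fun w => Ψ (Φ w)) p = ((Ψ (Φ (jetBase p))).1, (Ψ (Φ (jetBase p))).2,
    alongJet (fun w => (Ψ (Φ w)).2) p / alongJet (fun w => (Ψ (Φ w)).1) p) := rfl
  rw [h, alongJet_comp hΨ.fst_comp hΦ hT, alongJet_comp hΨ.snd_comp hΦ hT,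
    mul_div_mul_left _ _ hT]
  rfl

/-- Second order chain rule. The last term is the Hessian of `F` on the pushed forward tangent
vector, which is `χ_x + y' χ_y` times `(1, new slope)`; hence the square. -/
theorem quadJet_comp (hF : AnalyticAt ℝ F (Φ (jetBase p))) (hΦ : AnalyticAt ℝ Φ (jetBase p))
    (hT : alongJet (fun w => (Φ w).1) p ≠ 0) :
    quadJet (fun w => F (Φ w)) p =
      partialX F (Φ (jetBase p)) * quadJet (fun w => (Φ w).1) p +
      partialY F (Φ (jetBase p)) * quadJet (fun w => (Φ w).2) p +
      alongJet (fun w => (Φ w).1) p ^ 2 * quadJet F (prolongation Φ p) := by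
  set z := jetBase p with hz
  have hΦ' := hΦ.eventually_analyticAt
  have hF' : ∀ᶠ w in 𝓝 z, AnalyticAt ℝ F (Φ w) := hΦ.continuousAt.eventually hF.eventually_analyticAt
  have eX : partialX (fun w => F (Φ w)) =ᶠ[𝓝 z] fun w =>
      partialX F (Φ w) * partialX (fun w => (Φ w).1) w +
        partialY F (Φ w) * partialX (fun w => (Φ w).2) w := by
    filter_upwards [hΦ', hF'] with w h1 h2
    exact partialX_comp h2 h1
  have eY : partialY (fun w => F (Φ w)) =ᶠ[𝓝 z] fun w =>
      partialX F (Φ w) * partialY (fun w => (Φ w).1) w +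
        partialY F (Φ w) * partialY (fun w => (Φ w).2) w := by
    filter_upwards [hΦ', hF'] with w h1 h2
    exact partialY_comp h2 h1
  have a1 := hΦ.fst_comp
  have a2 := hΦ.snd_comp
  have b1 : AnalyticAt ℝ (fun w => partialX F (Φ w)) z := hF.partialX.comp hΦ
  have b2 : AnalyticAt ℝ (fun w => partialY F (Φ w)) z := hF.partialY.comp hΦ
  have q : quadJet F (prolongation Φ p) = partialX (partialX F) (Φ z) +
      2 * (alongJet (fun w => (Φ w).2) p / alongJet (fun w => (Φ w).1) p) *
        partialX (partialY F) (Φ z) +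
      (alongJet (fun w => (Φ w).2) p / alongJet (fun w => (Φ w).1) p) ^ 2 *
        partialY (partialY F) (Φ z) := rfl
  have hq : alongJet (fun w => (Φ w).1) p ^ 2 * quadJet F (prolongation Φ p) =
      alongJet (fun w => (Φ w).1) p ^ 2 * partialX (partialX F) (Φ z) +
      2 * (alongJet (fun w => (Φ w).1) p * alongJet (fun w => (Φ w).2) p) *
        partialX (partialY F) (Φ z) +
      alongJet (fun w => (Φ w).2) p ^ 2 * partialY (partialY F) (Φ z) := by
    rw [q]; field_simp
  rw [hq]
  simp only [quadJet, ← hz]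
  rw [eX.partialX_eq, eY.partialX_eq, eY.partialY_eq,
    partialX_add (b1.fun_mul a1.partialX) (b2.fun_mul a2.partialX),
    partialX_add (b1.fun_mul a1.partialY) (b2.fun_mul a2.partialY),
    partialY_add (b1.fun_mul a1.partialY) (b2.fun_mul a2.partialY),
    partialX_mul b1 a1.partialX, partialX_mul b2 a2.partialX, partialX_mul b1 a1.partialY,
    partialX_mul b2 a2.partialY, partialY_mul b1 a1.partialY, partialY_mul b2 a2.partialY,
    partialX_comp hF.partialX hΦ, partialX_comp hF.partialY hΦ, partialY_comp hF.partialX hΦ,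
    partialY_comp hF.partialY hΦ, partialX_partialY_comm hF]
  simp only [alongJet, ← hz]
  ring

/-- A cocycle identity: the cubic measures the failure to be affine, and under composition it adds
up with the weights matching the factor `(χ_x + y' χ_y) ^ 3` in `CarriesAt`. Both composition and
inversion of equivalences rest on it. -/
theorem prolongationCubic_comp (hΨ : AnalyticAt ℝ Ψ (Φ (jetBase p)))
    (hΦ : AnalyticAt ℝ Φ (jetBase p)) (hT : alongJet (fun w => (Φ w).1) p ≠ 0) :
    prolongationCubic (fun w => Ψ (Φ w)) p =
      alongJet (fun w => (Φ w).1) p ^ 3 * prolongationCubic Ψ (prolongation Φ p) +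
      pointJacobian Ψ (Φ (jetBase p)) * prolongationCubic Φ p := by
  have e : prolongationCubic (fun w => Ψ (Φ w)) p =
    alongJet (fun w => (Ψ (Φ w)).1) p * quadJet (fun w => (Ψ (Φ w)).2) p -
    alongJet (fun w => (Ψ (Φ w)).2) p * quadJet (fun w => (Ψ (Φ w)).1) p := rfl
  rw [e, alongJet_comp hΨ.fst_comp hΦ hT, alongJet_comp hΨ.snd_comp hΦ hT,
    quadJet_comp hΨ.fst_comp hΦ hT, quadJet_comp hΨ.snd_comp hΦ hT]
  have h1 : ∀ F : ℝ × ℝ → ℝ, alongJet F (prolongation Φ p) = partialX F (Φ (jetBase p)) +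
      alongJet (fun w => (Φ w).2) p / alongJet (fun w => (Φ w).1) p *
        partialY F (Φ (jetBase p)) := fun _ => rfl
  simp only [prolongationCubic, h1, pointJacobian]
  field_simp
  ring

theorem CarriesAt.comp (H2 : CarriesAt Ψ g h (prolongation Φ p)) (H1 : CarriesAt Φ f g p) :
    CarriesAt (fun w => Ψ (Φ w)) f h p := by
  have hΦ := H1.analytic
  have hT := H1.transversal
  have hΨ : AnalyticAt ℝ Ψ (Φ (jetBase p)) := H2.analytic
  refine ⟨hΨ.comp hΦ, ?_, ?_, ?_⟩
  · have := H2.areaPreserving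
    rw [jetBase_prolongation] at this
    rw [pointJacobian_comp hΨ hΦ, this, H1.areaPreserving, one_mul]
  · rw [alongJet_comp hΨ.fst_comp hΦ hT]
    exact mul_ne_zero hT H2.transversal
  · have hJ := H2.areaPreserving
    rw [jetBase_prolongation] at hJ
    rw [prolongation_comp hΨ hΦ hT, alongJet_comp hΨ.fst_comp hΦ hT,
      prolongationCubic_comp hΨ hΦ hT, hJ, mul_pow]
    linear_combination alongJet (fun w => (Φ w).1) p ^ 3 * H2.eq + H1.eq

theorem Filter.EventuallyEq.fst_snd_comp (h : Φ =ᶠ[𝓝 z] Ψ) :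
    (fun w => (Φ w).1) =ᶠ[𝓝 z] (fun w => (Ψ w).1) ∧
      (fun w => (Φ w).2) =ᶠ[𝓝 z] (fun w => (Ψ w).2) :=
  ⟨h.fun_comp Prod.fst, h.fun_comp Prod.snd⟩

theorem Filter.EventuallyEq.pointJacobian_eq (h : Φ =ᶠ[𝓝 z] Ψ) :
    pointJacobian Φ z = pointJacobian Ψ z := by
  obtain ⟨h1, h2⟩ := h.fst_snd_comp
  unfold pointJacobian
  rw [h1.partialX_eq, h1.partialY_eq, h2.partialX_eq, h2.partialY_eq]

theorem Filter.EventuallyEq.prolongation_eq (h : Φ =ᶠ[𝓝 (jetBase p)] Ψ) :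
    prolongation Φ p = prolongation Ψ p := by
  obtain ⟨h1, h2⟩ := h.fst_snd_comp
  unfold prolongation
  rw [h1.alongJet_eq, h2.alongJet_eq, h.eq_of_nhds]

theorem Filter.EventuallyEq.prolongationCubic_eq (h : Φ =ᶠ[𝓝 (jetBase p)] Ψ) :
    prolongationCubic Φ p = prolongationCubic Ψ p := by
  obtain ⟨h1, h2⟩ := h.fst_snd_comp
  unfold prolongationCubic
  rw [h1.alongJet_eq, h2.alongJet_eq, h1.quadJet_eq, h2.quadJet_eq]

theorem CarriesAt.congr (H : CarriesAt Φ f g p) (h : Φ =ᶠ[𝓝 (jetBase p)] Ψ) :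
    CarriesAt Ψ f g p :=
  ⟨H.analytic.congr h, h.pointJacobian_eq ▸ H.areaPreserving,
    h.fst_snd_comp.1.alongJet_eq ▸ H.transversal, by
      rw [← h.prolongation_eq, ← h.fst_snd_comp.1.alongJet_eq, ← h.prolongationCubic_eq]
      exact H.eq⟩

theorem prolongationCubic_id : prolongationCubic (fun w => w) p = 0 := by
  have h1 : partialX (fun w : ℝ × ℝ => w.1) = fun _ => 1 := funext partialX_fst
  have h2 : partialY (fun w : ℝ × ℝ => w.1) = fun _ => 0 := funext partialY_fst
  have h3 : partialX (fun w : ℝ × ℝ => w.2) = fun _ => 0 := funext partialX_snd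
  have h4 : partialY (fun w : ℝ × ℝ => w.2) = fun _ => 1 := funext partialY_snd
  simp [prolongationCubic, quadJet, h1, h2, h3, h4, partialX_const, partialY_const]

theorem prolongation_id : prolongation (fun w => w) p = p := by
  simp [prolongation, alongJet, jetBase, partialX_fst, partialX_snd, partialY_fst, partialY_snd]

theorem alongJet_fst : alongJet (fun w => w.1) p = 1 := by
  simp [alongJet, partialX_fst, partialY_fst]

theorem pointJacobian_id : pointJacobian (fun w => w) z = 1 := by
  simp [pointJacobian, partialX_fst, partialX_snd, partialY_fst, partialY_snd]

theorem continuousAt_prolongation (hΦ : AnalyticAt ℝ Φ (jetBase p))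
    (hT : alongJet (fun w => (Φ w).1) p ≠ 0) : ContinuousAt (prolongation Φ) p := by
  have h1 := hΦ.fst_comp.alongJet.continuousAt
  have h2 := hΦ.snd_comp.alongJet.continuousAt
  have h3 : ContinuousAt (fun p => Φ (jetBase p)) p :=
    hΦ.continuousAt.comp continuous_jetBase.continuousAt
  exact h3.fst.prodMk (h3.snd.prodMk (h2.div h1 hT))

/-- Local real analytic inverse of an area-preserving map. -/
theorem exists_analytic_local_inverse (hΦ : AnalyticAt ℝ Φ z) (hJ : pointJacobian Φ z ≠ 0) :
    ∃ Ψ : ℝ × ℝ → ℝ × ℝ, AnalyticAt ℝ Ψ (Φ z) ∧ (∀ᶠ w in 𝓝 z, Ψ (Φ w) = w) ∧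
      ∀ᶠ w in 𝓝 (Φ z), Φ (Ψ w) = w := by
  have hd : ∀ h, fderiv ℝ Φ z h = (h.1 * partialX (fun w => (Φ w).1) z +
      h.2 * partialY (fun w => (Φ w).1) z, h.1 * partialX (fun w => (Φ w).2) z +
      h.2 * partialY (fun w => (Φ w).2) z) := by
    intro h
    rw [← fderiv_eq_partials, ← fderiv_eq_partials]
    have h1 := (hasFDerivAt_fst (𝕜 := ℝ)).comp z hΦ.differentiableAt.hasFDerivAt
    have h2 := (hasFDerivAt_snd (𝕜 := ℝ)).comp z hΦ.differentiableAt.hasFDerivAt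
    have e1 : fderiv ℝ (fun w => (Φ w).1) z = _ := h1.fderiv
    have e2 : fderiv ℝ (fun w => (Φ w).2) z = _ := h2.fderiv
    rw [e1, e2]
    simp
  have hinj : Function.Injective (fderiv ℝ Φ z : ℝ × ℝ →ₗ[ℝ] ℝ × ℝ) := by
    rw [← LinearMap.ker_eq_bot, LinearMap.ker_eq_bot']
    intro h hh
    have hh' : fderiv ℝ Φ z h = 0 := hh
    rw [hd, Prod.mk_eq_zero] at hh'
    obtain ⟨e1, e2⟩ := hh'
    unfold pointJacobian at hJ
    ext
    · refine (mul_eq_zero.1 ?_).resolve_right hJ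
      linear_combination partialY (fun w => (Φ w).2) z * e1 - partialY (fun w => (Φ w).1) z * e2
    · refine (mul_eq_zero.1 ?_).resolve_right hJ
      linear_combination partialX (fun w => (Φ w).1) z * e2 - partialX (fun w => (Φ w).2) z * e1
  let e : (ℝ × ℝ) ≃L[ℝ] ℝ × ℝ :=
    (LinearEquiv.ofInjectiveEndo (fderiv ℝ Φ z : ℝ × ℝ →ₗ[ℝ] ℝ × ℝ) hinj).toContinuousLinearEquiv
  have he : HasFDerivAt Φ (e : ℝ × ℝ →L[ℝ] ℝ × ℝ) z := by
    have : (e : ℝ × ℝ →L[ℝ] ℝ × ℝ) = fderiv ℝ Φ z := by ext <;> rfl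
    rw [this]; exact hΦ.differentiableAt.hasFDerivAt
  -- Here `⊤` is the analytic smoothness exponent `ω`, so the inverse function theorem returns an
  -- analytic inverse.
  have hc : ContDiffAt ℝ ⊤ Φ z := hΦ.contDiffAt
  have hs := hc.hasStrictFDerivAt' he (by simp)
  refine ⟨hc.localInverse he (by simp), ?_, ?_, ?_⟩
  · have := hc.to_localInverse he (by simp)
    rwa [← contDiffWithinAt_univ, contDiffWithinAt_omega_iff_analyticWithinAt,
      analyticWithinAt_univ] at this
  · exact hs.eventually_left_inverse
  · exact hs.eventually_right_inverse

/-- The inverse transformation carries the equations backwards. -/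
theorem CarriesAt.exists_inverse (H : ∀ᶠ p' in 𝓝 p, CarriesAt Φ f g p') :
    ∃ Ψ : ℝ × ℝ → ℝ × ℝ, AnalyticAt ℝ Ψ (Φ (jetBase p)) ∧
      (∀ᶠ w in 𝓝 (jetBase p), Ψ (Φ w) = w) ∧ (∀ᶠ w in 𝓝 (Φ (jetBase p)), Φ (Ψ w) = w) ∧
      (∀ᶠ q in 𝓝 (prolongation Φ p), CarriesAt Ψ g f q) ∧
      prolongation Ψ (prolongation Φ p) = p := by
  have H0 := H.self_of_nhds
  obtain ⟨Ψ, hΨ, hl, hr⟩ := exists_analytic_local_inverse H0.analytic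
    (by rw [H0.areaPreserving]; exact one_ne_zero)
  have hT := H0.transversal
  have hpp : prolongation Ψ (prolongation Φ p) = p := by
    rw [← prolongation_comp hΨ H0.analytic hT]
    exact (Filter.EventuallyEq.prolongation_eq (Ψ := fun w => w) hl).trans prolongation_id
  have hTΨ : alongJet (fun w => (Ψ w).1) (prolongation Φ p) ≠ 0 := by
    intro h0
    have h1 := alongJet_comp hΨ.fst_comp H0.analytic hT
    rw [h0, mul_zero, Filter.EventuallyEq.alongJet_eq (G := fun w => w.1) (hl.mono fun w hw => congrArg Prod.fst hw),
      alongJet_fst] at h1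
    exact one_ne_zero h1
  have hcont : ContinuousAt (prolongation Ψ) (prolongation Φ p) := continuousAt_prolongation hΨ hTΨ
  have hev : ∀ᶠ q in 𝓝 (prolongation Φ p), CarriesAt Φ f g (prolongation Ψ q) :=
    hcont.eventually (by rw [hpp]; exact H)
  have hTev : ∀ᶠ q in 𝓝 (prolongation Φ p), alongJet (fun w => (Ψ w).1) q ≠ 0 :=
    (hΨ.fst_comp.alongJet (p := prolongation Φ p)).continuousAt.eventually_ne hTΨ
  refine ⟨Ψ, hΨ, hl, hr, ?_, hpp⟩
  filter_upwards [hev, hTev, eventually_jetBase (p := prolongation Φ p) hΨ.eventually_analyticAt,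
    eventually_jetBase (p := prolongation Φ p) hr.eventually_nhds] with q h1 h2 h3 h4
  have hΦ1 : AnalyticAt ℝ Φ (Ψ (jetBase q)) := h1.analytic
  have h4' : (fun w => Φ (Ψ w)) =ᶠ[𝓝 (jetBase q)] fun w => w := h4
  -- Each composition formula is applied to `Φ ∘ Ψ`, which is the identity near `jetBase q`. This
  -- expresses the Jacobian, the transversality factor and the cubic of `Ψ` through those of `Φ`.
  have hJ := pointJacobian_comp hΦ1 h3
  rw [h4'.pointJacobian_eq, pointJacobian_id] at hJ
  have hJ1 : pointJacobian Φ (Ψ (jetBase q)) = 1 := h1.areaPreserving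
  rw [hJ1, one_mul] at hJ
  have hA := alongJet_comp hΦ1.fst_comp h3 h2
  rw [h4'.fst_snd_comp.1.alongJet_eq, alongJet_fst] at hA
  have hN := prolongationCubic_comp hΦ1 h3 h2
  rw [h4'.prolongationCubic_eq, prolongationCubic_id, hJ1] at hN
  have hP := prolongation_comp hΦ1 h3 h2
  rw [h4'.prolongation_eq, prolongation_id] at hP
  refine ⟨h3, hJ.symm, h2, ?_⟩
  have e := h1.eq
  rw [← hP] at e
  have hA3 : alongJet (fun w => (Ψ w).1) q ^ 3 *
      alongJet (fun w => (Φ w).1) (prolongation Ψ q) ^ 3 = 1 := by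
    rw [← mul_pow, ← hA, one_pow]
  linear_combination (-alongJet (fun w => (Ψ w).1) q ^ 3) * e + g q * hA3 + hN

end Composition

/-! ### The cubic attached to an area-preserving transformation -/

section Coefficients

variable {Φ : ℝ × ℝ → ℝ × ℝ} {z : ℝ × ℝ} {F : ℝ × ℝ → ℝ}

/-- The `2 × 2` determinant `F₂ G₁ - F₁ G₂` of two pairs of functions. -/
def pairDet (F₁ F₂ G₁ G₂ : ℝ × ℝ → ℝ) (w : ℝ × ℝ) : ℝ := F₂ w * G₁ w - F₁ w * G₂ w

/-- When the Jacobian is `1`, Cramer's rule makes these four determinants the coefficients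
expressing the second derivatives of `χ` and `φ` through their first derivatives: up to sign, the
Christoffel symbols of the pulled back flat connection. -/
noncomputable def coeffA (Φ : ℝ × ℝ → ℝ × ℝ) : ℝ × ℝ → ℝ :=
  pairDet (partialY fun w => (Φ w).1) (partialY fun w => (Φ w).2)
    (partialY (partialY fun w => (Φ w).1)) (partialY (partialY fun w => (Φ w).2))

noncomputable def coeffB (Φ : ℝ × ℝ → ℝ × ℝ) : ℝ × ℝ → ℝ :=
  pairDet (partialY fun w => (Φ w).1) (partialY fun w => (Φ w).2)
    (partialX (partialY fun w => (Φ w).1)) (partialX (partialY fun w => (Φ w).2))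

noncomputable def coeffC (Φ : ℝ × ℝ → ℝ × ℝ) : ℝ × ℝ → ℝ :=
  pairDet (partialX fun w => (Φ w).1) (partialX fun w => (Φ w).2)
    (partialX (partialY fun w => (Φ w).1)) (partialX (partialY fun w => (Φ w).2))

noncomputable def coeffD (Φ : ℝ × ℝ → ℝ × ℝ) : ℝ × ℝ → ℝ :=
  pairDet (partialX fun w => (Φ w).1) (partialX fun w => (Φ w).2)
    (partialX (partialX fun w => (Φ w).1)) (partialX (partialX fun w => (Φ w).2))

theorem AnalyticAt.pairDet {F₁ F₂ G₁ G₂ : ℝ × ℝ → ℝ} (h1 : AnalyticAt ℝ F₁ z)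
    (h2 : AnalyticAt ℝ F₂ z) (h3 : AnalyticAt ℝ G₁ z) (h4 : AnalyticAt ℝ G₂ z) :
    AnalyticAt ℝ (pairDet F₁ F₂ G₁ G₂) z := by
  unfold _root_.pairDet; fun_prop

theorem analyticAt_coeff (hΦ : AnalyticAt ℝ Φ z) :
    AnalyticAt ℝ (coeffA Φ) z ∧ AnalyticAt ℝ (coeffB Φ) z ∧ AnalyticAt ℝ (coeffC Φ) z ∧
      AnalyticAt ℝ (coeffD Φ) z := by
  refine ⟨AnalyticAt.pairDet ?_ ?_ ?_ ?_, AnalyticAt.pairDet ?_ ?_ ?_ ?_,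
    AnalyticAt.pairDet ?_ ?_ ?_ ?_, AnalyticAt.pairDet ?_ ?_ ?_ ?_⟩ <;> fun_prop

theorem partialX_pairDet {F₁ F₂ G₁ G₂ : ℝ × ℝ → ℝ} (h1 : AnalyticAt ℝ F₁ z)
    (h2 : AnalyticAt ℝ F₂ z) (h3 : AnalyticAt ℝ G₁ z) (h4 : AnalyticAt ℝ G₂ z) :
    partialX (pairDet F₁ F₂ G₁ G₂) z =
      F₂ z * partialX G₁ z + partialX F₂ z * G₁ z - (F₁ z * partialX G₂ z + partialX F₁ z * G₂ z) := by
  unfold pairDet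
  rw [partialX_sub (h2.fun_mul h3) (h1.fun_mul h4), partialX_mul h2 h3, partialX_mul h1 h4]

theorem partialY_pairDet {F₁ F₂ G₁ G₂ : ℝ × ℝ → ℝ} (h1 : AnalyticAt ℝ F₁ z)
    (h2 : AnalyticAt ℝ F₂ z) (h3 : AnalyticAt ℝ G₁ z) (h4 : AnalyticAt ℝ G₂ z) :
    partialY (pairDet F₁ F₂ G₁ G₂) z =
      F₂ z * partialY G₁ z + partialY F₂ z * G₁ z - (F₁ z * partialY G₂ z + partialY F₁ z * G₂ z) := by
  unfold pairDet
  rw [partialY_sub (h2.fun_mul h3) (h1.fun_mul h4), partialY_mul h2 h3, partialY_mul h1 h4]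

theorem pointJacobian_eq_pairDet (Φ : ℝ × ℝ → ℝ × ℝ) : pointJacobian Φ =
    pairDet (partialY fun w => (Φ w).1) (partialY fun w => (Φ w).2)
      (partialX fun w => (Φ w).1) (partialX fun w => (Φ w).2) := by
  funext w; unfold pointJacobian pairDet; ring

theorem partialX_partialY_comm_eventually (hF : AnalyticAt ℝ F z) :
    partialY (partialX F) =ᶠ[𝓝 z] partialX (partialY F) := by
  filter_upwards [hF.eventually_analyticAt] with w hw
  exact (partialX_partialY_comm hw).symm

theorem partialY_partialX_partialX (hF : AnalyticAt ℝ F z) :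
    partialY (partialX (partialX F)) z = partialX (partialX (partialY F)) z := by
  rw [← partialX_partialY_comm hF.partialX, (partialX_partialY_comm_eventually hF).partialX_eq]

theorem partialY_partialX_partialY (hF : AnalyticAt ℝ F z) :
    partialY (partialX (partialY F)) z = partialX (partialY (partialY F)) z :=
  (partialX_partialY_comm hF.partialY).symm

/-- The Jacobian is constant: first order consequences. -/
theorem pointJacobian_derivatives (hΦ : AnalyticAt ℝ Φ z)
    (hJ : ∀ᶠ w in 𝓝 z, pointJacobian Φ w = 1) :
    pairDet (partialY fun w => (Φ w).1) (partialY fun w => (Φ w).2)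
        (partialX (partialX fun w => (Φ w).1)) (partialX (partialX fun w => (Φ w).2)) z =
      coeffC Φ z ∧
    pairDet (partialX fun w => (Φ w).1) (partialX fun w => (Φ w).2)
        (partialY (partialY fun w => (Φ w).1)) (partialY (partialY fun w => (Φ w).2)) z =
      coeffB Φ z := by
  have hJ' : pointJacobian Φ =ᶠ[𝓝 z] fun _ => 1 := hJ
  have a1 := hΦ.fst_comp
  have a2 := hΦ.snd_comp
  have eX := hJ'.partialX_eq
  have eY := hJ'.partialY_eq
  rw [partialX_const, pointJacobian_eq_pairDet,
    partialX_pairDet a1.partialY a2.partialY a1.partialX a2.partialX] at eX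
  rw [partialY_const, pointJacobian_eq_pairDet,
    partialY_pairDet a1.partialY a2.partialY a1.partialX a2.partialX,
    ← partialX_partialY_comm a1, ← partialX_partialY_comm a2] at eY
  unfold coeffC coeffB pairDet
  constructor
  · linear_combination eX
  · linear_combination -eY

/-- The coefficients of `y'` and `y' ^ 2` are each one determinant plus twice another.
Differentiating the constant Jacobian identifies the two determinants, which produces the factors
`3`. -/
theorem prolongationCubic_eq_coeff {p : ℝ × ℝ × ℝ} (hΦ : AnalyticAt ℝ Φ (jetBase p))
    (hJ : ∀ᶠ w in 𝓝 (jetBase p), pointJacobian Φ w = 1) :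
    prolongationCubic Φ p = -(coeffA Φ (jetBase p) * p.2.2 ^ 3 + 3 * coeffB Φ (jetBase p) * p.2.2 ^ 2 +
      3 * coeffC Φ (jetBase p) * p.2.2 + coeffD Φ (jetBase p)) := by
  obtain ⟨h1, h2⟩ := pointJacobian_derivatives hΦ hJ
  unfold prolongationCubic alongJet quadJet
  unfold coeffC pairDet at h1
  unfold coeffB pairDet at h2
  unfold coeffA coeffB coeffC coeffD pairDet
  linear_combination (-p.2.2) * h1 - p.2.2 ^ 2 * h2

/-- The pulled back connection is flat because the original is; concretely, this is the equality of
mixed third derivatives of `Φ`. -/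
theorem coefficientRelationsAt_coeff (hΦ : AnalyticAt ℝ Φ z)
    (hJ : ∀ᶠ w in 𝓝 z, pointJacobian Φ w = 1) :
    CoefficientRelationsAt (coeffA Φ) (coeffB Φ) (coeffC Φ) (coeffD Φ) z := by
  obtain ⟨h1, h2⟩ := pointJacobian_derivatives hΦ hJ
  -- In the first and third relations the third derivatives cancel on their own. In the middle one
  -- they do not, and the `y`-derivative of this identity supplies what is missing; so the identity
  -- is needed on a neighbourhood.
  have hh : pairDet (partialY fun w => (Φ w).1) (partialY fun w => (Φ w).2)
        (partialX (partialX fun w => (Φ w).1)) (partialX (partialX fun w => (Φ w).2)) =ᶠ[𝓝 z]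
      coeffC Φ := by
    filter_upwards [hΦ.eventually_analyticAt, hJ.eventually_nhds] with w hw1 hw2
    exact (pointJacobian_derivatives hw1 hw2).1
  have a1 := hΦ.fst_comp
  have a2 := hΦ.snd_comp
  have h3 := hh.partialY_eq
  have hj := hJ.self_of_nhds
  simp only [coeffC, coeffB, coeffA, coeffD, CoefficientRelationsAt] at h1 h2 h3 ⊢
  simp (disch := fun_prop) only [partialX_pairDet, partialY_pairDet] at h3 ⊢
  rw [partialY_partialX_partialX a1, partialY_partialX_partialX a2] at h3 ⊢
  rw [partialY_partialX_partialY a1, partialY_partialX_partialY a2] at h3 ⊢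
  rw [← partialX_partialY_comm a1, ← partialX_partialY_comm a2] at h3 ⊢
  unfold pairDet at h1 h2 ⊢
  unfold pointJacobian at hj
  set a := partialX (fun w => (Φ w).1) z
  set b := partialY (fun w => (Φ w).1) z
  set c := partialX (fun w => (Φ w).2) z
  set d := partialY (fun w => (Φ w).2) z
  set X1 := partialX (partialX fun w => (Φ w).1) z
  set X2 := partialX (partialY fun w => (Φ w).1) z
  set X3 := partialY (partialY fun w => (Φ w).1) z
  set F1 := partialX (partialX fun w => (Φ w).2) z
  set F2 := partialX (partialY fun w => (Φ w).2) z
  set F3 := partialY (partialY fun w => (Φ w).2) z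
  refine ⟨?_, ?_, ?_⟩
  · linear_combination (-2 * (F2 * X1 - X2 * F1)) * hj + 2 * (a * F2 - c * X2) * h1
  · linear_combination -h3 - (X1 * F3 - X3 * F1) * hj + (a * F3 - c * X3) * h1 -
      (c * X2 - a * F2) * h2
  · linear_combination (-2 * (X2 * F3 - X3 * F2)) * hj - 2 * (d * X2 - b * F2) * h2

/-- The second derivatives of `Φ` in terms of its first derivatives and the coefficients. -/
theorem second_derivatives_eq_coeff (hΦ : AnalyticAt ℝ Φ z)
    (hJ : ∀ᶠ w in 𝓝 z, pointJacobian Φ w = 1) (hA : coeffA Φ z = 0) (hB : coeffB Φ z = 0)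
    (hC : coeffC Φ z = 0) (hD : coeffD Φ z = 0) :
    (partialX (partialX fun w => (Φ w).1) z = 0 ∧ partialX (partialY fun w => (Φ w).1) z = 0 ∧
      partialY (partialY fun w => (Φ w).1) z = 0) ∧
    (partialX (partialX fun w => (Φ w).2) z = 0 ∧ partialX (partialY fun w => (Φ w).2) z = 0 ∧
      partialY (partialY fun w => (Φ w).2) z = 0) := by
  obtain ⟨h1, h2⟩ := pointJacobian_derivatives hΦ hJ
  have hj := hJ.self_of_nhds
  rw [hC] at h1
  rw [hB] at h2
  unfold coeffA pairDet at hA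
  unfold coeffB pairDet at hB
  unfold coeffC pairDet at hC
  unfold coeffD pairDet at hD
  unfold pairDet at h1 h2
  unfold pointJacobian at hj
  set a := partialX (fun w => (Φ w).1) z
  set b := partialY (fun w => (Φ w).1) z
  set c := partialX (fun w => (Φ w).2) z
  set d := partialY (fun w => (Φ w).2) z
  set X1 := partialX (partialX fun w => (Φ w).1) z
  set X2 := partialX (partialY fun w => (Φ w).1) z
  set X3 := partialY (partialY fun w => (Φ w).1) z
  set F1 := partialX (partialX fun w => (Φ w).2) z
  set F2 := partialX (partialY fun w => (Φ w).2) z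
  set F3 := partialY (partialY fun w => (Φ w).2) z
  refine ⟨⟨?_, ?_, ?_⟩, ?_, ?_, ?_⟩
  · linear_combination a * h1 - b * hD - X1 * hj
  · linear_combination a * hB - b * hC - X2 * hj
  · linear_combination a * hA - b * h2 - X3 * hj
  · linear_combination c * h1 - d * hD - F1 * hj
  · linear_combination c * hB - d * hC - F2 * hj
  · linear_combination c * hA - d * h2 - F3 * hj

/-- A polynomial of degree at most four vanishing near a point has zero coefficients. -/
theorem quartic_coeff_eq_zero {s₀ c₀ c₁ c₂ c₃ c₄ : ℝ}
    (h : ∀ᶠ s in 𝓝 s₀, c₀ + c₁ * s + c₂ * s ^ 2 + c₃ * s ^ 3 + c₄ * s ^ 4 = 0) :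
    c₀ = 0 ∧ c₁ = 0 ∧ c₂ = 0 ∧ c₃ = 0 ∧ c₄ = 0 := by
  open Polynomial in
  have hP : (C c₀ + C c₁ * X + C c₂ * X ^ 2 + C c₃ * X ^ 3 + C c₄ * X ^ 4 : ℝ[X]) = 0 := by
    refine Polynomial.eq_zero_of_infinite_isRoot _ (infinite_of_mem_nhds s₀ ?_)
    filter_upwards [h] with s hs
    simpa [Polynomial.IsRoot] using hs
  have hc := fun n => congrArg (fun P => Polynomial.coeff P n) hP
  have e0 := hc 0
  have e1 := hc 1
  have e2 := hc 2
  have e3 := hc 3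
  have e4 := hc 4
  simp [Polynomial.coeff_X, Polynomial.coeff_C, Polynomial.coeff_X_pow] at e0 e1 e2 e3 e4
  exact ⟨e0, e1, e2, e3, e4⟩

theorem eventually_jet_of_base {P : ℝ × ℝ × ℝ → Prop} {p : ℝ × ℝ × ℝ} (h : ∀ᶠ p' in 𝓝 p, P p') :
    ∀ᶠ z in 𝓝 (jetBase p), ∀ᶠ s in 𝓝 p.2.2, P (z.1, z.2, s) := by
  have hc : Continuous fun w : (ℝ × ℝ) × ℝ => ((w.1.1, w.1.2, w.2) : ℝ × ℝ × ℝ) := by fun_prop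
  have : ∀ᶠ w in 𝓝 ((jetBase p, p.2.2) : (ℝ × ℝ) × ℝ), P (w.1.1, w.1.2, w.2) :=
    hc.continuousAt.eventually h
  rw [nhds_prod_eq] at this
  exact this.curry

theorem CarriesAt.eventually_pointJacobian {f g : ℝ × ℝ × ℝ → ℝ} {p : ℝ × ℝ × ℝ}
    (H : ∀ᶠ p' in 𝓝 p, CarriesAt Φ f g p') :
    ∀ᶠ z in 𝓝 (jetBase p), pointJacobian Φ z = 1 := by
  filter_upwards [eventually_jet_of_base H] with z hz
  exact hz.self_of_nhds.areaPreserving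

/-- An equation equivalent to the free one has the normal form with flat coefficients. -/
theorem EquivalentToFreeAt.exists_coefficients {f : ℝ × ℝ × ℝ → ℝ} {p : ℝ × ℝ × ℝ}
    (hf : AnalyticAt ℝ f p) (h : EquivalentToFreeAt f p) :
    ∃ A B C D : ℝ × ℝ → ℝ,
      AnalyticAt ℝ A (jetBase p) ∧ AnalyticAt ℝ B (jetBase p) ∧
      AnalyticAt ℝ C (jetBase p) ∧ AnalyticAt ℝ D (jetBase p) ∧
      (∀ᶠ p' in 𝓝 p, IsCubicAt A B C D f p') ∧
      (∀ᶠ z in 𝓝 (jetBase p), CoefficientRelationsAt A B C D z) := by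
  obtain ⟨q, h⟩ := h
  obtain ⟨Φ, H, -⟩ := (areaEquivalentAt_iff hf).1 h
  have hΦ := H.self_of_nhds.analytic
  have hJ := CarriesAt.eventually_pointJacobian H
  obtain ⟨hA, hB, hC, hD⟩ := analyticAt_coeff hΦ
  refine ⟨coeffA Φ, coeffB Φ, coeffC Φ, coeffD Φ, hA, hB, hC, hD, ?_, ?_⟩
  · filter_upwards [H, eventually_jetBase (p := p) hJ.eventually_nhds] with p' h1 h2
    have e := h1.eq
    rw [prolongationCubic_eq_coeff h1.analytic h2, zero_mul] at e
    unfold IsCubicAt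
    linarith
  · filter_upwards [hΦ.eventually_analyticAt, hJ.eventually_nhds] with w h1 h2
    exact coefficientRelationsAt_coeff h1 h2

end Coefficients

/-! ### Analytic total differential systems -/

section TotalDifferential

open unitInterval BoundedContinuousFunction

variable {E G G₁ G₂ G₃ F : Type*} [NormedAddCommGroup E] [NormedSpace ℝ E]
  [NormedAddCommGroup G] [NormedSpace ℝ G] [NormedAddCommGroup G₁] [NormedSpace ℝ G₁]
  [NormedAddCommGroup G₂] [NormedSpace ℝ G₂] [NormedAddCommGroup G₃] [NormedSpace ℝ G₃]
  [NormedAddCommGroup F] [NormedSpace ℝ F]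

/-- Multiplication of a vector by the monomial `s ^ n` on the unit interval. -/
noncomputable def monomialCLM (G : Type*) [NormedAddCommGroup G] [NormedSpace ℝ G] (n : ℕ) :
    G →L[ℝ] (I →ᵇ G) :=
  LinearMap.mkContinuous
    { toFun := fun v => mkOfCompact ⟨fun s => ((s : ℝ) ^ n) • v, by fun_prop⟩
      map_add' := fun v w => by ext s; simp
      map_smul' := fun c v => by ext s; simp [smul_comm c] } 1 (fun v => by
        rw [one_mul, BoundedContinuousFunction.norm_le (norm_nonneg v)]
        intro s
        change ‖((s : ℝ) ^ n) • v‖ ≤ ‖v‖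
        rw [norm_smul, norm_pow, Real.norm_of_nonneg s.2.1]
        exact mul_le_of_le_one_left (norm_nonneg v) (pow_le_one₀ s.2.1 s.2.2))

theorem monomialCLM_apply (n : ℕ) (v : G) (s : I) :
    monomialCLM G n v s = ((s : ℝ) ^ n) • v := rfl

theorem norm_monomialCLM_le (n : ℕ) : ‖monomialCLM G n‖ ≤ 1 :=
  LinearMap.mkContinuous_norm_le _ zero_le_one _

/-- The restrictions of an analytic map to the segments `s ↦ z₀ + s z` depend analytically on `z`,
as continuous functions of `s`. -/
theorem exists_analytic_radial_lift [CompleteSpace G] {h : E → G} {z₀ : E}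
    (hh : AnalyticAt ℝ h z₀) :
    ∃ H : E → (I →ᵇ G), AnalyticAt ℝ H 0 ∧ ∀ᶠ z in 𝓝 0, ∀ s : I, H z s = h (z₀ + (s : ℝ) • z) := by
  obtain ⟨P, r, hP⟩ := hh
  -- By homogeneity the degree `n` term at `s • z` is `s ^ n` times the term at `z`, so the lift is
  -- again a power series in `z`. Its coefficients are no larger in norm, so the radius of
  -- convergence does not shrink.
  let Q : FormalMultilinearSeries ℝ E (I →ᵇ G) := fun n =>
    (monomialCLM G n).compContinuousMultilinearMap (P n)
  have hQn : ∀ n, ‖Q n‖ ≤ ‖P n‖ := fun n => by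
    refine ((monomialCLM G n).norm_compContinuousMultilinearMap_le (P n)).trans ?_
    exact mul_le_of_le_one_left (norm_nonneg _) (norm_monomialCLM_le n)
  have hrad : r ≤ Q.radius := by
    refine hP.r_le.trans ?_
    refine ENNReal.le_of_forall_nnreal_lt fun ρ hρ => ?_
    obtain ⟨C, -, hC⟩ := P.norm_mul_pow_le_of_lt_radius hρ
    exact Q.le_radius_of_bound C fun n =>
      (mul_le_mul_of_nonneg_right (hQn n) (by positivity)).trans (hC n)
  have hQ := (Q.hasFPowerSeriesOnBall (hP.r_pos.trans_le hrad)).mono hP.r_pos hrad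
  refine ⟨Q.sum, ⟨Q, r, hQ⟩, ?_⟩
  filter_upwards [Metric.eball_mem_nhds (0 : E) hP.r_pos] with z hz s
  have h1 := (BoundedContinuousFunction.evalCLM ℝ s).hasSum (hQ.hasSum hz)
  have hz' : (s : ℝ) • z ∈ Metric.eball (0 : E) r := by
    rw [mem_eball_zero_iff] at hz ⊢
    refine lt_of_le_of_lt ?_ hz
    rw [enorm_smul]
    refine mul_le_of_le_one_left bot_le ?_
    rw [Real.enorm_of_nonneg s.2.1]
    exact ENNReal.ofReal_le_one.2 s.2.2
  have h2 := hP.hasSum hz'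
  rw [zero_add] at h1
  refine h1.unique (h2.congr_fun ?_)
  intro n
  have h3 := (P n).map_smul_univ (fun _ => (s : ℝ)) (fun _ => z)
  simp only [Finset.prod_const, Finset.card_univ, Fintype.card_fin] at h3
  exact h3.symm

/-- Pointwise application of a bounded bilinear map to continuous functions. -/
noncomputable def pointwiseBilin (b : G₁ →L[ℝ] G₂ →L[ℝ] G₃) :
    (I →ᵇ G₁) →L[ℝ] (I →ᵇ G₂) →L[ℝ] (I →ᵇ G₃) :=
  LinearMap.mkContinuous₂
    (LinearMap.mk₂ ℝ (fun f g => mkOfCompact ⟨fun s => b (f s) (g s), by fun_prop⟩)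
      (fun f f' g => by ext s; simp) (fun c f g => by ext s; simp)
      (fun f g g' => by ext s; simp) (fun c f g => by ext s; simp)) ‖b‖ (fun f g => by
        rw [BoundedContinuousFunction.norm_le (by positivity)]
        intro s
        refine (b.le_opNorm₂ _ _).trans ?_
        gcongr
        · exact f.norm_coe_le_norm s
        · exact g.norm_coe_le_norm s)

theorem pointwiseBilin_apply (b : G₁ →L[ℝ] G₂ →L[ℝ] G₃) (f : (I →ᵇ G₁)) (g : (I →ᵇ G₂)) (s : I) :
    pointwiseBilin b f g s = b (f s) (g s) := rfl

/-- Extension of a continuous function from the unit interval to the line by constants. -/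
noncomputable def extendI {F : Type*} [NormedAddCommGroup F] (g : (I →ᵇ F)) : ℝ → F :=
  Set.IccExtend (zero_le_one' ℝ) g

theorem continuous_extendI {F : Type*} [NormedAddCommGroup F] (g : (I →ᵇ F)) :
    Continuous (extendI g) := g.continuous.Icc_extend'

theorem extendI_coe {F : Type*} [NormedAddCommGroup F] (g : (I →ᵇ F)) (t : I) :
    extendI g t = g t := Set.IccExtend_val _ _ _

theorem norm_extendI_le {F : Type*} [NormedAddCommGroup F] (g : (I →ᵇ F)) (t : ℝ) :
    ‖extendI g t‖ ≤ ‖g‖ := g.norm_coe_le_norm _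

/-- Integration from the left end point of the unit interval. -/
noncomputable def volterra (F : Type*) [NormedAddCommGroup F] [NormedSpace ℝ F] :
    (I →ᵇ F) →L[ℝ] (I →ᵇ F) :=
  LinearMap.mkContinuous
    { toFun := fun g => mkOfCompact ⟨fun t => ∫ s in (0 : ℝ)..t, extendI g s,
        (intervalIntegral.continuous_primitive
          (fun _ _ => (continuous_extendI g).intervalIntegrable _ _) 0).comp continuous_subtype_val⟩
      map_add' := fun f g => by
        ext t
        change ∫ s in (0 : ℝ)..t, (extendI f s + extendI g s) = _
        exact intervalIntegral.integral_add ((continuous_extendI f).intervalIntegrable _ _)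
          ((continuous_extendI g).intervalIntegrable _ _)
      map_smul' := fun c g => by
        ext t
        change ∫ s in (0 : ℝ)..t, c • extendI g s = _
        exact intervalIntegral.integral_smul _ _ } 1 (fun g => by
      rw [one_mul, BoundedContinuousFunction.norm_le (norm_nonneg g)]
      intro t
      refine (intervalIntegral.norm_integral_le_of_norm_le_const
        (fun s _ => norm_extendI_le g s)).trans ?_
      rw [sub_zero, abs_of_nonneg t.2.1]
      exact mul_le_of_le_one_right (norm_nonneg g) t.2.2)

theorem volterra_apply (g : (I →ᵇ F)) (t : I) : volterra F g t = ∫ s in (0 : ℝ)..t, extendI g s := rfl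

theorem hasDerivAt_primitive_extendI [CompleteSpace F] (g : (I →ᵇ F)) (x : ℝ) :
    HasDerivAt (fun x => ∫ s in (0 : ℝ)..x, extendI g s) (extendI g x) x :=
  intervalIntegral.integral_hasDerivAt_right ((continuous_extendI g).intervalIntegrable _ _)
    ((continuous_extendI g).stronglyMeasurableAtFilter _ _) (continuous_extendI g).continuousAt

theorem eventually_segment {P : E → Prop} {z₀ : E} (h : ∀ᶠ z in 𝓝 z₀, P z) :
    ∀ᶠ z in 𝓝 (0 : E), ∀ s : ℝ, 0 ≤ s → s ≤ 1 → P (z₀ + s • z) := by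
  obtain ⟨ε, hε, hb⟩ := Metric.eventually_nhds_iff.1 h
  filter_upwards [Metric.ball_mem_nhds (0 : E) hε] with z hz s hs0 hs1
  apply hb
  rw [dist_eq_norm, add_sub_cancel_left, norm_smul, Real.norm_of_nonneg hs0]
  rw [mem_ball_zero_iff] at hz
  exact (mul_le_of_le_one_left (norm_nonneg z) hs1).trans_lt hz

theorem AnalyticAt.pointwiseBilin {b : G₁ →L[ℝ] G₂ →L[ℝ] G₃} {f : E → (I →ᵇ G₁)} {g : E → (I →ᵇ G₂)}
    {z : E} (hf : AnalyticAt ℝ f z) (hg : AnalyticAt ℝ g z) :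
    AnalyticAt ℝ (fun z => pointwiseBilin b (f z) (g z)) z :=
  AnalyticAt.comp (g := fun p : (I →ᵇ G₁) × (I →ᵇ G₂) => _root_.pointwiseBilin b p.1 p.2)
    (f := fun z => (f z, g z)) ((_root_.pointwiseBilin b).analyticAt_bilinear (f z, g z))
    (hf.prod hg)

theorem fderiv_pointwiseBilin {b : G₁ →L[ℝ] G₂ →L[ℝ] G₃} {f : E → (I →ᵇ G₁)} {g : E → (I →ᵇ G₂)}
    {z : E} (hf : DifferentiableAt ℝ f z) (hg : DifferentiableAt ℝ g z) (h : E) :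
    fderiv ℝ (fun z => pointwiseBilin b (f z) (g z)) z h =
      pointwiseBilin b (f z) (fderiv ℝ g z h) + pointwiseBilin b (fderiv ℝ f z h) (g z) := by
  rw [((pointwiseBilin b).hasFDerivAt_of_bilinear hf.hasFDerivAt hg.hasFDerivAt).fderiv]
  rfl

/-- Evaluation at a point of the unit interval. -/
noncomputable def evalI (s : I) : (I →ᵇ G) →L[ℝ] G := BoundedContinuousFunction.evalCLM ℝ s

theorem evalI_apply (s : I) (f : I →ᵇ G) : evalI s f = f s := rfl

theorem fderiv_radial_lift {h : E → G} {z₀ z : E} {H : E → I →ᵇ G} {s : I}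
    (hH : DifferentiableAt ℝ H z) (hHs : ∀ᶠ y in 𝓝 z, H y s = h (z₀ + (s : ℝ) • y))
    (hh : DifferentiableAt ℝ h (z₀ + (s : ℝ) • z)) (k : E) :
    fderiv ℝ H z k s = (s : ℝ) • fderiv ℝ h (z₀ + (s : ℝ) • z) k := by
  have h1 := ((evalI s).hasFDerivAt (x := H z)).comp z hH.hasFDerivAt
  have h2 : HasFDerivAt (fun y : E => z₀ + (s : ℝ) • y) ((s : ℝ) • ContinuousLinearMap.id ℝ E) z :=
    ((hasFDerivAt_id z).const_smul (s : ℝ)).const_add z₀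
  have h3 := hh.hasFDerivAt.comp z h2
  have h5 := congrArg (fun S => S k) (h1.unique (h3.congr_of_eventuallyEq hHs))
  simpa [evalI_apply] using h5

/-- The radial component of an analytic one-form, as a continuous function on each segment. -/
theorem exists_analytic_radial_component [CompleteSpace G] {θ : E → E →L[ℝ] G} {z₀ : E}
    (hθ : AnalyticAt ℝ θ z₀) :
    ∃ Θ : E → I →ᵇ G, AnalyticAt ℝ Θ 0 ∧ Θ 0 = 0 ∧ ∀ᶠ z in 𝓝 0, ∀ s : I,
      Θ z s = θ (z₀ + (s : ℝ) • z) z ∧ ∀ h, fderiv ℝ Θ z h s =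
        θ (z₀ + (s : ℝ) • z) h + (s : ℝ) • fderiv ℝ θ (z₀ + (s : ℝ) • z) h z := by
  obtain ⟨H, hH, hHs⟩ := exists_analytic_radial_lift hθ
  refine ⟨fun z => pointwiseBilin (ContinuousLinearMap.apply ℝ G) (monomialCLM E 0 z) (H z),
    AnalyticAt.pointwiseBilin ((monomialCLM E 0).analyticAt 0) hH, by simp, ?_⟩
  filter_upwards [hH.eventually_analyticAt, hHs.eventually_nhds,
    eventually_segment hθ.eventually_analyticAt] with z kH kHs kθ s
  have eH : ∀ s : I, H z s = θ (z₀ + (s : ℝ) • z) := kHs.self_of_nhds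
  refine ⟨?_, fun h => ?_⟩
  · simp [pointwiseBilin_apply, monomialCLM_apply, eH]
  · rw [fderiv_pointwiseBilin (monomialCLM E 0).differentiableAt kH.differentiableAt h,
      ContinuousLinearMap.fderiv, BoundedContinuousFunction.add_apply, pointwiseBilin_apply,
      pointwiseBilin_apply, monomialCLM_apply, monomialCLM_apply, eH,
      fderiv_radial_lift kH.differentiableAt (kHs.mono fun y hy => hy s)
        (kθ s s.2.1 s.2.2).differentiableAt]
    simp [add_comm]

/-- Solutions of an analytic family of fixed point equations. -/
theorem exists_analytic_fixed_point [CompleteSpace F] {T : E → F →L[ℝ] F} (hT : AnalyticAt ℝ T 0)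
    (hT0 : T 0 = 0) (w : F) :
    ∃ U : E → F, AnalyticAt ℝ U 0 ∧ ∀ᶠ z in 𝓝 0, U z = w + T z (U z) := by
  -- The equation is linear, so its solution is `(1 - T z)⁻¹ w`; inversion is analytic near `1 = 1 -
  -- T 0`.
  refine ⟨fun z => Ring.inverse (1 - T z) w, ?_, ?_⟩
  · have h1 : AnalyticAt ℝ (fun z => Ring.inverse (1 - T z)) 0 := by
      refine AnalyticAt.comp (g := Ring.inverse) ?_ (analyticAt_const.sub hT)
      rw [hT0, sub_zero]
      exact analyticAt_inverse (𝕜 := ℝ) (1 : (F →L[ℝ] F)ˣ)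
    exact ((ContinuousLinearMap.apply ℝ F w).analyticAt _).comp h1
  · have : ∀ᶠ z in 𝓝 (0 : E), ‖T z‖ < 1 :=
      hT.continuousAt.norm.eventually_lt_const (by
        change ‖T 0‖ < 1
        rw [hT0, norm_zero]; exact one_pos)
    filter_upwards [this] with z hz
    have h1 := Ring.mul_inverse_cancel _ (isUnit_one_sub_of_norm_lt_one hz)
    have h2 := congrArg (fun S : F →L[ℝ] F => S w) h1
    have h3 : Ring.inverse (1 - T z) w - T z (Ring.inverse (1 - T z) w) = w := h2
    exact sub_eq_iff_eq_add.1 h3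

/-- The Volterra operators with kernel `b (S s)`. -/
noncomputable def volterraMul (b : G →L[ℝ] F →L[ℝ] F) :
    (I →ᵇ G) →L[ℝ] (I →ᵇ F) →L[ℝ] (I →ᵇ F) :=
  (ContinuousLinearMap.compL ℝ (I →ᵇ F) (I →ᵇ F) (I →ᵇ F) (volterra F)).comp (pointwiseBilin b)

theorem volterraMul_apply (b : G →L[ℝ] F →L[ℝ] F) (S : I →ᵇ G) (g : I →ᵇ F) :
    volterraMul b S g = volterra F (pointwiseBilin b S g) := rfl

/-- Differentiating the fixed point equation in the parameter yields the variational equation: same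
linear operator, new inhomogeneous term. -/
theorem bilin_family_derivative {X Y : Type*} [NormedAddCommGroup X] [NormedSpace ℝ X]
    [NormedAddCommGroup Y] [NormedSpace ℝ Y] (B : Y →L[ℝ] X →L[ℝ] X) {S : E → Y} {U : E → X} {z : E}
    {w : X} (hS : DifferentiableAt ℝ S z) (hU : DifferentiableAt ℝ U z)
    (h : ∀ᶠ y in 𝓝 z, U y = w + B (S y) (U y)) (k : E) :
    fderiv ℝ U z k = B (S z) (fderiv ℝ U z k) + B (fderiv ℝ S z k) (U z) := by
  have h1 := (B.hasFDerivAt_of_bilinear hS.hasFDerivAt hU.hasFDerivAt).const_add w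
  have h2 := hU.hasFDerivAt.unique (h1.congr_of_eventuallyEq h)
  have h3 := congrArg (fun S => S k) h2
  exact h3

theorem analyticAt_clm_comp {X Y : Type*} [NormedAddCommGroup X] [NormedSpace ℝ X]
    [NormedAddCommGroup Y] [NormedSpace ℝ Y] (L : X →L[ℝ] Y) {S : E → X} {z : E}
    (hS : AnalyticAt ℝ S z) : AnalyticAt ℝ (fun z => L (S z)) z :=
  (L.analyticAt (S z)).comp hS

/-- An analytic, completely integrable total differential system `du = θ u` has analytic local
solutions with arbitrary initial value. -/
theorem exists_analytic_solution_of_flat [CompleteSpace F] [CompleteSpace G] (b : G →L[ℝ] F →L[ℝ] F)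
    {θ : E → E →L[ℝ] G} {z₀ : E}
    (hθ : AnalyticAt ℝ θ z₀)
    (hflat : ∀ᶠ z in 𝓝 z₀, ∀ (h k : E) (w : F), b (fderiv ℝ θ z h k) w - b (fderiv ℝ θ z k h) w =
      b (θ z h) (b (θ z k) w) - b (θ z k) (b (θ z h) w)) (w₀ : F) :
    ∃ u : E → F, AnalyticAt ℝ u z₀ ∧ u z₀ = w₀ ∧
      ∀ᶠ z in 𝓝 z₀, ∀ h, fderiv ℝ u z h = b (θ z h) (u z) := by
  obtain ⟨Θ, hΘ_an, hΘ0, hΘ⟩ := exists_analytic_radial_component hθ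
  -- Integrate along rays: `U z` is the solution, as a function of `s` in the unit interval, of the
  -- linear equation obtained by restricting the system to `s ↦ z₀ + s z`. Its end value `U z 1` is
  -- the candidate for `u (z₀ + z)`.
  obtain ⟨U, hU_an, hUeq⟩ := exists_analytic_fixed_point
    (analyticAt_clm_comp (volterraMul b) hΘ_an) (by rw [hΘ0, map_zero]) (monomialCLM F 0 w₀)
  have main : ∀ᶠ z in 𝓝 (0 : E), ∀ h : E, fderiv ℝ U z h 1 = b (θ (z₀ + z) h) (U z 1) := by
    filter_upwards [hΘ, hΘ_an.eventually_analyticAt, hU_an.eventually_analyticAt,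
      hUeq.eventually_nhds, eventually_segment hθ.eventually_analyticAt,
      eventually_segment hflat] with z kΘs kΘ kU kUeq kθ kflat h
    have eΘ : ∀ s : I, Θ z s = θ (z₀ + (s : ℝ) • z) z := fun s => (kΘs s).1
    have dΘ : ∀ s : I, fderiv ℝ Θ z h s = θ (z₀ + (s : ℝ) • z) h +
        (s : ℝ) • fderiv ℝ θ (z₀ + (s : ℝ) • z) h z := fun s => (kΘs s).2 h
    set dU := fderiv ℝ U z h
    set g₂ := pointwiseBilin b (Θ z) (U z) with hg₂
    set g₁ := pointwiseBilin b (Θ z) dU +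
      pointwiseBilin b (fderiv ℝ Θ z h) (U z) with hg₁
    have edU : dU = volterra F g₁ := by
      rw [hg₁, map_add, ← volterraMul_apply, ← volterraMul_apply]
      exact bilin_family_derivative (volterraMul b) kΘ.differentiableAt kU.differentiableAt kUeq h
    -- The derivative of `U` in the direction `h` and `U z` itself, written as primitives on the
    -- whole line so that both are differentiable at the end points too.
    let P : ℝ → F := fun x => ∫ s in (0 : ℝ)..x, extendI g₁ s
    let R : ℝ → F := fun x => w₀ + ∫ s in (0 : ℝ)..x, extendI g₂ s
    have eP : ∀ t : I, dU t = P t := fun t => by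
      have := congrArg (fun S : (I →ᵇ F) => S t) edU
      exact this
    have eR : ∀ t : I, U z t = R t := fun t => by
      have := congrArg (fun S : (I →ᵇ F) => S t) kUeq.self_of_nhds
      simpa [monomialCLM_apply, volterraMul_apply, volterra_apply] using this
    have hP : ∀ x, HasDerivAt P (extendI g₁ x) x := hasDerivAt_primitive_extendI g₁
    have hR : ∀ x, HasDerivAt R (extendI g₂ x) x := fun x =>
      (hasDerivAt_primitive_extendI g₂ x).const_add w₀
    -- The defect of the equation in the direction `h` at the point `z₀ + x z`, scaled by `x`. It
    -- vanishes at `0` and, by flatness in the directions `h` and `z`, satisfies a homogeneous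
    -- linear equation; Gronwall gives zero, and `x = 1` is the claim.
    let e : ℝ → F := fun x => P x - x • b (θ (z₀ + x • z) h) (R x)
    have he : ∀ x ∈ Icc (0 : ℝ) 1, HasDerivAt e (b (Θ z (projIcc 0 1 zero_le_one x)) (e x)) x := by
      intro x hx
      have hl : HasDerivAt (fun x : ℝ => z₀ + x • z) z x := by
        simpa using ((hasDerivAt_id x).smul_const z).const_add z₀
      have h1 : HasDerivAt (fun x : ℝ => θ (z₀ + x • z)) (fderiv ℝ θ (z₀ + x • z) z) x :=
        (kθ x hx.1 hx.2).differentiableAt.hasFDerivAt.comp_hasDerivAt x hl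
      have h2 := ((b.hasFDerivAt.comp_hasDerivAt x
        (h1.clm_apply (hasDerivAt_const x h)))).clm_apply (hR x)
      have h3 := (hP x).fun_sub ((hasDerivAt_id' x).fun_smul h2)
      refine h3.congr_deriv ?_
      have ex : projIcc 0 1 zero_le_one x = (⟨x, hx⟩ : I) := projIcc_of_mem _ hx
      have eg₁ : extendI g₁ x = g₁ ⟨x, hx⟩ := extendI_coe g₁ ⟨x, hx⟩
      have eg₂ : extendI g₂ x = g₂ ⟨x, hx⟩ := extendI_coe g₂ ⟨x, hx⟩
      have hf := kflat x hx.1 hx.2 h z (R x)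
      rw [eg₁, eg₂, ex, hg₁, hg₂]
      simp only [BoundedContinuousFunction.add_apply, pointwiseBilin_apply, eΘ, dΘ, eP, eR, e,
        map_add, map_sub, map_smul, map_zero, add_zero, _root_.add_apply, _root_.smul_apply, Function.comp_apply]
      linear_combination (norm := module) x • hf
    have hzero := eq_zero_of_abs_deriv_le_mul_abs_self_of_eq_zero_right (f := e) (K := ‖b‖ * ‖Θ z‖)
      (a := 0) (b := 1) (fun x hx => (he x hx).continuousAt.continuousWithinAt)
      (fun x hx => (he x ⟨hx.1, hx.2.le⟩).hasDerivWithinAt) (by simp [e, P])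
      (fun x hx => (b.le_opNorm₂ _ _).trans (mul_le_mul_of_nonneg_right
        (mul_le_mul_of_nonneg_left ((Θ z).norm_coe_le_norm _) (norm_nonneg b)) (norm_nonneg _))) 1
      ⟨zero_le_one, le_rfl⟩
    have e1 := eP 1
    have e2 := eR 1
    simp only [e, one_smul, sub_eq_zero] at hzero
    rw [e1, e2]
    exact hzero
  have hsub : AnalyticAt ℝ (fun z : E => z - z₀) z₀ := analyticAt_id.sub analyticAt_const
  have htend : Tendsto (fun z : E => z - z₀) (𝓝 z₀) (𝓝 0) := by
    have := hsub.continuousAt.tendsto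
    rwa [sub_self] at this
  refine ⟨fun z => U (z - z₀) 1, ?_, ?_, ?_⟩
  · refine ((evalI (1 : I)).analyticAt _).comp
      (AnalyticAt.comp (g := U) (f := fun z => z - z₀) ?_ hsub)
    rwa [sub_self]
  · have := hUeq.self_of_nhds
    change U (z₀ - z₀) 1 = w₀
    rw [sub_self, this]
    simp [hΘ0, monomialCLM_apply]
  · filter_upwards [htend.eventually main, htend.eventually hU_an.eventually_analyticAt] with z hz kU h
    rw [add_sub_cancel] at hz
    rw [← hz h]
    have h1 := ((evalI (1 : I)).hasFDerivAt (x := U (z - z₀))).comp z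
      (kU.differentiableAt.hasFDerivAt.comp z ((hasFDerivAt_id z).sub_const z₀))
    have h2 : fderiv ℝ (fun z => U (z - z₀) 1) z = _ := h1.fderiv
    rw [h2]
    simp [evalI_apply]

end TotalDifferential

/-! ### Flattening coordinates -/

section Flattening

variable {A B C D : ℝ × ℝ → ℝ} {z₀ : ℝ × ℝ}

/-- The endomorphism of `ℝ × ℝ × ℝ` occurring in the linear system for a flat coordinate and its two
first derivatives. -/
def flatMatrix (n₁ n₂ h e₁ e₂ : ℝ) : (ℝ × ℝ × ℝ) →ₗ[ℝ] ℝ × ℝ × ℝ where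
  toFun w := (n₁ * w.2.1 + n₂ * w.2.2, h * w.2.1 + e₁ * w.2.2, e₂ * w.2.1 - h * w.2.2)
  map_add' v w := by ext <;> simp <;> ring
  map_smul' c w := by ext <;> simp <;> ring

/-- `flatMatrix` as a bounded bilinear map. -/
noncomputable def flatMatrixCLM : (ℝ × ℝ × ℝ × ℝ × ℝ) →L[ℝ] (ℝ × ℝ × ℝ) →L[ℝ] ℝ × ℝ × ℝ :=
  LinearMap.toContinuousLinearMap
    { toFun := fun g => LinearMap.toContinuousLinearMap
        (flatMatrix g.1 g.2.1 g.2.2.1 g.2.2.2.1 g.2.2.2.2)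
      map_add' := fun g g' => by
        ext <;> simp [flatMatrix] <;> ring
      map_smul' := fun c g => by
        ext <;> simp [flatMatrix] }

theorem flatMatrixCLM_apply (g : ℝ × ℝ × ℝ × ℝ × ℝ) (w : ℝ × ℝ × ℝ) :
    flatMatrixCLM g w = (g.1 * w.2.1 + g.2.1 * w.2.2, g.2.2.1 * w.2.1 + g.2.2.2.1 * w.2.2,
      g.2.2.2.2 * w.2.1 - g.2.2.1 * w.2.2) := rfl

/-- The one-form `h ↦ h.1 • K₁ + h.2 • K₂`. -/
noncomputable def oneFormCLM (G : Type*) [NormedAddCommGroup G] [NormedSpace ℝ G] :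
    (G × G) →L[ℝ] (ℝ × ℝ) →L[ℝ] G :=
  (ContinuousLinearMap.smulRightL ℝ (ℝ × ℝ) G (ContinuousLinearMap.fst ℝ ℝ ℝ)).comp
      (ContinuousLinearMap.fst ℝ G G) +
    (ContinuousLinearMap.smulRightL ℝ (ℝ × ℝ) G (ContinuousLinearMap.snd ℝ ℝ ℝ)).comp
      (ContinuousLinearMap.snd ℝ G G)

theorem oneFormCLM_apply {G : Type*} [NormedAddCommGroup G] [NormedSpace ℝ G] (K : G × G)
    (h : ℝ × ℝ) : oneFormCLM G K h = h.1 • K.1 + h.2 • K.2 := rfl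

theorem eventually_eq_of_partials_eq_zero {F : ℝ × ℝ → ℝ} (hF : AnalyticAt ℝ F z₀)
    (hX : ∀ᶠ z in 𝓝 z₀, partialX F z = 0) (hY : ∀ᶠ z in 𝓝 z₀, partialY F z = 0) :
    ∀ᶠ z in 𝓝 z₀, F z = F z₀ := by
  obtain ⟨ε, hε, hb⟩ := Metric.eventually_nhds_iff_ball.1
    (hF.eventually_analyticAt.and (hX.and hY))
  filter_upwards [Metric.ball_mem_nhds z₀ hε] with z hz
  refine Metric.isOpen_ball.is_const_of_fderiv_eq_zero (𝕜 := ℝ)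
    (convex_ball z₀ ε).isPreconnected
    (fun w hw => (hb w hw).1.differentiableAt.differentiableWithinAt) (fun w hw => ?_) hz
    (Metric.mem_ball_self hε)
  ext
  · simpa [partialX] using (hb w hw).2.1
  · simpa [partialY] using (hb w hw).2.2

theorem fderiv_prod_apply {E F G : Type*} [NormedAddCommGroup E] [NormedSpace ℝ E]
    [NormedAddCommGroup F] [NormedSpace ℝ F] [NormedAddCommGroup G] [NormedSpace ℝ G]
    {f : E → F × G} {z : E} (hf : DifferentiableAt ℝ f z) (h : E) :
    fderiv ℝ (fun z => (f z).1) z h = (fderiv ℝ f z h).1 ∧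
      fderiv ℝ (fun z => (f z).2) z h = (fderiv ℝ f z h).2 := by
  have h1 := ((ContinuousLinearMap.fst ℝ F G).hasFDerivAt (x := f z)).comp z hf.hasFDerivAt
  have h2 := ((ContinuousLinearMap.snd ℝ F G).hasFDerivAt (x := f z)).comp z hf.hasFDerivAt
  have e1 : fderiv ℝ (fun z => (f z).1) z = _ := h1.fderiv
  have e2 : fderiv ℝ (fun z => (f z).2) z = _ := h2.fderiv
  rw [e1, e2]
  exact ⟨rfl, rfl⟩

/-- Existence of flat coordinates with prescribed differential at a point. -/
theorem exists_flat_coordinate (hA : AnalyticAt ℝ A z₀) (hB : AnalyticAt ℝ B z₀)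
    (hC : AnalyticAt ℝ C z₀) (hD : AnalyticAt ℝ D z₀)
    (hrel : ∀ᶠ z in 𝓝 z₀, CoefficientRelationsAt A B C D z) (a₀ b₀ : ℝ) :
    ∃ χ : ℝ × ℝ → ℝ, AnalyticAt ℝ χ z₀ ∧ partialX χ z₀ = a₀ ∧ partialY χ z₀ = b₀ ∧
      ∀ᶠ z in 𝓝 z₀, partialX (partialX χ) z = C z * partialX χ z - D z * partialY χ z ∧
        partialX (partialY χ) z = B z * partialX χ z - C z * partialY χ z ∧
        partialY (partialY χ) z = A z * partialX χ z - B z * partialY χ z := by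
  -- The `dx` and `dy` parts of the system for `(χ, χ_x, χ_y)`. The leading entries `1, 0` and `0,
  -- 1` only say that the last two unknowns are the derivatives of the first.
  let K : ℝ × ℝ → (ℝ × ℝ × ℝ × ℝ × ℝ) × (ℝ × ℝ × ℝ × ℝ × ℝ) := fun z =>
    ((1, 0, C z, -D z, B z), (0, 1, B z, -C z, A z))
  have hK : AnalyticAt ℝ K z₀ := by fun_prop
  have dK : ∀ᶠ z in 𝓝 z₀, ∀ h : ℝ × ℝ, fderiv ℝ K z h =
      ((0, 0, fderiv ℝ C z h, -fderiv ℝ D z h, fderiv ℝ B z h),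
        (0, 0, fderiv ℝ B z h, -fderiv ℝ C z h, fderiv ℝ A z h)) := by
    filter_upwards [hA.eventually_analyticAt, hB.eventually_analyticAt, hC.eventually_analyticAt,
      hD.eventually_analyticAt] with z kA kB kC kD h
    have a := kA.differentiableAt.hasFDerivAt
    have b := kB.differentiableAt.hasFDerivAt
    have c := kC.differentiableAt.hasFDerivAt
    have d := kD.differentiableAt.hasFDerivAt
    have := (((hasFDerivAt_const (1 : ℝ) z).prodMk ((hasFDerivAt_const (0 : ℝ) z).prodMk
      (c.prodMk (d.neg.prodMk b)))).prodMk ((hasFDerivAt_const (0 : ℝ) z).prodMk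
      ((hasFDerivAt_const (1 : ℝ) z).prodMk (b.prodMk (c.neg.prodMk a))))).fderiv
    have e : fderiv ℝ K z = _ := this
    rw [e]; rfl
  obtain ⟨u, hu, hu0, hdu⟩ := exists_analytic_solution_of_flat flatMatrixCLM
    (θ := fun z => oneFormCLM _ (K z)) (analyticAt_clm_comp (oneFormCLM _) hK) (by
      filter_upwards [hK.eventually_analyticAt, dK, hrel] with z kK kdK krel h k w
      have dθ : ∀ h k, fderiv ℝ (fun z => oneFormCLM _ (K z)) z h k =
          k.1 • (fderiv ℝ K z h).1 + k.2 • (fderiv ℝ K z h).2 := fun h k => by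
        have e : fderiv ℝ (fun z => oneFormCLM _ (K z)) z = _ :=
          ((oneFormCLM (ℝ × ℝ × ℝ × ℝ × ℝ)).hasFDerivAt.comp z
            kK.differentiableAt.hasFDerivAt).fderiv
        rw [e]; rfl
      obtain ⟨r1, r2, r3⟩ := krel
      rw [dθ, dθ, kdK, kdK]
      simp only [flatMatrixCLM_apply, oneFormCLM_apply, K, fderiv_eq_partials, Prod.smul_mk,
        Prod.mk_add_mk, Prod.mk_sub_mk, smul_eq_mul, Prod.mk.injEq]
      -- The first component holds identically because both parts prescribe the same mixed
      -- derivative; the others are the curvature, killed by the three relations.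
      refine ⟨by ring, ?_, ?_⟩
      · linear_combination (-(h.1 * k.2 - h.2 * k.1) * w.2.1) * r2 +
          (h.1 * k.2 - h.2 * k.1) * w.2.2 * r1
      · linear_combination (-(h.1 * k.2 - h.2 * k.1) * w.2.1) * r3 +
          (h.1 * k.2 - h.2 * k.1) * w.2.2 * r2) (0, a₀, b₀)
  have hd : ∀ᶠ z in 𝓝 z₀, ∀ h : ℝ × ℝ,
      fderiv ℝ (fun z => (u z).1) z h = h.1 * (u z).2.1 + h.2 * (u z).2.2 ∧
      fderiv ℝ (fun z => (u z).2.1) z h = h.1 * (C z * (u z).2.1 - D z * (u z).2.2) +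
        h.2 * (B z * (u z).2.1 - C z * (u z).2.2) ∧
      fderiv ℝ (fun z => (u z).2.2) z h = h.1 * (B z * (u z).2.1 - C z * (u z).2.2) +
        h.2 * (A z * (u z).2.1 - B z * (u z).2.2) := by
    filter_upwards [hu.eventually_analyticAt, hdu] with z ku kdu h
    have e1 := fderiv_prod_apply ku.differentiableAt h
    have e2 := fderiv_prod_apply ku.snd_comp.differentiableAt h
    rw [e1.1, e2.1, e2.2, e1.2, kdu]
    simp only [flatMatrixCLM_apply, oneFormCLM_apply, K, Prod.smul_mk, Prod.mk_add_mk, smul_eq_mul]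
    refine ⟨by ring, by ring, by ring⟩
  have eX : partialX (fun z => (u z).1) =ᶠ[𝓝 z₀] fun z => (u z).2.1 := by
    filter_upwards [hd] with z hz
    rw [partialX, (hz _).1]; simp
  have eY : partialY (fun z => (u z).1) =ᶠ[𝓝 z₀] fun z => (u z).2.2 := by
    filter_upwards [hd] with z hz
    rw [partialY, (hz _).1]; simp
  refine ⟨fun z => (u z).1, hu.fst_comp, ?_, ?_, ?_⟩
  · rw [eX.eq_of_nhds, hu0]
  · rw [eY.eq_of_nhds, hu0]
  · filter_upwards [hd, eX, eY, eX.partialX, eY.partialX, eY.partialY] with z hz h1 h2 h3 h4 h5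
    rw [h1, h2, h3, h4, h5]
    refine ⟨?_, ?_, ?_⟩
    · rw [partialX, (hz _).2.1]; simp
    · rw [partialX, (hz _).2.2]; simp
    · rw [partialY, (hz _).2.2]; simp

/-- An equation in normal form with flat coefficients is equivalent to the free one. -/
theorem equivalentToFreeAt_of_coefficients {f : ℝ × ℝ × ℝ → ℝ} {p : ℝ × ℝ × ℝ}
    (hf : AnalyticAt ℝ f p) (hA : AnalyticAt ℝ A (jetBase p)) (hB : AnalyticAt ℝ B (jetBase p))
    (hC : AnalyticAt ℝ C (jetBase p)) (hD : AnalyticAt ℝ D (jetBase p))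
    (hcub : ∀ᶠ p' in 𝓝 p, IsCubicAt A B C D f p')
    (hrel : ∀ᶠ z in 𝓝 (jetBase p), CoefficientRelationsAt A B C D z) :
    EquivalentToFreeAt f p := by
  -- The differentials at the base point are chosen as `dx` and `dy`, so the Jacobian is `1` there.
  -- It stays `1` nearby because the system for the first derivatives is trace-free.
  obtain ⟨χ, hχ, hχ1, hχ2, dχ⟩ := exists_flat_coordinate hA hB hC hD hrel 1 0
  obtain ⟨φ, hφ, hφ1, hφ2, dφ⟩ := exists_flat_coordinate hA hB hC hD hrel 0 1
  have hΦ : AnalyticAt ℝ (fun z => (χ z, φ z)) (jetBase p) := hχ.prod hφ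
  have hJan : AnalyticAt ℝ (pointJacobian fun z => (χ z, φ z)) (jetBase p) := by
    rw [pointJacobian_eq_pairDet]
    exact AnalyticAt.pairDet hχ.partialY hφ.partialY hχ.partialX hφ.partialX
  have hJ0 : pointJacobian (fun z => (χ z, φ z)) (jetBase p) = 1 := by
    simp [pointJacobian, hχ1, hχ2, hφ1, hφ2]
  have hJ : ∀ᶠ z in 𝓝 (jetBase p), pointJacobian (fun z => (χ z, φ z)) z = 1 := by
    rw [← hJ0]
    refine eventually_eq_of_partials_eq_zero hJan ?_ ?_
    · filter_upwards [hχ.eventually_analyticAt, hφ.eventually_analyticAt, dχ, dφ] with z k1 k2 e1 e2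
      rw [pointJacobian_eq_pairDet]
      simp only []
      rw [partialX_pairDet k1.partialY k2.partialY k1.partialX k2.partialX, e1.1, e1.2.1, e2.1,
        e2.2.1]
      ring
    · filter_upwards [hχ.eventually_analyticAt, hφ.eventually_analyticAt, dχ, dφ] with z k1 k2 e1 e2
      rw [pointJacobian_eq_pairDet]
      simp only []
      rw [partialY_pairDet k1.partialY k2.partialY k1.partialX k2.partialX,
        ← partialX_partialY_comm k1, ← partialX_partialY_comm k2, e1.2.1, e1.2.2, e2.2.1, e2.2.2]
      ring
  refine ⟨_, (areaEquivalentAt_iff hf).2 ⟨fun z => (χ z, φ z), ?_, rfl⟩⟩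
  have hT0 : alongJet χ p ≠ 0 := by simp [alongJet, hχ1, hχ2]
  filter_upwards [eventually_jetBase hΦ.eventually_analyticAt, eventually_jetBase hJ,
    hχ.alongJet.continuousAt.eventually_ne hT0, hcub, eventually_jetBase dχ,
    eventually_jetBase dφ] with p' k1 k2 k3 k4 e1 e2
  refine ⟨k1, k2, k3, ?_⟩
  have k2' := k2
  simp only [pointJacobian] at k2'
  rw [zero_mul, k4]
  simp only [prolongationCubic, alongJet, quadJet]
  rw [e1.1, e1.2.1, e1.2.2, e2.1, e2.2.1, e2.2.2]
  linear_combination (A (jetBase p') * p'.2.2 ^ 3 + 3 * B (jetBase p') * p'.2.2 ^ 2 +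
    3 * C (jetBase p') * p'.2.2 + D (jetBase p')) * k2'

end Flattening

/-! ### Special affine transformations -/

section Affine

/-- The affine map `(x, y) ↦ (v + a x + b y, w + c x + d y)`. -/
def affineMap (v w a b c d : ℝ) (z : ℝ × ℝ) : ℝ × ℝ :=
  (v + a * z.1 + b * z.2, w + c * z.1 + d * z.2)

theorem affineAction_eq (v w a b c d : ℝ) :
    affineAction !![1, 0, 0; v, a, b; w, c, d] = affineMap v w a b c d := by
  funext z
  simp [affineAction, affineMap, Matrix.mulVec, dotProduct, Fin.sum_univ_three]

theorem mem_ASL2_iff {M : Matrix (Fin 3) (Fin 3) ℝ} :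
    M ∈ ASL2 ↔ ∃ v w a b c d : ℝ, a * d - b * c = 1 ∧ M = !![1, 0, 0; v, a, b; w, c, d] := by
  constructor
  · rintro ⟨v, w, A, rfl⟩
    refine ⟨v, w, A.1 0 0, A.1 0 1, A.1 1 0, A.1 1 1, ?_, rfl⟩
    have := A.2
    rwa [Matrix.det_fin_two] at this
  · rintro ⟨v, w, a, b, c, d, hdet, rfl⟩
    exact ⟨v, w, ⟨!![a, b; c, d], by rw [Matrix.det_fin_two_of]; exact hdet⟩, by simp⟩

variable {v w a b c d : ℝ} {z : ℝ × ℝ} {p : ℝ × ℝ × ℝ}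

theorem analyticAt_affineMap : AnalyticAt ℝ (affineMap v w a b c d) z := by
  unfold affineMap; fun_prop

theorem partialX_linear (v a b : ℝ) (z : ℝ × ℝ) :
    partialX (fun z => v + a * z.1 + b * z.2) z = a := by
  rw [partialX_add (by fun_prop) (by fun_prop), partialX_add (by fun_prop) (by fun_prop),
    partialX_mul (by fun_prop) (by fun_prop), partialX_mul (by fun_prop) (by fun_prop),
    partialX_fst, partialX_snd]
  simp [partialX_const]

theorem partialY_linear (v a b : ℝ) (z : ℝ × ℝ) :
    partialY (fun z => v + a * z.1 + b * z.2) z = b := by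
  rw [partialY_add (by fun_prop) (by fun_prop), partialY_add (by fun_prop) (by fun_prop),
    partialY_mul (by fun_prop) (by fun_prop), partialY_mul (by fun_prop) (by fun_prop),
    partialY_fst, partialY_snd]
  simp [partialY_const]

theorem alongJet_linear : alongJet (fun z => v + a * z.1 + b * z.2) p = a + p.2.2 * b := by
  rw [alongJet, partialX_linear, partialY_linear]

theorem quadJet_linear : quadJet (fun z => v + a * z.1 + b * z.2) p = 0 := by
  have h1 : partialX (fun z : ℝ × ℝ => v + a * z.1 + b * z.2) = fun _ => a :=
    funext (partialX_linear v a b)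
  have h2 : partialY (fun z : ℝ × ℝ => v + a * z.1 + b * z.2) = fun _ => b :=
    funext (partialY_linear v a b)
  simp [quadJet, h1, h2, partialX_const, partialY_const]

theorem pointJacobian_affineMap : pointJacobian (affineMap v w a b c d) z = a * d - b * c := by
  simp only [pointJacobian, affineMap]
  rw [partialX_linear, partialY_linear, partialX_linear, partialY_linear]

theorem alongJet_affineMap :
    alongJet (fun z => (affineMap v w a b c d z).1) p = a + p.2.2 * b := alongJet_linear

theorem prolongation_affineMap : prolongation (affineMap v w a b c d) p =
    (v + a * p.1 + b * p.2.1, w + c * p.1 + d * p.2.1, (c + p.2.2 * d) / (a + p.2.2 * b)) := by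
  simp only [prolongation, affineMap, jetBase]
  rw [alongJet_linear, alongJet_linear]

theorem carriesAt_affineMap (hdet : a * d - b * c = 1) (hT : a + p.2.2 * b ≠ 0) :
    CarriesAt (affineMap v w a b c d) (fun _ => 0) (fun _ => 0) p := by
  refine ⟨analyticAt_affineMap, pointJacobian_affineMap.trans hdet, ?_, ?_⟩
  · rwa [alongJet_affineMap]
  · simp only [prolongationCubic, affineMap, quadJet_linear]
    simp

theorem exists_eq_linear_of_second_partials_eq_zero {F : ℝ × ℝ → ℝ} (hF : AnalyticAt ℝ F z)
    (h : ∀ᶠ w in 𝓝 z, partialX (partialX F) w = 0 ∧ partialX (partialY F) w = 0 ∧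
      partialY (partialY F) w = 0) :
    ∃ v, ∀ᶠ w in 𝓝 z, F w = v + partialX F z * w.1 + partialY F z * w.2 := by
  have hX : ∀ᶠ w in 𝓝 z, partialX F w = partialX F z := by
    refine eventually_eq_of_partials_eq_zero hF.partialX (h.mono fun w hw => hw.1) ?_
    filter_upwards [h, hF.eventually_analyticAt] with w hw k
    rw [← partialX_partialY_comm k, hw.2.1]
  have hY : ∀ᶠ w in 𝓝 z, partialY F w = partialY F z :=
    eventually_eq_of_partials_eq_zero hF.partialY (h.mono fun w hw => hw.2.1)
      (h.mono fun w hw => hw.2.2)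
  have hl : ∀ w, AnalyticAt ℝ (fun w : ℝ × ℝ => 0 + partialX F z * w.1 + partialY F z * w.2) w :=
    fun w => by fun_prop
  have hc := eventually_eq_of_partials_eq_zero
    (F := fun w => F w - (0 + partialX F z * w.1 + partialY F z * w.2)) (hF.sub (hl z)) (by
      filter_upwards [hX, hF.eventually_analyticAt] with w hw k
      rw [partialX_sub k (hl w), partialX_linear, hw, sub_self]) (by
      filter_upwards [hY, hF.eventually_analyticAt] with w hw k
      rw [partialY_sub k (hl w), partialY_linear, hw, sub_self])
  refine ⟨F z - (0 + partialX F z * z.1 + partialY F z * z.2), ?_⟩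
  filter_upwards [hc] with w hw
  linear_combination hw

/-- The symmetries of `y'' = 0` are the special affine transformations. -/
theorem carriesEquationOn_free_iff (Φ : ℝ × ℝ → ℝ × ℝ) (p : ℝ × ℝ × ℝ) :
    (∃ W ∈ 𝓝 p, CarriesEquationOn Φ (fun _ => 0) (fun _ => 0) W) ↔
      ∃ M ∈ ASL2, Φ =ᶠ[𝓝 (jetBase p)] affineAction M ∧
        alongJet (fun w => (affineAction M w).1) p ≠ 0 := by
  rw [carriesAt_eventually_iff analyticAt_const]
  constructor
  · intro H
    have hΦ := H.self_of_nhds.analytic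
    have hJ := CarriesAt.eventually_pointJacobian H
    have hsec : ∀ᶠ z in 𝓝 (jetBase p), (partialX (partialX fun w => (Φ w).1) z = 0 ∧
        partialX (partialY fun w => (Φ w).1) z = 0 ∧ partialY (partialY fun w => (Φ w).1) z = 0) ∧
        (partialX (partialX fun w => (Φ w).2) z = 0 ∧
        partialX (partialY fun w => (Φ w).2) z = 0 ∧
        partialY (partialY fun w => (Φ w).2) z = 0) := by
      filter_upwards [hΦ.eventually_analyticAt, hJ.eventually_nhds, eventually_jet_of_base H]
        with z k1 k2 k3
      -- Over a fixed point the cubic vanishes for all slopes near that of `p`, so each coefficient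
      -- is zero; the null quartic term only fits the shape of `quartic_coeff_eq_zero`.
      have hq : ∀ᶠ s in 𝓝 p.2.2, coeffD Φ z + (3 * coeffC Φ z) * s + (3 * coeffB Φ z) * s ^ 2 +
          coeffA Φ z * s ^ 3 + 0 * s ^ 4 = 0 := by
        filter_upwards [k3] with s hs
        have e := hs.eq
        rw [prolongationCubic_eq_coeff (p := (z.1, z.2, s)) k1 k2] at e
        simp only [jetBase] at e
        linear_combination e
      obtain ⟨e0, e1, e2, e3, -⟩ := quartic_coeff_eq_zero hq
      exact second_derivatives_eq_coeff k1 k2 e3 (by linarith) (by linarith) e0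
    obtain ⟨v, hv⟩ := exists_eq_linear_of_second_partials_eq_zero hΦ.fst_comp
      (hsec.mono fun z hz => hz.1)
    obtain ⟨w, hw⟩ := exists_eq_linear_of_second_partials_eq_zero hΦ.snd_comp
      (hsec.mono fun z hz => hz.2)
    have hEq : Φ =ᶠ[𝓝 (jetBase p)] affineMap v w (partialX (fun w => (Φ w).1) (jetBase p))
        (partialY (fun w => (Φ w).1) (jetBase p)) (partialX (fun w => (Φ w).2) (jetBase p))
        (partialY (fun w => (Φ w).2) (jetBase p)) := by
      filter_upwards [hv, hw] with z h1 h2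
      exact Prod.ext h1 h2
    refine ⟨_, mem_ASL2_iff.2 ⟨v, w, _, _, _, _, hJ.self_of_nhds, rfl⟩, ?_, ?_⟩
    · rwa [affineAction_eq]
    · rw [affineAction_eq, ← hEq.fst_snd_comp.1.alongJet_eq]
      exact H.self_of_nhds.transversal
  · rintro ⟨M, hM, hEq, hT⟩
    obtain ⟨v, w, a, b, c, d, hdet, rfl⟩ := mem_ASL2_iff.1 hM
    rw [affineAction_eq] at hEq hT
    rw [alongJet_affineMap] at hT
    have hc : Continuous fun p : ℝ × ℝ × ℝ => a + p.2.2 * b := by fun_prop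
    filter_upwards [eventually_jetBase hEq.eventually_nhds, hc.continuousAt.eventually_ne hT]
      with q h1 h2
    exact (carriesAt_affineMap hdet h2).congr (Filter.EventuallyEq.symm h1)

end Affine

/-! ### One-parameter families of transformations -/

section OneParameter

/-- The derivative of a one-parameter family at parameter zero. -/
noncomputable def familyDeriv (F : ℝ × (ℝ × ℝ) → ℝ) (w : ℝ × ℝ) : ℝ := deriv (fun ε => F (ε, w)) 0

/-- The partial derivative in `x` of all members of a family. -/
noncomputable def familyX (F : ℝ × (ℝ × ℝ) → ℝ) (q : ℝ × (ℝ × ℝ)) : ℝ :=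
  partialX (fun w => F (q.1, w)) q.2

/-- The partial derivative in `y` of all members of a family. -/
noncomputable def familyY (F : ℝ × (ℝ × ℝ) → ℝ) (q : ℝ × (ℝ × ℝ)) : ℝ :=
  partialY (fun w => F (q.1, w)) q.2

variable {F G : ℝ × (ℝ × ℝ) → ℝ} {z : ℝ × ℝ} {q : ℝ × (ℝ × ℝ)}

theorem fderiv_slice (hF : AnalyticAt ℝ F q) (h : ℝ × ℝ) :
    fderiv ℝ (fun w => F (q.1, w)) q.2 h = fderiv ℝ F q (0, h) := by
  have h1 := HasFDerivAt.comp (g := F) (f := fun w => (q.1, w)) q.2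
    hF.differentiableAt.hasFDerivAt ((hasFDerivAt_const q.1 q.2).prodMk (hasFDerivAt_id q.2))
  have e : fderiv ℝ (fun w => F (q.1, w)) q.2 = _ := h1.fderiv
  rw [e]; rfl

theorem familyX_eventuallyEq (hF : AnalyticAt ℝ F q) :
    familyX F =ᶠ[𝓝 q] fun q => fderiv ℝ F q (0, (1, 0)) := by
  filter_upwards [hF.eventually_analyticAt] with r hr
  exact fderiv_slice hr (1, 0)

theorem familyY_eventuallyEq (hF : AnalyticAt ℝ F q) :
    familyY F =ᶠ[𝓝 q] fun q => fderiv ℝ F q (0, (0, 1)) := by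
  filter_upwards [hF.eventually_analyticAt] with r hr
  exact fderiv_slice hr (0, 1)

theorem AnalyticAt.fderiv_apply_const {E : Type*} [NormedAddCommGroup E] [NormedSpace ℝ E]
    {F : E → ℝ} {x : E} (hF : AnalyticAt ℝ F x) (v : E) : AnalyticAt ℝ (fun q => fderiv ℝ F q v) x :=
  ((ContinuousLinearMap.apply ℝ ℝ v).analyticAt _).comp hF.fderiv

theorem AnalyticAt.familyX (hF : AnalyticAt ℝ F q) : AnalyticAt ℝ (familyX F) q :=
  (hF.fderiv_apply_const _).congr (familyX_eventuallyEq hF).symm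

theorem AnalyticAt.familyY (hF : AnalyticAt ℝ F q) : AnalyticAt ℝ (familyY F) q :=
  (hF.fderiv_apply_const _).congr (familyY_eventuallyEq hF).symm

theorem hasDerivAt_parameter (hF : AnalyticAt ℝ F (0, z)) :
    HasDerivAt (fun ε => F (ε, z)) (fderiv ℝ F (0, z) (1, 0)) 0 :=
  HasFDerivAt.comp_hasDerivAt (f := fun ε : ℝ => (ε, z)) 0 hF.differentiableAt.hasFDerivAt
    ((hasDerivAt_id (0 : ℝ)).prodMk (hasDerivAt_const 0 z))

theorem familyDeriv_eq (hF : AnalyticAt ℝ F (0, z)) :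
    familyDeriv F z = fderiv ℝ F (0, z) (1, 0) := (hasDerivAt_parameter hF).deriv

theorem hasDerivAt_familyDeriv (hF : AnalyticAt ℝ F (0, z)) :
    HasDerivAt (fun ε => F (ε, z)) (familyDeriv F z) 0 := by
  rw [familyDeriv_eq hF]; exact hasDerivAt_parameter hF

theorem eventually_slice_zero {P : ℝ × (ℝ × ℝ) → Prop} (h : ∀ᶠ q in 𝓝 ((0 : ℝ), z), P q) :
    ∀ᶠ w in 𝓝 z, P (0, w) := by
  have hc : Continuous fun w : ℝ × ℝ => ((0 : ℝ), w) := by fun_prop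
  exact hc.continuousAt.eventually h

theorem familyDeriv_eventuallyEq (hF : AnalyticAt ℝ F (0, z)) :
    familyDeriv F =ᶠ[𝓝 z] fun w => fderiv ℝ F (0, w) (1, 0) := by
  filter_upwards [eventually_slice_zero hF.eventually_analyticAt] with w hw
  exact familyDeriv_eq hw

theorem AnalyticAt.familyDeriv (hF : AnalyticAt ℝ F (0, z)) : AnalyticAt ℝ (familyDeriv F) z := by
  refine AnalyticAt.congr ?_ (familyDeriv_eventuallyEq hF).symm
  exact AnalyticAt.comp (g := fun q => fderiv ℝ F q (1, 0)) (f := fun w => ((0 : ℝ), w))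
    (hF.fderiv_apply_const _) (analyticAt_const.prod analyticAt_id)

/-- Symmetry of the second derivative on the product of parameter and plane. It allows the
prolongation formulas to be differentiated in the parameter term by term. -/
theorem familyDeriv_familyX (hF : AnalyticAt ℝ F (0, z)) :
    familyDeriv (familyX F) z = partialX (familyDeriv F) z := by
  rw [familyDeriv_eq hF.familyX, (familyX_eventuallyEq hF).fderiv_eq, hF.fderiv_fderiv_comm,
    (familyDeriv_eventuallyEq hF).partialX_eq]
  exact (fderiv_slice (q := (0, z)) (hF.fderiv_apply_const (1, 0)) (1, 0)).symm

theorem familyDeriv_familyY (hF : AnalyticAt ℝ F (0, z)) :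
    familyDeriv (familyY F) z = partialY (familyDeriv F) z := by
  rw [familyDeriv_eq hF.familyY, (familyY_eventuallyEq hF).fderiv_eq, hF.fderiv_fderiv_comm,
    (familyDeriv_eventuallyEq hF).partialY_eq]
  exact (fderiv_slice (q := (0, z)) (hF.fderiv_apply_const (1, 0)) (0, 1)).symm

theorem familyDeriv_familyX_eventuallyEq (hF : AnalyticAt ℝ F (0, z)) :
    familyDeriv (familyX F) =ᶠ[𝓝 z] partialX (familyDeriv F) := by
  filter_upwards [eventually_slice_zero hF.eventually_analyticAt] with w hw
  exact familyDeriv_familyX hw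

theorem familyDeriv_familyY_eventuallyEq (hF : AnalyticAt ℝ F (0, z)) :
    familyDeriv (familyY F) =ᶠ[𝓝 z] partialY (familyDeriv F) := by
  filter_upwards [eventually_slice_zero hF.eventually_analyticAt] with w hw
  exact familyDeriv_familyY hw

theorem hasDerivAt_partialX_family (hF : AnalyticAt ℝ F (0, z)) :
    HasDerivAt (fun ε => partialX (fun w => F (ε, w)) z) (partialX (familyDeriv F) z) 0 := by
  rw [← familyDeriv_familyX hF]; exact hasDerivAt_familyDeriv hF.familyX

theorem hasDerivAt_partialY_family (hF : AnalyticAt ℝ F (0, z)) :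
    HasDerivAt (fun ε => partialY (fun w => F (ε, w)) z) (partialY (familyDeriv F) z) 0 := by
  rw [← familyDeriv_familyY hF]; exact hasDerivAt_familyDeriv hF.familyY

theorem hasDerivAt_alongJet_family {p : ℝ × ℝ × ℝ} (hF : AnalyticAt ℝ F (0, jetBase p)) :
    HasDerivAt (fun ε => alongJet (fun w => F (ε, w)) p) (alongJet (familyDeriv F) p) 0 :=
  (hasDerivAt_partialX_family hF).add ((hasDerivAt_partialY_family hF).const_mul p.2.2)

theorem hasDerivAt_quadJet_family {p : ℝ × ℝ × ℝ} (hF : AnalyticAt ℝ F (0, jetBase p)) :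
    HasDerivAt (fun ε => quadJet (fun w => F (ε, w)) p) (quadJet (familyDeriv F) p) 0 := by
  have h1 := hasDerivAt_partialX_family hF.familyX
  have h2 := hasDerivAt_partialX_family hF.familyY
  have h3 := hasDerivAt_partialY_family hF.familyY
  rw [(familyDeriv_familyX_eventuallyEq hF).partialX_eq] at h1
  rw [(familyDeriv_familyY_eventuallyEq hF).partialX_eq] at h2
  rw [(familyDeriv_familyY_eventuallyEq hF).partialY_eq] at h3
  exact (h1.add (h2.const_mul (2 * p.2.2))).add (h3.const_mul (p.2.2 ^ 2))

/-- Infinitesimal form of the condition to preserve areas. -/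
theorem divergence_eq_zero (hF : AnalyticAt ℝ F (0, z)) (hG : AnalyticAt ℝ G (0, z))
    (hF0 : ∀ᶠ w in 𝓝 z, F (0, w) = w.1) (hG0 : ∀ᶠ w in 𝓝 z, G (0, w) = w.2)
    (hJ : ∀ᶠ ε in 𝓝 (0 : ℝ), pointJacobian (fun w => (F (ε, w), G (ε, w))) z = 1) :
    partialX (familyDeriv F) z + partialY (familyDeriv G) z = 0 := by
  have h := ((hasDerivAt_partialX_family hF).fun_mul (hasDerivAt_partialY_family hG)).fun_sub
    ((hasDerivAt_partialY_family hF).fun_mul (hasDerivAt_partialX_family hG))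
  have h0 := h.unique ((hasDerivAt_const (0 : ℝ) (1 : ℝ)).congr_of_eventuallyEq hJ)
  have hF0' : (fun w => F (0, w)) =ᶠ[𝓝 z] fun w => w.1 := hF0
  have hG0' : (fun w => G (0, w)) =ᶠ[𝓝 z] fun w => w.2 := hG0
  rw [hF0'.partialX_eq, hF0'.partialY_eq, hG0'.partialX_eq, hG0'.partialY_eq, partialX_fst,
    partialY_fst, partialX_snd, partialY_snd] at h0
  linarith

theorem alongJet_snd {p : ℝ × ℝ × ℝ} : alongJet (fun w => w.2) p = p.2.2 := by
  simp [alongJet, partialX_snd, partialY_snd]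

theorem quadJet_fst {p : ℝ × ℝ × ℝ} : quadJet (fun w => w.1) p = 0 := by
  simpa using quadJet_linear (v := 0) (a := 1) (b := 0) (p := p)

theorem quadJet_snd {p : ℝ × ℝ × ℝ} : quadJet (fun w => w.2) p = 0 := by
  simpa using quadJet_linear (v := 0) (a := 0) (b := 1) (p := p)

/-- Infinitesimal form of the condition to preserve the equation `y'' = f`. -/
theorem infinitesimal_symmetry {f : ℝ × ℝ × ℝ → ℝ} {p : ℝ × ℝ × ℝ} (hf : AnalyticAt ℝ f p)
    (hF : AnalyticAt ℝ F (0, jetBase p)) (hG : AnalyticAt ℝ G (0, jetBase p))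
    (hF0 : ∀ᶠ w in 𝓝 (jetBase p), F (0, w) = w.1) (hG0 : ∀ᶠ w in 𝓝 (jetBase p), G (0, w) = w.2)
    (hS : ∀ᶠ ε in 𝓝 (0 : ℝ), CarriesAt (fun w => (F (ε, w), G (ε, w))) f f p) :
    quadJet (familyDeriv G) p - p.2.2 * quadJet (familyDeriv F) p =
      fderiv ℝ f p (familyDeriv F (jetBase p), familyDeriv G (jetBase p),
        alongJet (familyDeriv G) p - p.2.2 * alongJet (familyDeriv F) p) +
      3 * f p * alongJet (familyDeriv F) p := by
  have hF0' : (fun w => F (0, w)) =ᶠ[𝓝 (jetBase p)] fun w => w.1 := hF0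
  have hG0' : (fun w => G (0, w)) =ᶠ[𝓝 (jetBase p)] fun w => w.2 := hG0
  have eA : alongJet (fun w => F (0, w)) p = 1 := hF0'.alongJet_eq.trans alongJet_fst
  have eB : alongJet (fun w => G (0, w)) p = p.2.2 := hG0'.alongJet_eq.trans alongJet_snd
  have eQ : quadJet (fun w => F (0, w)) p = 0 := hF0'.quadJet_eq.trans quadJet_fst
  have eR : quadJet (fun w => G (0, w)) p = 0 := hG0'.quadJet_eq.trans quadJet_snd
  have dA := hasDerivAt_alongJet_family hF
  have dB := hasDerivAt_alongJet_family hG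
  have dq := dB.fun_div dA (by rw [eA]; exact one_ne_zero)
  have dX := (hasDerivAt_familyDeriv hF).prodMk ((hasDerivAt_familyDeriv hG).prodMk dq)
  have e0 : (F (0, jetBase p), G (0, jetBase p),
      alongJet (fun w => G (0, w)) p / alongJet (fun w => F (0, w)) p) = p := by
    rw [eA, eB, hF0.self_of_nhds, hG0.self_of_nhds, div_one]; rfl
  have hf' : HasFDerivAt f (fderiv ℝ f p) (F (0, jetBase p), G (0, jetBase p),
      alongJet (fun w => G (0, w)) p / alongJet (fun w => F (0, w)) p) := by
    rw [e0]; exact hf.differentiableAt.hasFDerivAt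
  -- Both sides of the pointwise identity of `CarriesAt` are differentiated at parameter zero, where
  -- the transformation is the identity.
  have dL := (hf'.comp_hasDerivAt (0 : ℝ) dX).mul (dA.fun_pow 3)
  have dR := ((dA.fun_mul (hasDerivAt_quadJet_family hG)).fun_sub
    (dB.fun_mul (hasDerivAt_quadJet_family hF))).const_add (f p)
  have h0 := dL.unique (dR.congr_of_eventuallyEq (hS.mono fun ε hε => hε.eq))
  have e1 : (F (0, jetBase p), G (0, jetBase p), p.2.2) = p := by
    rw [hF0.self_of_nhds, hG0.self_of_nhds]; rfl
  simp only [Function.comp, eA, eB, eQ, eR] at h0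
  simp only [one_pow, mul_one, mul_zero, div_one, one_mul, zero_add, e1] at h0
  rw [← h0]
  push_cast
  ring

end OneParameter

/-! ### Infinitesimal symmetries -/

section SymmetryField

/-- The components of the first jet of a divergence-free vector field `(ξ, η)`. -/
noncomputable def fieldJet (ξ η : ℝ × ℝ → ℝ) (z : ℝ × ℝ) : Fin 5 → ℝ :=
  ![ξ z, η z, partialX ξ z, partialY ξ z, partialX η z]

/-- The vector field `(ξ, η)` is an infinitesimal area-preserving symmetry of `y'' = f` on `U × I`. -/
structure IsSymmetryField (f : ℝ × ℝ × ℝ → ℝ) (U : Set (ℝ × ℝ)) (I : Set ℝ) (ξ η : ℝ × ℝ → ℝ) :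
    Prop where
  analytic_fst : ∀ z ∈ U, AnalyticAt ℝ ξ z
  analytic_snd : ∀ z ∈ U, AnalyticAt ℝ η z
  divergence : ∀ z ∈ U, partialX ξ z + partialY η z = 0
  equation : ∀ z ∈ U, ∀ s ∈ I, quadJet η (z.1, z.2, s) - s * quadJet ξ (z.1, z.2, s) =
    fderiv ℝ f (z.1, z.2, s) (ξ z, η z, alongJet η (z.1, z.2, s) - s * alongJet ξ (z.1, z.2, s)) +
      3 * f (z.1, z.2, s) * alongJet ξ (z.1, z.2, s)

theorem fderiv_eq_three_partials (f : ℝ × ℝ × ℝ → ℝ) (p : ℝ × ℝ × ℝ) (a b c : ℝ) :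
    fderiv ℝ f p (a, b, c) =
      a * fderiv ℝ f p (1, 0, 0) + b * fderiv ℝ f p (0, 1, 0) + c * fderiv ℝ f p (0, 0, 1) := by
  have : ((a, b, c) : ℝ × ℝ × ℝ) =
      a • ((1, 0, 0) : ℝ × ℝ × ℝ) + b • ((0, 1, 0) : ℝ × ℝ × ℝ) + c • ((0, 0, 1) : ℝ × ℝ × ℝ) := by
    ext <;> simp
  rw [this, map_add, map_add, map_smul, map_smul, map_smul]
  rfl

/-- The coefficients of the infinitesimal symmetry condition in terms of the jet of the field. -/
noncomputable def symmetryCoeff (f : ℝ × ℝ × ℝ → ℝ) (i : Fin 5) (p : ℝ × ℝ × ℝ) : ℝ :=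
  ![fderiv ℝ f p (1, 0, 0), fderiv ℝ f p (0, 1, 0), -2 * p.2.2 * fderiv ℝ f p (0, 0, 1) + 3 * f p,
    -p.2.2 ^ 2 * fderiv ℝ f p (0, 0, 1) + 3 * p.2.2 * f p, fderiv ℝ f p (0, 0, 1)] i

variable {f : ℝ × ℝ × ℝ → ℝ} {U : Set (ℝ × ℝ)} {I : Set ℝ} {ξ η : ℝ × ℝ → ℝ} {z z₀ : ℝ × ℝ}

theorem continuousAt_symmetryCoeff {p : ℝ × ℝ × ℝ} (hf : AnalyticAt ℝ f p) (i : Fin 5) :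
    ContinuousAt (symmetryCoeff f i) p := by
  have h0 := hf.continuousAt
  have h1 := (hf.fderiv_apply_const (1, 0, 0)).continuousAt
  have h2 := (hf.fderiv_apply_const (0, 1, 0)).continuousAt
  have h3 := (hf.fderiv_apply_const (0, 0, 1)).continuousAt
  unfold symmetryCoeff
  fin_cases i <;> simp <;> fun_prop

theorem IsSymmetryField.second_partials (h : IsSymmetryField f U I ξ η) (hU : IsOpen U)
    (hz : z ∈ U) :
    partialX (partialY η) z = -partialX (partialX ξ) z ∧
      partialY (partialY η) z = -partialX (partialY ξ) z := by
  have e : partialY η =ᶠ[𝓝 z] fun w => -partialX ξ w := by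
    filter_upwards [hU.mem_nhds hz] with w hw
    linarith [h.divergence w hw]
  rw [e.partialX_eq, e.partialY_eq, partialX_neg, partialY_neg,
    ← partialX_partialY_comm (h.analytic_fst z hz)]
  exact ⟨rfl, rfl⟩

/-- Vanishing divergence removes `η_y` and its derivatives. What remains is a cubic in the slope
whose coefficients are four independent second derivatives, equated with an expression linear in the
first jet. -/
theorem IsSymmetryField.reduced_equation (h : IsSymmetryField f U I ξ η) (hU : IsOpen U)
    (hz : z ∈ U) {s : ℝ} (hs : s ∈ I) :
    partialX (partialX η) z - 3 * s * partialX (partialX ξ) z - 3 * s ^ 2 * partialX (partialY ξ) z -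
      s ^ 3 * partialY (partialY ξ) z =
      fderiv ℝ f (z.1, z.2, s) (ξ z, η z,
        partialX η z - 2 * s * partialX ξ z - s ^ 2 * partialY ξ z) +
      3 * f (z.1, z.2, s) * (partialX ξ z + s * partialY ξ z) := by
  have e := h.equation z hz s hs
  obtain ⟨e1, e2⟩ := h.second_partials hU hz
  have e3 : partialY η z = -partialX ξ z := by linarith [h.divergence z hz]
  simp only [quadJet, alongJet, jetBase] at e
  rw [fderiv_eq_three_partials] at e ⊢
  rw [e1, e2, e3] at e
  linear_combination e

/-- Inversion of the Vandermonde matrix. The weights do not depend on the polynomial, so bounds and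
analyticity pass from values at the nodes to coefficients. -/
theorem exists_interpolation (s : Fin 4 → ℝ) (hs : Function.Injective s) :
    ∃ m : Fin 4 → Fin 4 → ℝ, ∀ e : Fin 4 → ℝ, ∀ j, e j = ∑ k, m j k * ∑ i, e i * s k ^ (i : ℕ) := by
  refine ⟨fun j k => (Matrix.vandermonde s)⁻¹ j k, fun e j => ?_⟩
  have hdet : IsUnit (Matrix.vandermonde s).det :=
    isUnit_iff_ne_zero.2 (Matrix.det_vandermonde_ne_zero_iff.2 hs)
  have h1 : (Matrix.vandermonde s)⁻¹.mulVec ((Matrix.vandermonde s).mulVec e) = e := by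
    rw [Matrix.mulVec_mulVec, Matrix.nonsing_inv_mul _ hdet, Matrix.one_mulVec]
  conv_lhs => rw [← h1]
  simp only [Matrix.mulVec, dotProduct, Matrix.vandermonde_apply]
  refine Finset.sum_congr rfl fun k _ => ?_
  congr 1
  exact Finset.sum_congr rfl fun i _ => mul_comm _ _

theorem exists_four_points {s₀ : ℝ} (hI : I ∈ 𝓝 s₀) :
    ∃ s : Fin 4 → ℝ, Function.Injective s ∧ ∀ k, s k ∈ I := by
  obtain ⟨T, hT, hcard⟩ := (infinite_of_mem_nhds s₀ hI).exists_subset_card_eq 4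
  let e := (Finset.equivFinOfCardEq hcard).symm
  exact ⟨fun k => (e k : ℝ), fun a b hab => e.injective (Subtype.ext hab), fun k => hT (e k).2⟩

/-- The second derivatives of infinitesimal symmetries, which determine the symmetry condition. -/
noncomputable def fieldSecond (ξ η : ℝ × ℝ → ℝ) (z : ℝ × ℝ) : Fin 4 → ℝ :=
  ![partialX (partialX η) z, -3 * partialX (partialX ξ) z, -3 * partialX (partialY ξ) z,
    -partialY (partialY ξ) z]

theorem IsSymmetryField.fieldSecond_eq (h : IsSymmetryField f U I ξ η) (hU : IsOpen U)
    (hz : z ∈ U) {s : ℝ} (hs : s ∈ I) :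
    ∑ i, fieldSecond ξ η z i * s ^ (i : ℕ) =
      ∑ i, symmetryCoeff f i (z.1, z.2, s) * fieldJet ξ η z i := by
  have e := h.reduced_equation hU hz hs
  rw [fderiv_eq_three_partials] at e
  simp [Fin.sum_univ_four, Fin.sum_univ_five, fieldSecond, symmetryCoeff, fieldJet]
  linear_combination e

/-- The second derivatives of infinitesimal symmetries are controlled by their first jets. -/
theorem exists_second_bound (hU : IsOpen U) (hz₀ : z₀ ∈ U) {s₀ : ℝ} (hI : I ∈ 𝓝 s₀)
    (hf : ∀ s ∈ I, AnalyticAt ℝ f (z₀.1, z₀.2, s)) :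
    ∃ K : ℝ, ∃ ρ > 0, Metric.ball z₀ ρ ⊆ U ∧ ∀ ξ η, IsSymmetryField f U I ξ η →
      ∀ z ∈ Metric.ball z₀ ρ, ∀ j, |fieldSecond ξ η z j| ≤ K * ‖fieldJet ξ η z‖ := by
  obtain ⟨s, hsinj, hsI⟩ := exists_four_points hI
  obtain ⟨m, hm⟩ := exists_interpolation s hsinj
  let b : Fin 4 → ℝ × ℝ → ℝ := fun j z =>
    ∑ k, |m j k| * ∑ i, |symmetryCoeff f i (z.1, z.2, s k)|
  have hb : ∀ j, ContinuousAt (b j) z₀ := fun j => by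
    refine tendsto_finsetSum _ fun k _ => Tendsto.const_mul _ (tendsto_finsetSum _ fun i _ => ?_)
    have hc : ContinuousAt (fun z : ℝ × ℝ => ((z.1, z.2, s k) : ℝ × ℝ × ℝ)) z₀ := by fun_prop
    exact (ContinuousAt.comp (g := symmetryCoeff f i) (f := fun z : ℝ × ℝ => (z.1, z.2, s k))
      (continuousAt_symmetryCoeff (hf _ (hsI k)) i) hc).abs
  have hbdd : ∀ᶠ z in 𝓝 z₀, ∀ j, b j z < b j z₀ + 1 :=
    eventually_all.2 fun j => (hb j).eventually_lt_const (lt_add_one _)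
  obtain ⟨ρ, hρ, hball⟩ := Metric.eventually_nhds_iff_ball.1 (hbdd.and (hU.eventually_mem hz₀))
  have hbnn : ∀ j z, 0 ≤ b j z := fun j z => by positivity
  -- Continuity at `z₀` bounds each `b j` by `b j z₀ + 1` on the ball; the sum is one constant
  -- serving all four `j`, and it is independent of the field.
  refine ⟨∑ j, (b j z₀ + 1), ρ, hρ, fun z hz => (hball z hz).2, fun ξ η h z hz j => ?_⟩
  have h1 : |fieldSecond ξ η z j| ≤ b j z * ‖fieldJet ξ η z‖ := by
    rw [hm (fieldSecond ξ η z) j]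
    refine (Finset.abs_sum_le_sum_abs _ _).trans ?_
    rw [Finset.sum_mul]
    refine Finset.sum_le_sum fun k _ => ?_
    rw [abs_mul, mul_assoc, h.fieldSecond_eq hU (hball z hz).2 (hsI k)]
    refine mul_le_mul_of_nonneg_left ?_ (abs_nonneg _)
    refine (Finset.abs_sum_le_sum_abs _ _).trans ?_
    rw [Finset.sum_mul]
    refine Finset.sum_le_sum fun i _ => ?_
    rw [abs_mul]
    exact mul_le_mul_of_nonneg_left (norm_le_pi_norm (fieldJet ξ η z) i) (abs_nonneg _)
  refine h1.trans (mul_le_mul_of_nonneg_right ?_ (norm_nonneg _))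
  refine ((hball z hz).1 j).le.trans ?_
  exact Finset.single_le_sum (f := fun j => b j z₀ + 1)
    (fun j _ => add_nonneg (hbnn j z₀) zero_le_one) (Finset.mem_univ j)

/-- An infinitesimal symmetry whose first jet vanishes at a point vanishes. -/
theorem IsSymmetryField.fieldJet_eq_zero (h : IsSymmetryField f U I ξ η) (hU : IsOpen U) {K ρ : ℝ}
    (hball : Metric.ball z₀ ρ ⊆ U)
    (hK : ∀ z ∈ Metric.ball z₀ ρ, ∀ j, |fieldSecond ξ η z j| ≤ K * ‖fieldJet ξ η z‖)
    {z₁ z₂ : ℝ × ℝ} (h1 : z₁ ∈ Metric.ball z₀ ρ) (h2 : z₂ ∈ Metric.ball z₀ ρ)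
    (hjet : fieldJet ξ η z₁ = 0) : fieldJet ξ η z₂ = 0 := by
  set k := z₂ - z₁
  let c : ℝ → ℝ × ℝ := fun t => (z₁.1 + t * k.1, z₁.2 + t * k.2)
  have hc : ∀ t ∈ Icc (0 : ℝ) 1, c t ∈ Metric.ball z₀ ρ := fun t ht => by
    have : c t = z₁ + t • (z₂ - z₁) := by ext <;> simp [c, k]
    rw [this]
    exact (convex_ball z₀ ρ).add_smul_sub_mem h1 h2 ht
  have hcd1 : ∀ t, HasDerivAt (fun t => z₁.1 + t * k.1) k.1 t := fun t => by
    simpa using ((hasDerivAt_id t).mul_const k.1).const_add z₁.1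
  have hcd2 : ∀ t, HasDerivAt (fun t => z₁.2 + t * k.2) k.2 t := fun t => by
    simpa using ((hasDerivAt_id t).mul_const k.2).const_add z₁.2
  have hF : ∀ F : ℝ × ℝ → ℝ, ∀ t, AnalyticAt ℝ F (c t) →
      HasDerivAt (fun t => F (c t)) (k.1 * partialX F (c t) + k.2 * partialY F (c t)) t :=
    fun F t ha => HasDerivAt.comp_partials (F := F) ha (hcd1 t) (hcd2 t)
  let e : ℝ → Fin 5 → ℝ := fun t => fieldJet ξ η (c t)
  let e' : ℝ → Fin 5 → ℝ := fun t =>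
    ![k.1 * partialX ξ (c t) + k.2 * partialY ξ (c t),
      k.1 * partialX η (c t) + k.2 * partialY η (c t),
      k.1 * partialX (partialX ξ) (c t) + k.2 * partialY (partialX ξ) (c t),
      k.1 * partialX (partialY ξ) (c t) + k.2 * partialY (partialY ξ) (c t),
      k.1 * partialX (partialX η) (c t) + k.2 * partialY (partialX η) (c t)]
  have hd : ∀ t ∈ Icc (0 : ℝ) 1, HasDerivAt e (e' t) t := fun t ht => by
    have hx := h.analytic_fst _ (hball (hc t ht))
    have hy := h.analytic_snd _ (hball (hc t ht))
    rw [hasDerivAt_pi]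
    intro i
    fin_cases i
    · exact hF ξ t hx
    · exact hF η t hy
    · exact hF _ t hx.partialX
    · exact hF _ t hx.partialY
    · exact hF _ t hy.partialX
  have hbound : ∀ t ∈ Icc (0 : ℝ) 1, ‖e' t‖ ≤ (|k.1| + |k.2|) * (1 + |K|) * ‖e t‖ := fun t ht => by
    have hx := h.analytic_fst _ (hball (hc t ht))
    have hy := h.analytic_snd _ (hball (hc t ht))
    have hj := fun i => norm_le_pi_norm (e t) i
    have hs := hK _ (hc t ht)
    -- The factor `1 + |K|` dominates both kinds of entries of `e'`: first derivatives, bounded by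
    -- `‖e t‖`, and second derivatives, bounded by `K * ‖e t‖`.
    have hKK : K * ‖e t‖ ≤ (1 + |K|) * ‖e t‖ :=
      mul_le_mul_of_nonneg_right (by linarith [le_abs_self K]) (norm_nonneg _)
    have h1K : ‖e t‖ ≤ (1 + |K|) * ‖e t‖ :=
      le_mul_of_one_le_left (norm_nonneg _) (by linarith [abs_nonneg K])
    have comb : ∀ a b : ℝ, |a| ≤ (1 + |K|) * ‖e t‖ → |b| ≤ (1 + |K|) * ‖e t‖ →
        ‖k.1 * a + k.2 * b‖ ≤ (|k.1| + |k.2|) * (1 + |K|) * ‖e t‖ := fun a b ha hb => by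
      rw [Real.norm_eq_abs]
      refine (abs_add_le _ _).trans ?_
      rw [abs_mul, abs_mul, mul_assoc, add_mul]
      exact add_le_add (mul_le_mul_of_nonneg_left ha (abs_nonneg _))
        (mul_le_mul_of_nonneg_left hb (abs_nonneg _))
    have j2 : |partialX ξ (c t)| ≤ ‖e t‖ := hj 2
    have j3 : |partialY ξ (c t)| ≤ ‖e t‖ := hj 3
    have j4 : |partialX η (c t)| ≤ ‖e t‖ := hj 4
    have s0 : |partialX (partialX η) (c t)| ≤ K * ‖e t‖ := hs 0
    have s1 : |-3 * partialX (partialX ξ) (c t)| ≤ K * ‖e t‖ := hs 1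
    have s2 : |-3 * partialX (partialY ξ) (c t)| ≤ K * ‖e t‖ := hs 2
    have s3 : |-partialY (partialY ξ) (c t)| ≤ K * ‖e t‖ := hs 3
    have h3 : ∀ a : ℝ, |-3 * a| ≤ K * ‖e t‖ → |a| ≤ (1 + |K|) * ‖e t‖ := fun a ha => by
      rw [abs_mul, abs_neg, abs_of_pos (by norm_num : (0 : ℝ) < 3)] at ha
      linarith [abs_nonneg a]
    obtain ⟨d1, -⟩ := h.second_partials hU (hball (hc t ht))
    have dv : partialY η (c t) = -partialX ξ (c t) := by
      linarith [h.divergence _ (hball (hc t ht))]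
    rw [pi_norm_le_iff_of_nonneg (by positivity)]
    intro i
    fin_cases i
    · exact comb _ _ (j2.trans h1K) (j3.trans h1K)
    · refine comb _ _ (j4.trans h1K) ?_
      rw [dv, abs_neg]; exact j2.trans h1K
    · refine comb _ _ (h3 _ s1) ?_
      rw [← partialX_partialY_comm hx]; exact h3 _ s2
    · refine comb _ _ (h3 _ s2) ?_
      rw [abs_neg] at s3; exact s3.trans hKK
    · refine comb _ _ (s0.trans hKK) ?_
      rw [← partialX_partialY_comm hy, d1, abs_neg]; exact h3 _ s1
  have c0 : c 0 = z₁ := by simp [c]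
  have c1 : c 1 = z₂ := by simp [c, k]
  -- Gronwall along the segment from `z₁` to `z₂`: the jet is zero at the start and its derivative
  -- is bounded by a multiple of itself.
  have := eq_zero_of_abs_deriv_le_mul_abs_self_of_eq_zero_right (f := e) (f' := e')
    (fun t ht => (hd t ht).continuousAt.continuousWithinAt)
    (fun t ht => (hd t ⟨ht.1, ht.2.le⟩).hasDerivWithinAt) (by simp only [e]; rw [c0, hjet])
    (fun t ht => hbound t ⟨ht.1, ht.2.le⟩) 1 ⟨zero_le_one, le_rfl⟩
  rw [← c1]; exact this

end SymmetryField

/-! ### Equations with a transitive algebra of infinitesimal symmetries -/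

section Transitive

variable {f : ℝ × ℝ × ℝ → ℝ} {U : Set (ℝ × ℝ)} {I : Set ℝ} {ξ η : ℝ × ℝ → ℝ} {z z₀ : ℝ × ℝ}
  {A B C D : ℝ × ℝ → ℝ}

/-- Two fields vanishing at `z` suffice. The shear with `η_x = 1` shows that `f_{y'}` is a cubic in
the slope, and the scaling with `ξ_x = 1` that `3 f - 2 y' f_{y'}` is one. -/
theorem exists_cubic_of_isotropy (hU : IsOpen U) (hI : IsOpen I) {s₀ : ℝ} (hs₀ : s₀ ∈ I)
    (hf : ∀ z ∈ U, ∀ s ∈ I, AnalyticAt ℝ f (z.1, z.2, s)) (hz : z ∈ U)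
    (H : ∀ y : Fin 5 → ℝ, ∃ ξ η, IsSymmetryField f U I ξ η ∧ fieldJet ξ η z = y) :
    ∃ e : Fin 4 → ℝ, ∀ s ∈ I, f (z.1, z.2, s) = ∑ i, e i * s ^ (i : ℕ) := by
  obtain ⟨ξ, η, h1, j1⟩ := H ![0, 0, 0, 0, 1]
  obtain ⟨ξ', η', h2, j2⟩ := H ![0, 0, 1, 0, 0]
  set e := fieldSecond ξ η z
  set e' := fieldSecond ξ' η' z
  have E1 : ∀ s ∈ I, fderiv ℝ f (z.1, z.2, s) (0, 0, 1) =
      e 0 + e 1 * s + e 2 * s ^ 2 + e 3 * s ^ 3 := fun s hs => by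
    have := h1.fieldSecond_eq hU hz hs
    rw [j1] at this
    simp [Fin.sum_univ_four, Fin.sum_univ_five, symmetryCoeff] at this
    exact this.symm
  have E2 : ∀ s ∈ I, 3 * f (z.1, z.2, s) = 2 * s * (e 0 + e 1 * s + e 2 * s ^ 2 + e 3 * s ^ 3) +
      (e' 0 + e' 1 * s + e' 2 * s ^ 2 + e' 3 * s ^ 3) := fun s hs => by
    have := h2.fieldSecond_eq hU hz hs
    rw [j2] at this
    simp [Fin.sum_univ_four, Fin.sum_univ_five, symmetryCoeff] at this
    have e1 := E1 s hs
    linear_combination (2 * s) * e1 - this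
  -- So far `f` has degree at most four. Differentiating `E2` and comparing with `E1`, the cubic
  -- coefficients give `8 * e 3 = 3 * e 3`, which removes the quartic term.
  have E3 : ∀ s ∈ I, (e' 1 + 2 * e 0 - 3 * e 0) + (2 * e' 2 + 4 * e 1 - 3 * e 1) * s +
      (3 * e' 3 + 6 * e 2 - 3 * e 2) * s ^ 2 + (8 * e 3 - 3 * e 3) * s ^ 3 + 0 * s ^ 4 = 0 :=
    fun s hs => by
    have d1 : HasDerivAt (fun s => f (z.1, z.2, s)) (fderiv ℝ f (z.1, z.2, s) (0, 0, 1)) s :=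
      HasFDerivAt.comp_hasDerivAt (f := fun s : ℝ => ((z.1, z.2, s) : ℝ × ℝ × ℝ)) s
        (hf z hz s hs).differentiableAt.hasFDerivAt
        ((hasDerivAt_const s z.1).prodMk ((hasDerivAt_const s z.2).prodMk (hasDerivAt_id s)))
    have hi := hasDerivAt_id' s
    have d2 := ((hi.const_mul 2).fun_mul (((((hi.const_mul (e 1)).const_add (e 0))).fun_add
      ((hi.fun_pow 2).const_mul (e 2))).fun_add ((hi.fun_pow 3).const_mul (e 3)))).fun_add
      (((((hi.const_mul (e' 1)).const_add (e' 0))).fun_add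
      ((hi.fun_pow 2).const_mul (e' 2))).fun_add ((hi.fun_pow 3).const_mul (e' 3)))
    have d3 := (d1.const_mul 3).unique (d2.congr_of_eventuallyEq (by
      filter_upwards [hI.mem_nhds hs] with r hr
      exact E2 r hr))
    rw [E1 s hs] at d3
    simp at d3
    linear_combination -d3
  obtain ⟨-, -, -, e3, -⟩ := quartic_coeff_eq_zero (s₀ := s₀)
    (by filter_upwards [hI.mem_nhds hs₀] with s hs using E3 s hs)
  have e3' : e 3 = 0 := by linarith
  refine ⟨![e' 0 / 3, (e' 1 + 2 * e 0) / 3, (e' 2 + 2 * e 1) / 3, (e' 3 + 2 * e 2) / 3],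
    fun s hs => ?_⟩
  have := E2 s hs
  simp [Fin.sum_univ_four]
  rw [e3'] at this
  linear_combination this / 3

/-- A function which is cubic in the last variable has analytic coefficients. -/
theorem exists_analytic_coefficients {s₀ : ℝ} (hI : I ∈ 𝓝 s₀)
    (hf : ∀ z ∈ U, ∀ s ∈ I, AnalyticAt ℝ f (z.1, z.2, s))
    (H : ∀ z ∈ U, ∃ e : Fin 4 → ℝ, ∀ s ∈ I, f (z.1, z.2, s) = ∑ i, e i * s ^ (i : ℕ)) :
    ∃ A B C D : ℝ × ℝ → ℝ, (∀ z ∈ U, AnalyticAt ℝ A z ∧ AnalyticAt ℝ B z ∧ AnalyticAt ℝ C z ∧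
      AnalyticAt ℝ D z) ∧ ∀ z ∈ U, ∀ s ∈ I, IsCubicAt A B C D f (z.1, z.2, s) := by
  obtain ⟨s, hsinj, hsI⟩ := exists_four_points hI
  obtain ⟨m, hm⟩ := exists_interpolation s hsinj
  -- The coefficients are recovered as fixed linear combinations of `f` at four fixed slopes, hence
  -- are analytic in the base point.
  let c : Fin 4 → ℝ × ℝ → ℝ := fun j z => ∑ k, m j k * f (z.1, z.2, s k)
  have hc : ∀ j, ∀ z ∈ U, AnalyticAt ℝ (c j) z := fun j z hz => by
    refine Finset.analyticAt_fun_sum _ fun k _ => analyticAt_const.fun_mul ?_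
    exact AnalyticAt.comp (g := f) (f := fun z : ℝ × ℝ => (z.1, z.2, s k)) (hf z hz _ (hsI k))
      (by fun_prop)
  refine ⟨c 3, fun z => c 2 z * (1 / 3), fun z => c 1 z * (1 / 3), c 0, fun z hz =>
    ⟨hc 3 z hz, (hc 2 z hz).fun_mul analyticAt_const, (hc 1 z hz).fun_mul analyticAt_const,
      hc 0 z hz⟩, fun z hz t ht => ?_⟩
  obtain ⟨e, he⟩ := H z hz
  have hce : ∀ j, c j z = e j := fun j => by
    rw [hm e j]
    exact Finset.sum_congr rfl fun k _ => by rw [he _ (hsI k)]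
  unfold IsCubicAt
  simp only [jetBase]
  rw [he t ht, hce, hce, hce, hce]
  simp [Fin.sum_univ_four]
  ring

theorem fderiv_cubic {p : ℝ × ℝ × ℝ} (hf : AnalyticAt ℝ f p) (hA : AnalyticAt ℝ A (jetBase p))
    (hB : AnalyticAt ℝ B (jetBase p)) (hC : AnalyticAt ℝ C (jetBase p))
    (hD : AnalyticAt ℝ D (jetBase p)) (hcub : ∀ᶠ q in 𝓝 p, IsCubicAt A B C D f q) (a b c : ℝ) :
    fderiv ℝ f p (a, b, c) =
      (a * partialX A (jetBase p) + b * partialY A (jetBase p)) * p.2.2 ^ 3 +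
      3 * (a * partialX B (jetBase p) + b * partialY B (jetBase p)) * p.2.2 ^ 2 +
      3 * (a * partialX C (jetBase p) + b * partialY C (jetBase p)) * p.2.2 +
      (a * partialX D (jetBase p) + b * partialY D (jetBase p)) +
      c * (3 * A (jetBase p) * p.2.2 ^ 2 + 6 * B (jetBase p) * p.2.2 + 3 * C (jetBase p)) := by
  have l : ∀ u v : ℝ, HasDerivAt (fun t : ℝ => u + t * v) v 0 := fun u v => by
    simpa using ((hasDerivAt_id (0 : ℝ)).mul_const v).const_add u
  let γ : ℝ → ℝ × ℝ × ℝ := fun t => (p.1 + t * a, p.2.1 + t * b, p.2.2 + t * c)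
  have hγ : HasDerivAt γ (a, b, c) 0 := (l p.1 a).prodMk ((l p.2.1 b).prodMk (l p.2.2 c))
  have hγ0 : γ 0 = p := by simp [γ]
  have hb0 : ((p.1 + 0 * a, p.2.1 + 0 * b) : ℝ × ℝ) = jetBase p := by simp [jetBase]
  have hF : ∀ F : ℝ × ℝ → ℝ, AnalyticAt ℝ F (jetBase p) →
      HasDerivAt (fun t : ℝ => F (p.1 + t * a, p.2.1 + t * b))
        (a * partialX F (jetBase p) + b * partialY F (jetBase p)) 0 := fun F ha => by
    have := HasDerivAt.comp_partials (F := F) (c := fun t => p.1 + t * a)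
      (d := fun t => p.2.1 + t * b) (t := 0) (by rw [hb0]; exact ha) (l p.1 a) (l p.2.1 b)
    rwa [hb0] at this
  have d1 : HasDerivAt (f ∘ γ) (fderiv ℝ f p (a, b, c)) 0 :=
    HasFDerivAt.comp_hasDerivAt (f := γ) 0 (by rw [hγ0]; exact hf.differentiableAt.hasFDerivAt) hγ
  have hs := l p.2.2 c
  have d2 := ((((hF A hA).fun_mul (hs.fun_pow 3)).fun_add
    (((hF B hB).const_mul 3).fun_mul (hs.fun_pow 2))).fun_add
    (((hF C hC).const_mul 3).fun_mul hs)).fun_add (hF D hD)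
  have hev : ∀ᶠ t in 𝓝 (0 : ℝ), IsCubicAt A B C D f (γ t) :=
    hγ.continuousAt.eventually (by rw [hγ0]; exact hcub)
  rw [d1.unique (d2.congr_of_eventuallyEq hev)]
  rw [hb0]
  push_cast
  ring

/-- The second derivatives of an infinitesimal symmetry of a cubic equation. -/
theorem IsSymmetryField.second_partials_cubic (h : IsSymmetryField f U I ξ η) (hU : IsOpen U)
    (hI : IsOpen I) {s₀ : ℝ} (hs₀ : s₀ ∈ I) (hf : ∀ z ∈ U, ∀ s ∈ I, AnalyticAt ℝ f (z.1, z.2, s))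
    (han : ∀ z ∈ U, AnalyticAt ℝ A z ∧ AnalyticAt ℝ B z ∧ AnalyticAt ℝ C z ∧ AnalyticAt ℝ D z)
    (hcub : ∀ z ∈ U, ∀ s ∈ I, IsCubicAt A B C D f (z.1, z.2, s)) (hz : z ∈ U) :
    partialX (partialX η) z = ξ z * partialX D z + η z * partialY D z + 3 * C z * partialX η z +
      3 * D z * partialX ξ z ∧
    partialX (partialX ξ) z = -(ξ z * partialX C z + η z * partialY C z + 2 * B z * partialX η z +
      C z * partialX ξ z + D z * partialY ξ z) ∧
    partialX (partialY ξ) z = -(ξ z * partialX B z + η z * partialY B z + A z * partialX η z -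
      B z * partialX ξ z + 2 * C z * partialY ξ z) ∧
    partialY (partialY ξ) z = -(ξ z * partialX A z + η z * partialY A z - 3 * A z * partialX ξ z +
      3 * B z * partialY ξ z) := by
  obtain ⟨kA, kB, kC, kD⟩ := han z hz
  have key : ∀ s ∈ I,
      (partialX (partialX η) z - (ξ z * partialX D z + η z * partialY D z +
        3 * C z * partialX η z + 3 * D z * partialX ξ z)) +
      (-3 * (partialX (partialX ξ) z + (ξ z * partialX C z + η z * partialY C z +
        2 * B z * partialX η z + C z * partialX ξ z + D z * partialY ξ z))) * s +
      (-3 * (partialX (partialY ξ) z + (ξ z * partialX B z + η z * partialY B z +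
        A z * partialX η z - B z * partialX ξ z + 2 * C z * partialY ξ z))) * s ^ 2 +
      (-(partialY (partialY ξ) z + (ξ z * partialX A z + η z * partialY A z -
        3 * A z * partialX ξ z + 3 * B z * partialY ξ z))) * s ^ 3 + 0 * s ^ 4 = 0 := fun s hs => by
    have e := h.reduced_equation hU hz hs
    have hev : ∀ᶠ q in 𝓝 ((z.1, z.2, s) : ℝ × ℝ × ℝ), IsCubicAt A B C D f q := by
      have hc : Continuous fun q : ℝ × ℝ × ℝ => q.2.2 := by fun_prop
      have h1 : ∀ᶠ q in 𝓝 ((z.1, z.2, s) : ℝ × ℝ × ℝ), jetBase q ∈ U :=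
        eventually_jetBase (hU.eventually_mem hz)
      have h2 : ∀ᶠ q in 𝓝 ((z.1, z.2, s) : ℝ × ℝ × ℝ), q.2.2 ∈ I :=
        hc.continuousAt.eventually (hI.eventually_mem hs)
      filter_upwards [h1, h2] with q k1 k2
      exact hcub _ k1 _ k2
    rw [fderiv_cubic (hf z hz s hs) (A := A) (B := B) (C := C) (D := D) kA kB kC kD hev,
      show f (z.1, z.2, s) = _ from hcub z hz s hs] at e
    simp only [jetBase] at e
    linear_combination e
  obtain ⟨e0, e1, e2, e3, -⟩ := quartic_coeff_eq_zero (s₀ := s₀)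
    (by filter_upwards [hI.mem_nhds hs₀] with s hs using key s hs)
  refine ⟨by linarith, by linarith, by linarith, by linarith⟩

/-- Transitivity of the infinitesimal symmetries on first jets forces the coefficients to be flat. -/
theorem coefficientRelationsAt_of_transitive (hU : IsOpen U) (hI : IsOpen I) {s₀ : ℝ} (hs₀ : s₀ ∈ I)
    (hf : ∀ z ∈ U, ∀ s ∈ I, AnalyticAt ℝ f (z.1, z.2, s))
    (han : ∀ z ∈ U, AnalyticAt ℝ A z ∧ AnalyticAt ℝ B z ∧ AnalyticAt ℝ C z ∧ AnalyticAt ℝ D z)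
    (hcub : ∀ z ∈ U, ∀ s ∈ I, IsCubicAt A B C D f (z.1, z.2, s)) (hz : z ∈ U)
    (H : ∀ y : Fin 5 → ℝ, ∃ ξ η, IsSymmetryField f U I ξ η ∧ fieldJet ξ η z = y) :
    CoefficientRelationsAt A B C D z := by
  obtain ⟨kA, kB, kC, kD⟩ := han z hz
  -- The formulas for the second derivatives are differentiated once more and the mixed third
  -- derivatives compared. At a zero of the field only the linear part survives, acting on the
  -- curvature.
  have compat : ∀ ξ η, IsSymmetryField f U I ξ η → ξ z = 0 → η z = 0 →
      (partialX ξ z * ((partialY B z - partialX A z) - 2 * (A z * C z - B z ^ 2)) =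
        partialY ξ z * ((partialY C z - partialX B z) - (A z * D z - B z * C z))) ∧
      (partialX ξ z * ((partialY D z - partialX C z) - 2 * (B z * D z - C z ^ 2)) =
        partialX η z * ((partialX B z - partialY C z) + (A z * D z - B z * C z))) := by
    intro ξ η h hξ0 hη0
    have hx := h.analytic_fst z hz
    have hy := h.analytic_snd z hz
    have F := (hU.eventually_mem hz).mono fun w hw =>
      h.second_partials_cubic hU hI hs₀ hf han hcub hw
    obtain ⟨c1, c2, c3, c4⟩ := F.self_of_nhds
    have f1 := (show partialX (partialX η) =ᶠ[𝓝 z] _ from F.mono fun w hw => hw.1).partialY_eq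
    have f2 := (show partialX (partialX ξ) =ᶠ[𝓝 z] _ from F.mono fun w hw => hw.2.1).partialX_eq
    have f3 := (show partialX (partialY ξ) =ᶠ[𝓝 z] _ from F.mono fun w hw => hw.2.2.1).partialY_eq
    have f4 := (show partialY (partialY ξ) =ᶠ[𝓝 z] _ from F.mono fun w hw => hw.2.2.2).partialX_eq
    have eD : partialX (partialY η) =ᶠ[𝓝 z] fun w => -partialX (partialX ξ) w := by
      filter_upwards [hU.mem_nhds hz] with w hw
      exact (h.second_partials hU hw).1
    have dv : partialY η z = -partialX ξ z := by linarith [h.divergence z hz]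
    have dXY := (h.second_partials hU hz).1
    rw [partialY_partialX_partialX hy, eD.partialX_eq, partialX_neg] at f1
    rw [partialY_partialX_partialY hx] at f3
    simp (disch := fun_prop) only [partialX_add, partialY_add, partialX_sub, partialY_sub,
      partialX_neg, partialY_neg, partialX_mul, partialY_mul, partialX_const, partialY_const,
      hξ0, hη0, dv, ← partialX_partialY_comm hx, ← partialX_partialY_comm hy, dXY] at f1 f2 f3 f4
    simp only [hξ0, hη0, zero_mul, zero_add, add_zero, neg_mul, mul_neg] at f1 f2 f3 f4 c1 c2 c3 c4
    constructor
    · linear_combination (f4 - f3) / 2 + A z * c2 - 2 * B z * c3 + C z * c4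
    · linear_combination -(f1 + f2) / 2 + 2 * C z * c2 - D z * c3 + B z * c1
  -- The scaling gives the first and third relations, the shear with `ξ_y = 1` the middle one.
  obtain ⟨ξ, η, h1, j1⟩ := H ![0, 0, 1, 0, 0]
  obtain ⟨ξ', η', h2, j2⟩ := H ![0, 0, 0, 1, 0]
  obtain ⟨e1, e2⟩ := compat ξ η h1 (congrFun j1 0) (congrFun j1 1)
  obtain ⟨e3, -⟩ := compat ξ' η' h2 (congrFun j2 0) (congrFun j2 1)
  rw [show partialX ξ z = 1 from congrFun j1 2, show partialY ξ z = 0 from congrFun j1 3] at e1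
  rw [show partialX ξ z = 1 from congrFun j1 2, show partialX η z = 0 from congrFun j1 4] at e2
  rw [show partialX ξ' z = 0 from congrFun j2 2, show partialY ξ' z = 1 from congrFun j2 3] at e3
  exact ⟨by linarith, by linarith, by linarith⟩

end Transitive

/-! ### Local Lie groups of symmetries and their infinitesimal generators -/

section GroupAction

/-- The vector field of the plane generated by the tangent vector `c` of an acting group. -/
noncomputable def fundamentalField {E : Type*} [NormedAddCommGroup E] [NormedSpace ℝ E]
    (α : E → ℝ × ℝ → ℝ × ℝ) (c : E) (w : ℝ × ℝ) : ℝ × ℝ := fderiv ℝ (fun g => α g w) 0 c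

variable {E : Type*} [NormedAddCommGroup E] [NormedSpace ℝ E] {α : E → ℝ × ℝ → ℝ × ℝ}
  {z z₀ : ℝ × ℝ} {c : E}

theorem hasFDerivAt_action {g : E} (hα : AnalyticAt ℝ (fun w : E × (ℝ × ℝ) => α w.1 w.2) (g, z)) :
    HasFDerivAt (fun g => α g z) (fderiv ℝ (fun g => α g z) g) g := by
  have h : AnalyticAt ℝ (fun g => α g z) g :=
    AnalyticAt.comp (g := fun w : E × (ℝ × ℝ) => α w.1 w.2) (f := fun g => (g, z)) hα
      (analyticAt_id.prod analyticAt_const)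
  exact h.differentiableAt.hasFDerivAt

theorem hasDerivAt_action (hα : AnalyticAt ℝ (fun w : E × (ℝ × ℝ) => α w.1 w.2) (0, z)) :
    HasDerivAt (fun ε : ℝ => α (ε • c) z) (fundamentalField α c z) 0 := by
  have h : HasDerivAt (fun ε : ℝ => ε • c) c 0 := by
    simpa using (hasDerivAt_id (0 : ℝ)).smul_const c
  exact HasFDerivAt.comp_hasDerivAt (f := fun ε : ℝ => ε • c) 0
    (by rw [zero_smul]; exact hasFDerivAt_action hα) h

theorem analyticAt_oneParameter (hα : AnalyticAt ℝ (fun w : E × (ℝ × ℝ) => α w.1 w.2) (0, z)) :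
    AnalyticAt ℝ (fun q : ℝ × (ℝ × ℝ) => α (q.1 • c) q.2) (0, z) := by
  refine AnalyticAt.comp (g := fun w : E × (ℝ × ℝ) => α w.1 w.2)
    (f := fun q : ℝ × (ℝ × ℝ) => (q.1 • c, q.2)) (by simpa using hα) ?_
  exact (analyticAt_fst.smul analyticAt_const).prod analyticAt_snd

theorem familyDeriv_action (hα : AnalyticAt ℝ (fun w : E × (ℝ × ℝ) => α w.1 w.2) (0, z)) :
    familyDeriv (fun q => (α (q.1 • c) q.2).1) z = (fundamentalField α c z).1 ∧
      familyDeriv (fun q => (α (q.1 • c) q.2).2) z = (fundamentalField α c z).2 :=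
  ⟨(hasDerivAt_action hα).fst_comp.deriv, (hasDerivAt_action hα).snd_comp.deriv⟩

/-- The generators of a group of symmetries are infinitesimal symmetries. -/
theorem isSymmetryField_fundamentalField {f : ℝ × ℝ × ℝ → ℝ} {U : Set (ℝ × ℝ)} {I : Set ℝ} {s₀ : ℝ}
    (hU : IsOpen U) (hs₀ : s₀ ∈ I) (hf : ∀ z ∈ U, ∀ s ∈ I, AnalyticAt ℝ f (z.1, z.2, s))
    (hα : ∀ z ∈ U, AnalyticAt ℝ (fun w : E × (ℝ × ℝ) => α w.1 w.2) (0, z))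
    (h0 : ∀ z ∈ U, α 0 z = z)
    (hS : ∀ z ∈ U, ∀ s ∈ I, ∀ᶠ g in 𝓝 (0 : E), CarriesAt (α g) f f (z.1, z.2, s)) (c : E) :
    IsSymmetryField f U I (fun w => (fundamentalField α c w).1)
      (fun w => (fundamentalField α c w).2) := by
  have hc : Tendsto (fun ε : ℝ => ε • c) (𝓝 0) (𝓝 0) := by
    have : Continuous fun ε : ℝ => ε • c := by fun_prop
    simpa using this.tendsto 0
  have hF : ∀ z ∈ U, AnalyticAt ℝ (fun q : ℝ × (ℝ × ℝ) => (α (q.1 • c) q.2).1) (0, z) :=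
    fun z hz => (analyticAt_oneParameter (hα z hz)).fst_comp
  have hG : ∀ z ∈ U, AnalyticAt ℝ (fun q : ℝ × (ℝ × ℝ) => (α (q.1 • c) q.2).2) (0, z) :=
    fun z hz => (analyticAt_oneParameter (hα z hz)).snd_comp
  have eF : ∀ z ∈ U, familyDeriv (fun q => (α (q.1 • c) q.2).1) =ᶠ[𝓝 z]
      fun w => (fundamentalField α c w).1 := fun z hz =>
    (hU.eventually_mem hz).mono fun w hw => (familyDeriv_action (hα w hw)).1
  have eG : ∀ z ∈ U, familyDeriv (fun q => (α (q.1 • c) q.2).2) =ᶠ[𝓝 z]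
      fun w => (fundamentalField α c w).2 := fun z hz =>
    (hU.eventually_mem hz).mono fun w hw => (familyDeriv_action (hα w hw)).2
  have F0 : ∀ z ∈ U, ∀ᶠ w in 𝓝 z, (α ((0 : ℝ) • c) w).1 = w.1 := fun z hz =>
    (hU.eventually_mem hz).mono fun w hw => by rw [zero_smul, h0 w hw]
  have G0 : ∀ z ∈ U, ∀ᶠ w in 𝓝 z, (α ((0 : ℝ) • c) w).2 = w.2 := fun z hz =>
    (hU.eventually_mem hz).mono fun w hw => by rw [zero_smul, h0 w hw]
  refine ⟨fun z hz => (hF z hz).familyDeriv.congr (eF z hz),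
    fun z hz => (hG z hz).familyDeriv.congr (eG z hz), fun z hz => ?_, fun z hz s hs => ?_⟩
  · have := divergence_eq_zero (hF z hz) (hG z hz) (F0 z hz) (G0 z hz)
      ((hc.eventually (hS z hz s₀ hs₀)).mono fun ε hε => hε.areaPreserving)
    rwa [(eF z hz).partialX_eq, (eG z hz).partialY_eq] at this
  · have := infinitesimal_symmetry (p := (z.1, z.2, s)) (hf z hz s hs) (hF z hz) (hG z hz)
      (F0 z hz) (G0 z hz) (hc.eventually (hS z hz s hs))
    have e1 : familyDeriv (fun q => (α (q.1 • c) q.2).1) =ᶠ[𝓝 (jetBase (z.1, z.2, s))]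
      fun w => (fundamentalField α c w).1 := eF z hz
    have e2 : familyDeriv (fun q => (α (q.1 • c) q.2).2) =ᶠ[𝓝 (jetBase (z.1, z.2, s))]
      fun w => (fundamentalField α c w).2 := eG z hz
    rw [e1.quadJet_eq, e1.alongJet_eq, e2.quadJet_eq, e2.alongJet_eq, e1.self_of_nhds,
      e2.self_of_nhds] at this
    exact this

/-- For an effective action, a generator which vanishes near the base point is trivial. -/
theorem eq_zero_of_fundamentalField_eq_zero [CompleteSpace E] {m : E → E → E}
    (hm : AnalyticAt ℝ (fun w : E × E => m w.1 w.2) (0, 0))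
    (hl : ∀ᶠ g in 𝓝 (0 : E), m 0 g = g) (hr : ∀ᶠ g in 𝓝 (0 : E), m g 0 = g)
    (hα : AnalyticAt ℝ (fun w : E × (ℝ × ℝ) => α w.1 w.2) (0, z₀))
    (h0 : ∀ᶠ z in 𝓝 z₀, α 0 z = z)
    (hact : ∀ᶠ w in 𝓝 ((0, 0, z₀) : E × E × (ℝ × ℝ)), α w.1 (α w.2.1 w.2.2) = α (m w.1 w.2.1) w.2.2)
    (heff : ∀ᶠ g in 𝓝 (0 : E), (∀ᶠ z in 𝓝 z₀, α g z = z) → g = 0)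
    (hV : ∀ᶠ z in 𝓝 z₀, fundamentalField α c z = 0) : c = 0 := by
  let M : E × E → E := fun w => m w.1 w.2
  -- The derivative of `ε ↦ m (ε c) g` at zero: the right-invariant field with value `c` at the
  -- identity. Its integral curve `γ` from `0` plays the role of the one-parameter subgroup of `c`.
  let X : E → E := fun g => fderiv ℝ M (0, g) (c, 0)
  have hX : AnalyticAt ℝ X 0 := by
    have h1 : AnalyticAt ℝ (fun q => fderiv ℝ M q (c, 0)) (0, 0) :=
      ((ContinuousLinearMap.apply ℝ E ((c, 0) : E × E)).analyticAt _).comp hm.fderiv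
    exact AnalyticAt.comp (g := fun q => fderiv ℝ M q (c, 0)) (f := fun g : E => ((0 : E), g)) h1
      (analyticAt_const.prod analyticAt_id)
  have hX0 : X 0 = c := by
    have h1 : HasFDerivAt (fun g : E => M (g, 0)) (fderiv ℝ M (0, 0) ∘L
        (ContinuousLinearMap.id ℝ E).prod 0) 0 :=
      HasFDerivAt.comp (g := M) (f := fun g : E => (g, (0 : E))) 0
        hm.differentiableAt.hasFDerivAt ((hasFDerivAt_id 0).prodMk (hasFDerivAt_const 0 0))
    have h2 := h1.unique ((hasFDerivAt_id (0 : E)).congr_of_eventuallyEq hr)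
    exact DFunLike.congr_fun h2 c
  obtain ⟨γ, hγ0, ε, hε, hγ⟩ :=
    ContDiffAt.exists_forall_mem_closedBall_exists_eq_forall_mem_Ioo_hasDerivAt₀
      (hX.contDiffAt (n := 1)) 0
  have hγ' : ∀ᶠ t in 𝓝 (0 : ℝ), HasDerivAt γ (X (γ t)) t := by
    filter_upwards [Ioo_mem_nhds (show 0 - ε < 0 by linarith) (show 0 < 0 + ε by linarith)] with t ht
    exact hγ t ht
  have hγc : Tendsto γ (𝓝 0) (𝓝 0) := by
    have := hγ'.self_of_nhds.continuousAt.tendsto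
    rwa [hγ0] at this
  have hγz : Tendsto (fun q : ℝ × (ℝ × ℝ) => (γ q.1, q.2)) (𝓝 (0, z₀)) (𝓝 (0, z₀)) := by
    exact (hγc.comp (continuous_fst.tendsto _)).prodMk_nhds (continuous_snd.tendsto _)
  have hfst : Tendsto (fun q : ℝ × (ℝ × ℝ) => q.1) (𝓝 (0, z₀)) (𝓝 0) := continuous_fst.tendsto _
  have hsnd : Tendsto (fun q : ℝ × (ℝ × ℝ) => q.2) (𝓝 (0, z₀)) (𝓝 z₀) := continuous_snd.tendsto _
  have h0γ : Tendsto (fun q : ℝ × (ℝ × ℝ) => ((0 : E), γ q.1, q.2)) (𝓝 (0, z₀))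
      (𝓝 ((0, 0, z₀) : E × E × (ℝ × ℝ))) := tendsto_const_nhds.prodMk_nhds hγz
  have hαz : Tendsto (fun q : ℝ × (ℝ × ℝ) => α (γ q.1) q.2) (𝓝 (0, z₀)) (𝓝 z₀) := by
    have := hα.continuousAt.tendsto.comp hγz
    simp only [h0.self_of_nhds] at this
    exact this
  -- By the action law the velocity of `t ↦ α (γ t) z` is the generated field at `α (γ t) z`, which
  -- vanishes. Hence `γ t` acts trivially near `z₀`, effectiveness gives `γ = 0` near `0`, and so `c
  -- = γ' 0 = 0`.
  have key : ∀ᶠ q in 𝓝 ((0 : ℝ), z₀), HasDerivAt (fun t => α (γ t) q.2) 0 q.1 := by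
    have h0' : Tendsto (fun w : ℝ × ℝ => ((0 : E), w)) (𝓝 z₀) (𝓝 (0, z₀)) := tendsto_const_nhds.prodMk_nhds tendsto_id
    have h0m : Tendsto (fun g : E => ((0 : E), g)) (𝓝 0) (𝓝 (0, 0)) := tendsto_const_nhds.prodMk_nhds tendsto_id
    filter_upwards [hγz.eventually hα.eventually_analyticAt,
      h0γ.eventually hact.eventually_nhds, hαz.eventually hV,
      hαz.eventually (h0'.eventually hα.eventually_analyticAt),
      hfst.eventually (hγc.eventually (h0m.eventually hm.eventually_analyticAt)),
      hfst.eventually (hγc.eventually hl), hfst.eventually hγ'] with q k1 k2 k3 k4 k5 k6 k7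
    obtain ⟨t, z⟩ := q
    have d1 : HasDerivAt (fun t => α (γ t) z) (fderiv ℝ (fun g => α g z) (γ t) (X (γ t))) t :=
      HasFDerivAt.comp_hasDerivAt (f := γ) t (hasFDerivAt_action k1) k7
    have hs : HasDerivAt (fun ε : ℝ => ε • c) c 0 := by
      simpa using (hasDerivAt_id (0 : ℝ)).smul_const c
    have hs0 : Tendsto (fun ε : ℝ => (ε • c, γ t, z)) (𝓝 0) (𝓝 ((0 : E), γ t, z)) := by
      have : Continuous fun ε : ℝ => (ε • c, γ t, z) := by fun_prop
      simpa using this.tendsto 0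
    have d2 : HasDerivAt (fun ε : ℝ => M (ε • c, γ t)) (X (γ t)) 0 :=
      HasFDerivAt.comp_hasDerivAt (l := M) (f := fun ε : ℝ => (ε • c, γ t)) 0
        (by rw [zero_smul]; exact k5.differentiableAt.hasFDerivAt)
        (hs.prodMk (hasDerivAt_const 0 (γ t)))
    have d3 : HasDerivAt (fun ε : ℝ => α (M (ε • c, γ t)) z)
        (fderiv ℝ (fun g => α g z) (γ t) (X (γ t))) 0 :=
      HasFDerivAt.comp_hasDerivAt (l := fun g => α g z) (f := fun ε : ℝ => M (ε • c, γ t)) 0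
        (by simp only [M, zero_smul]; rw [k6]; exact hasFDerivAt_action k1) d2
    have d4 := (hasDerivAt_action (c := c) k4).congr_of_eventuallyEq
      ((hs0.eventually k2).mono fun ε hε => hε.symm)
    rw [d3.unique d4, k3] at d1
    exact d1
  obtain ⟨δ, hδ, hball⟩ := Metric.eventually_nhds_iff_ball.1 key
  have hfix : ∀ᶠ t in 𝓝 (0 : ℝ), ∀ᶠ z in 𝓝 z₀, α (γ t) z = z := by
    filter_upwards [Metric.ball_mem_nhds (0 : ℝ) hδ] with t ht
    filter_upwards [Metric.ball_mem_nhds z₀ hδ, h0] with z hz hz0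
    have hd : ∀ r ∈ Metric.ball (0 : ℝ) δ, HasDerivAt (fun t => α (γ t) z) 0 r := fun r hr =>
      hball (r, z) (by rw [← ball_prod_same]; exact ⟨hr, hz⟩)
    have := Metric.isOpen_ball.is_const_of_deriv_eq_zero (convex_ball (0 : ℝ) δ).isPreconnected
      (fun r hr => (hd r hr).differentiableAt.differentiableWithinAt)
      (fun r hr => (hd r hr).deriv) ht (Metric.mem_ball_self hδ)
    simp only [hγ0] at this
    rw [this, hz0]
  have hγ00 : γ =ᶠ[𝓝 0] fun _ => 0 := by
    filter_upwards [hfix, hγc.eventually heff] with t h1 h2 using h2 h1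
  have := hγ'.self_of_nhds.unique ((hasDerivAt_const (0 : ℝ) (0 : E)).congr_of_eventuallyEq hγ00)
  rwa [hγ0, hX0] at this

end GroupAction

/-! ### The maximal dimension of a group of symmetries -/

section Dimension

variable {f : ℝ × ℝ × ℝ → ℝ} {p : ℝ × ℝ × ℝ} {r : ℕ}
  {m : (Fin r → ℝ) → (Fin r → ℝ) → (Fin r → ℝ)} {α : (Fin r → ℝ) → ℝ × ℝ → ℝ × ℝ}

theorem IsSymmetryField.mono {U V : Set (ℝ × ℝ)} {I : Set ℝ} {ξ η : ℝ × ℝ → ℝ}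
    (h : IsSymmetryField f U I ξ η) (hV : V ⊆ U) : IsSymmetryField f V I ξ η :=
  ⟨fun z hz => h.1 z (hV hz), fun z hz => h.2 z (hV hz), fun z hz => h.3 z (hV hz),
    fun z hz => h.4 z (hV hz)⟩

theorem fieldJet_add {ξ η ξ' η' : ℝ × ℝ → ℝ} {z : ℝ × ℝ} (hξ : AnalyticAt ℝ ξ z)
    (hη : AnalyticAt ℝ η z) (hξ' : AnalyticAt ℝ ξ' z) (hη' : AnalyticAt ℝ η' z) :
    fieldJet (fun w => ξ w + ξ' w) (fun w => η w + η' w) z = fieldJet ξ η z + fieldJet ξ' η' z := by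
  unfold fieldJet
  rw [partialX_add hξ hξ', partialY_add hξ hξ', partialX_add hη hη']
  simp

theorem fieldJet_const_mul {ξ η : ℝ × ℝ → ℝ} {z : ℝ × ℝ} (a : ℝ) (hξ : AnalyticAt ℝ ξ z)
    (hη : AnalyticAt ℝ η z) :
    fieldJet (fun w => a * ξ w) (fun w => a * η w) z = a • fieldJet ξ η z := by
  unfold fieldJet
  rw [partialX_mul analyticAt_const hξ, partialY_mul analyticAt_const hξ,
    partialX_mul analyticAt_const hη, partialX_const, partialY_const]
  simp

/-- At each point, the first jets of the generators of a group of symmetries form a space of the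
dimension of the group. -/
theorem IsLocalSymmetryGroup.exists_injective_jets (hf : AnalyticAt ℝ f p)
    (h : IsLocalSymmetryGroup f p m α) :
    ∃ (U : Set (ℝ × ℝ)) (I : Set ℝ), IsOpen U ∧ IsOpen I ∧ jetBase p ∈ U ∧ p.2.2 ∈ I ∧
      (∀ z ∈ U, ∀ s ∈ I, AnalyticAt ℝ f (z.1, z.2, s)) ∧
      ∀ z ∈ U, ∃ T : (Fin r → ℝ) →ₗ[ℝ] (Fin 5 → ℝ), Function.Injective T ∧
        ∀ c, ∃ ξ η, IsSymmetryField f U I ξ η ∧ fieldJet ξ η z = T c := by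
  obtain ⟨W, hW, hS⟩ := h.symmetry
  have e1 : ∀ᶠ q in 𝓝 p, AnalyticAt ℝ (fun w : (Fin r → ℝ) × (ℝ × ℝ) => α w.1 w.2)
      (0, jetBase q) := by
    refine eventually_jetBase (P := fun z => AnalyticAt ℝ
      (fun w : (Fin r → ℝ) × (ℝ × ℝ) => α w.1 w.2) (0, z)) ?_
    have h0' : Tendsto (fun w : ℝ × ℝ => ((0 : Fin r → ℝ), w)) (𝓝 (jetBase p)) (𝓝 (0, jetBase p)) :=
      tendsto_const_nhds.prodMk_nhds tendsto_id
    exact h0'.eventually h.analytic.eventually_analyticAt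
  obtain ⟨ε, hε, hball⟩ := Metric.eventually_nhds_iff_ball.1
    ((hf.eventually_analyticAt.and (eventually_mem_nhds_iff.2 hW)).and
      (e1.and (eventually_jetBase h.zero_act)))
  set U := Metric.ball (jetBase p) ε
  set I := Metric.ball p.2.2 ε
  have hbox : ∀ z ∈ U, ∀ s ∈ I, ((z.1, z.2, s) : ℝ × ℝ × ℝ) ∈ Metric.ball p ε := by
    intro z hz s hs
    simp only [U, I, Metric.mem_ball, Prod.dist_eq, jetBase, max_lt_iff] at hz hs ⊢
    exact ⟨hz.1, hz.2, hs⟩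
  have hs₀ : p.2.2 ∈ I := Metric.mem_ball_self hε
  have hfU : ∀ z ∈ U, ∀ s ∈ I, AnalyticAt ℝ f (z.1, z.2, s) := fun z hz s hs =>
    (hball _ (hbox z hz s hs)).1.1
  have hαU : ∀ z ∈ U, AnalyticAt ℝ (fun w : (Fin r → ℝ) × (ℝ × ℝ) => α w.1 w.2) (0, z) :=
    fun z hz => (hball _ (hbox z hz _ hs₀)).2.1
  have hsym := isSymmetryField_fundamentalField (α := α) Metric.isOpen_ball hs₀ hfU hαU
    (fun z hz => (hball _ (hbox z hz _ hs₀)).2.2)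
    (fun z hz s hs => hS.mono fun g hg =>
      hg.carriesAt (hball _ (hbox z hz s hs)).1.2 (hfU z hz s hs))
  obtain ⟨K, ρ, hρ, hρU, hK⟩ := exists_second_bound (z₀ := jetBase p) Metric.isOpen_ball
    (Metric.mem_ball_self hε) (Metric.isOpen_ball.mem_nhds hs₀) (fun s hs =>
      hfU _ (Metric.mem_ball_self hε) s hs)
  refine ⟨Metric.ball (jetBase p) ρ, I, Metric.isOpen_ball, Metric.isOpen_ball,
    Metric.mem_ball_self hρ, hs₀, fun z hz => hfU z (hρU hz), fun z hz => ?_⟩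
  let T : (Fin r → ℝ) →ₗ[ℝ] (Fin 5 → ℝ) :=
    { toFun := fun c => fieldJet (fun w => (fundamentalField α c w).1)
        (fun w => (fundamentalField α c w).2) z
      map_add' := fun c d => by
        rw [← fieldJet_add ((hsym c).1 z (hρU hz)) ((hsym c).2 z (hρU hz))
          ((hsym d).1 z (hρU hz)) ((hsym d).2 z (hρU hz))]
        simp [fundamentalField]
      map_smul' := fun a c => by
        rw [RingHom.id_apply, ← fieldJet_const_mul a ((hsym c).1 z (hρU hz))
          ((hsym c).2 z (hρU hz))]
        simp [fundamentalField] }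
  refine ⟨T, ?_, fun c => ⟨_, _, (hsym c).mono hρU, rfl⟩⟩
  -- A zero jet at the single point `z` forces the field to vanish on the whole ball, in particular
  -- near the base point, where effectiveness applies. This works at every `z` of the ball, which
  -- the case of dimension five needs.
  rw [injective_iff_map_eq_zero]
  intro c hc
  have hl := h.isLocalLieGroup
  refine eq_zero_of_fundamentalField_eq_zero hl.analytic hl.zero_left hl.zero_right h.analytic
    h.zero_act h.act_act h.effective ?_
  filter_upwards [Metric.ball_mem_nhds (jetBase p) hρ] with w hw
  have := (hsym c).fieldJet_eq_zero Metric.isOpen_ball hρU (hK _ _ (hsym c)) hz hw hc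
  exact Prod.ext (congrFun this 0) (congrFun this 1)

theorem IsLocalSymmetryGroup.dim_le_five (hf : AnalyticAt ℝ f p)
    (h : IsLocalSymmetryGroup f p m α) : r ≤ 5 := by
  obtain ⟨U, I, -, -, hp, -, -, hT⟩ := h.exists_injective_jets hf
  obtain ⟨T, hT, -⟩ := hT _ hp
  simpa using LinearMap.finrank_le_finrank_of_injective hT

/-- An injective endomorphism of a five-dimensional space is onto, so all first jets occur at all
nearby points. Only the dimension of the group enters, not its isomorphism type. -/
theorem equivalentToFreeAt_of_symmetryGroup {m : (Fin 5 → ℝ) → (Fin 5 → ℝ) → (Fin 5 → ℝ)}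
    {α : (Fin 5 → ℝ) → ℝ × ℝ → ℝ × ℝ} (hf : AnalyticAt ℝ f p)
    (h : IsLocalSymmetryGroup f p m α) : EquivalentToFreeAt f p := by
  obtain ⟨U, I, hU, hI, hp, hs₀, hfU, hT⟩ := h.exists_injective_jets hf
  have H : ∀ z ∈ U, ∀ y : Fin 5 → ℝ, ∃ ξ η, IsSymmetryField f U I ξ η ∧ fieldJet ξ η z = y := by
    intro z hz y
    obtain ⟨T, hTi, hTs⟩ := hT z hz
    obtain ⟨c, rfl⟩ := (LinearMap.injective_iff_surjective.1 hTi) y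
    exact hTs c
  obtain ⟨A, B, C, D, han, hcub⟩ := exists_analytic_coefficients (hI.mem_nhds hs₀) hfU
    fun z hz => exists_cubic_of_isotropy hU hI hs₀ hfU hz (H z hz)
  obtain ⟨kA, kB, kC, kD⟩ := han _ hp
  refine equivalentToFreeAt_of_coefficients hf kA kB kC kD ?_ ?_
  · have hc : Continuous fun q : ℝ × ℝ × ℝ => q.2.2 := by fun_prop
    filter_upwards [eventually_jetBase (p := p) (hU.eventually_mem hp),
      hc.continuousAt.eventually (hI.eventually_mem hs₀)] with q k1 k2
    exact hcub _ k1 _ k2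
  · filter_upwards [hU.mem_nhds hp] with z hz
    exact coefficientRelationsAt_of_transitive hU hI hs₀ hfU han hcub hz (H z hz)

end Dimension

/-! ### The group `ASL(2, ℝ)` in local coordinates -/

section ASL2Coordinates

/-- Local coordinates of `ASL2` around the identity matrix. -/
def asl2Coords (N : Matrix (Fin 3) (Fin 3) ℝ) : Fin 5 → ℝ :=
  ![N 1 0, N 2 0, N 1 1 - 1, N 1 2, N 2 1]

/-- The matrix in `ASL2` with the given coordinates. -/
noncomputable def asl2Matrix (g : Fin 5 → ℝ) : Matrix (Fin 3) (Fin 3) ℝ :=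
  !![1, 0, 0; g 0, 1 + g 2, g 3; g 1, g 4, (1 + g 3 * g 4) / (1 + g 2)]

/-- The multiplication of `ASL2` in local coordinates. -/
noncomputable def asl2Mul (g h : Fin 5 → ℝ) : Fin 5 → ℝ := asl2Coords (asl2Matrix g * asl2Matrix h)

/-- The action of `ASL2` on the plane in local coordinates. -/
noncomputable def asl2Act (g : Fin 5 → ℝ) (z : ℝ × ℝ) : ℝ × ℝ :=
  affineMap (g 0) (g 1) (1 + g 2) (g 3) (g 4) ((1 + g 3 * g 4) / (1 + g 2)) z

variable {g h k : Fin 5 → ℝ} {N : Matrix (Fin 3) (Fin 3) ℝ}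

theorem asl2Coords_asl2Matrix : asl2Coords (asl2Matrix g) = g := by
  funext i
  fin_cases i <;> simp [asl2Coords, asl2Matrix]

theorem asl2Matrix_mem (hg : 1 + g 2 ≠ 0) : asl2Matrix g ∈ ASL2 :=
  mem_ASL2_iff.2 ⟨_, _, _, _, _, _, by field_simp; ring, rfl⟩

theorem asl2Matrix_asl2Coords (hN : N ∈ ASL2) (h1 : N 1 1 ≠ 0) : asl2Matrix (asl2Coords N) = N := by
  obtain ⟨v, w, a, b, c, d, hdet, rfl⟩ := mem_ASL2_iff.1 hN
  have ha : a ≠ 0 := h1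
  have hd : (1 + b * c) / a = d := by
    rw [div_eq_iff ha]; linear_combination -hdet
  ext i j
  fin_cases i <;> fin_cases j <;> simp [asl2Matrix, asl2Coords, hd]

theorem mul_mem_ASL2 {M N : Matrix (Fin 3) (Fin 3) ℝ} (hM : M ∈ ASL2) (hN : N ∈ ASL2) :
    M * N ∈ ASL2 := by
  obtain ⟨v, w, a, b, c, d, hdet, rfl⟩ := mem_ASL2_iff.1 hM
  obtain ⟨v', w', a', b', c', d', hdet', rfl⟩ := mem_ASL2_iff.1 hN
  refine mem_ASL2_iff.2 ⟨v + a * v' + b * w', w + c * v' + d * w', a * a' + b * c',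
    a * b' + b * d', c * a' + d * c', c * b' + d * d', ?_, ?_⟩
  · linear_combination (a' * d' - b' * c') * hdet + hdet'
  · ext i j
    fin_cases i <;> fin_cases j <;> simp [Matrix.mul_apply, Fin.sum_univ_three]

theorem asl2Matrix_zero : asl2Matrix 0 = 1 := by
  ext i j
  fin_cases i <;> fin_cases j <;> simp [asl2Matrix]

theorem asl2Matrix_asl2Mul (hg : 1 + g 2 ≠ 0) (hh : 1 + h 2 ≠ 0)
    (hgh : 1 + asl2Mul g h 2 ≠ 0) : asl2Matrix (asl2Mul g h) = asl2Matrix g * asl2Matrix h := by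
  refine asl2Matrix_asl2Coords (mul_mem_ASL2 (asl2Matrix_mem hg) (asl2Matrix_mem hh)) ?_
  simpa [asl2Mul, asl2Coords] using hgh

theorem asl2Act_eq : asl2Act g = affineAction (asl2Matrix g) := (affineAction_eq _ _ _ _ _ _).symm

theorem affineAction_mul {M N : Matrix (Fin 3) (Fin 3) ℝ} (hM : M ∈ ASL2) (hN : N ∈ ASL2)
    (z : ℝ × ℝ) : affineAction (M * N) z = affineAction M (affineAction N z) := by
  obtain ⟨v, w, a, b, c, d, -, rfl⟩ := mem_ASL2_iff.1 hM
  obtain ⟨v', w', a', b', c', d', -, rfl⟩ := mem_ASL2_iff.1 hN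
  ext <;> simp [affineAction, Matrix.mulVec, dotProduct, Fin.sum_univ_three, Matrix.mul_apply] <;>
    ring

theorem asl2Act_asl2Mul (hg : 1 + g 2 ≠ 0) (hh : 1 + h 2 ≠ 0) (hgh : 1 + asl2Mul g h 2 ≠ 0)
    (z : ℝ × ℝ) : asl2Act (asl2Mul g h) z = asl2Act g (asl2Act h z) := by
  rw [asl2Act_eq, asl2Act_eq, asl2Act_eq, asl2Matrix_asl2Mul hg hh hgh,
    affineAction_mul (asl2Matrix_mem hg) (asl2Matrix_mem hh)]

theorem asl2Act_zero (z : ℝ × ℝ) : asl2Act 0 z = z := by simp [asl2Act, affineMap]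

theorem asl2Mul_zero_left : asl2Mul 0 g = g := by
  rw [asl2Mul, asl2Matrix_zero, one_mul, asl2Coords_asl2Matrix]

theorem asl2Mul_zero_right : asl2Mul g 0 = g := by
  rw [asl2Mul, asl2Matrix_zero, mul_one, asl2Coords_asl2Matrix]

theorem analyticAt_asl2Mul :
    AnalyticAt ℝ (fun w : (Fin 5 → ℝ) × (Fin 5 → ℝ) => asl2Mul w.1 w.2) (0, 0) := by
  have h1 : ∀ i, AnalyticAt ℝ (fun w : (Fin 5 → ℝ) × (Fin 5 → ℝ) => w.1 i) (0, 0) := fun i =>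
    ((ContinuousLinearMap.proj (R := ℝ) (φ := fun _ : Fin 5 => ℝ) i).comp
      (ContinuousLinearMap.fst ℝ (Fin 5 → ℝ) (Fin 5 → ℝ))).analyticAt _
  have h2 : ∀ i, AnalyticAt ℝ (fun w : (Fin 5 → ℝ) × (Fin 5 → ℝ) => w.2 i) (0, 0) := fun i =>
    ((ContinuousLinearMap.proj (R := ℝ) (φ := fun _ : Fin 5 => ℝ) i).comp
      (ContinuousLinearMap.snd ℝ (Fin 5 → ℝ) (Fin 5 → ℝ))).analyticAt _
  have hd1 : AnalyticAt ℝ (fun w : (Fin 5 → ℝ) × (Fin 5 → ℝ) =>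
      (1 + w.1 3 * w.1 4) / (1 + w.1 2)) (0, 0) :=
    (analyticAt_const.add ((h1 3).mul (h1 4))).div (analyticAt_const.add (h1 2)) (by simp)
  have hd2 : AnalyticAt ℝ (fun w : (Fin 5 → ℝ) × (Fin 5 → ℝ) =>
      (1 + w.2 3 * w.2 4) / (1 + w.2 2)) (0, 0) :=
    (analyticAt_const.add ((h2 3).mul (h2 4))).div (analyticAt_const.add (h2 2)) (by simp)
  rw [analyticAt_pi_iff]
  intro i
  fin_cases i <;> simp [asl2Mul, asl2Coords, asl2Matrix, Matrix.mul_apply, Fin.sum_univ_three] <;>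
    fun_prop

theorem eventually_one_add_ne_zero :
    ∀ᶠ g in 𝓝 (0 : Fin 5 → ℝ), 1 + g 2 ≠ 0 := by
  have : Continuous fun g : Fin 5 → ℝ => 1 + g 2 := by fun_prop
  exact this.continuousAt.eventually_ne (by simp)

theorem tendsto_asl2Mul :
    Tendsto (fun w : (Fin 5 → ℝ) × (Fin 5 → ℝ) => asl2Mul w.1 w.2) (𝓝 (0, 0)) (𝓝 0) := by
  have := analyticAt_asl2Mul.continuousAt.tendsto
  rwa [asl2Mul_zero_left] at this

/-- Eventually the coordinate multiplication corresponds to the multiplication of matrices. -/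
theorem eventually_asl2Matrix_mul :
    ∀ᶠ w in 𝓝 ((0, 0) : (Fin 5 → ℝ) × (Fin 5 → ℝ)), 1 + w.1 2 ≠ 0 ∧ 1 + w.2 2 ≠ 0 ∧
      1 + asl2Mul w.1 w.2 2 ≠ 0 :=
  ((continuous_fst.tendsto ((0, 0) : (Fin 5 → ℝ) × (Fin 5 → ℝ))).eventually
    eventually_one_add_ne_zero).and
  (((continuous_snd.tendsto ((0, 0) : (Fin 5 → ℝ) × (Fin 5 → ℝ))).eventually
    eventually_one_add_ne_zero).and (tendsto_asl2Mul.eventually eventually_one_add_ne_zero))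

/-- Associativity is that of matrices, but only near the identity: the chart recovers the last entry
from the determinant by dividing by the upper left entry of the linear part. -/
theorem isLocalLieGroup_asl2Mul : IsLocalLieGroup asl2Mul := by
  refine ⟨analyticAt_asl2Mul, .of_forall fun g => asl2Mul_zero_left,
    .of_forall fun g => asl2Mul_zero_right, ?_⟩
  have hc1 : Continuous fun w : (Fin 5 → ℝ) × (Fin 5 → ℝ) × (Fin 5 → ℝ) => (w.1, w.2.1) := by fun_prop
  have hc2 : Continuous fun w : (Fin 5 → ℝ) × (Fin 5 → ℝ) × (Fin 5 → ℝ) => (w.2.1, w.2.2) := by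
    fun_prop
  filter_upwards [(hc1.tendsto (0, 0, 0)).eventually eventually_asl2Matrix_mul,
    (hc2.tendsto (0, 0, 0)).eventually eventually_asl2Matrix_mul] with w h1 h2
  conv_lhs => rw [asl2Mul, asl2Matrix_asl2Mul h1.1 h1.2.1 h1.2.2]
  conv_rhs => rw [asl2Mul, asl2Matrix_asl2Mul h2.1 h2.2.1 h2.2.2]
  rw [Matrix.mul_assoc]

theorem isLocallyASL2_asl2Mul : IsLocallyASL2 asl2Mul := by
  refine ⟨asl2Matrix, fun i j => ?_, asl2Matrix_zero,
    eventually_one_add_ne_zero.mono fun g => asl2Matrix_mem,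
    eventually_asl2Matrix_mul.mono fun w hw => asl2Matrix_asl2Mul hw.1 hw.2.1 hw.2.2,
    ⟨univ, univ_mem, fun g _ h _ e => ?_⟩, fun V hV => ?_⟩
  · have h1 : ∀ i, AnalyticAt ℝ (fun g : Fin 5 → ℝ => g i) 0 := fun i =>
      (ContinuousLinearMap.proj (R := ℝ) (φ := fun _ : Fin 5 => ℝ) i).analyticAt _
    have hd1 : AnalyticAt ℝ (fun g : Fin 5 → ℝ => (1 + g 3 * g 4) / (1 + g 2)) 0 :=
      (analyticAt_const.add ((h1 3).mul (h1 4))).div (analyticAt_const.add (h1 2)) (by simp)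
    fin_cases i <;> fin_cases j <;> simp [asl2Matrix] <;>
      first | fun_prop | exact h1 _ | exact analyticAt_const.add (h1 2)
  · rw [← asl2Coords_asl2Matrix (g := g), e, asl2Coords_asl2Matrix]
  · have he : ∀ i j, Continuous fun N : Matrix (Fin 3) (Fin 3) ℝ => N i j := fun i j =>
      continuous_apply_apply i j
    have hc : Continuous asl2Coords := by
      refine continuous_pi fun i => ?_
      fin_cases i
      · exact he 1 0
      · exact he 2 0
      · exact (he 1 1).sub continuous_const
      · exact he 1 2
      · exact he 2 1
    have h10 : asl2Coords 1 = 0 := by rw [← asl2Matrix_zero, asl2Coords_asl2Matrix]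
    -- The coordinate map is a continuous inverse of `asl2Matrix` on `ASL2` near the identity, so
    -- matrices close to `1` come from `V`.
    have hN : ∀ᶠ N in 𝓝 (1 : Matrix (Fin 3) (Fin 3) ℝ), asl2Coords N ∈ V :=
      (hc.tendsto 1).eventually (by rw [h10]; exact hV)
    have h11 : ∀ᶠ N in 𝓝 (1 : Matrix (Fin 3) (Fin 3) ℝ), N 1 1 ≠ 0 :=
      (he 1 1).continuousAt.eventually_ne (by simp)
    filter_upwards [nhdsWithin_le_nhds hN, nhdsWithin_le_nhds h11, self_mem_nhdsWithin]
      with N k1 k2 k3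
    exact ⟨_, k1, asl2Matrix_asl2Coords k3 k2⟩

theorem analyticAt_asl2Act (z : ℝ × ℝ) :
    AnalyticAt ℝ (fun w : (Fin 5 → ℝ) × (ℝ × ℝ) => asl2Act w.1 w.2) (0, z) := by
  have h1 : ∀ i, AnalyticAt ℝ (fun w : (Fin 5 → ℝ) × (ℝ × ℝ) => w.1 i) (0, z) := fun i =>
    ((ContinuousLinearMap.proj (R := ℝ) (φ := fun _ : Fin 5 => ℝ) i).comp
      (ContinuousLinearMap.fst ℝ (Fin 5 → ℝ) (ℝ × ℝ))).analyticAt _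
  have hd1 : AnalyticAt ℝ (fun w : (Fin 5 → ℝ) × (ℝ × ℝ) =>
      (1 + w.1 3 * w.1 4) / (1 + w.1 2)) (0, z) :=
    (analyticAt_const.add ((h1 3).mul (h1 4))).div (analyticAt_const.add (h1 2)) (by simp)
  have hx : AnalyticAt ℝ (fun w : (Fin 5 → ℝ) × (ℝ × ℝ) => w.2.1) (0, z) := by fun_prop
  have hy : AnalyticAt ℝ (fun w : (Fin 5 → ℝ) × (ℝ × ℝ) => w.2.2) (0, z) := by fun_prop
  unfold asl2Act affineMap
  exact (((h1 0).add ((analyticAt_const.add (h1 2)).mul hx)).add ((h1 3).mul hy)).prod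
    (((h1 1).add ((h1 4).mul hx)).add (hd1.mul hy))

theorem eq_zero_of_asl2Act_eq {z : ℝ × ℝ} (H : ∀ᶠ w in 𝓝 z, asl2Act g w = w) : g = 0 := by
  have e : asl2Act g =ᶠ[𝓝 z] fun w => w := H
  obtain ⟨e1, e2⟩ := e.fst_snd_comp
  have a1 := e1.partialX_eq
  have a2 := e1.partialY_eq
  have a3 := e2.partialX_eq
  have a4 := e2.partialY_eq
  simp only [asl2Act, affineMap, partialX_linear, partialY_linear, partialX_fst, partialY_fst,
    partialX_snd, partialY_snd] at a1 a2 a3 a4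
  have v1 := e1.self_of_nhds
  have v2 := e2.self_of_nhds
  simp only [asl2Act, affineMap] at v1 v2
  rw [a1, a2] at v1
  rw [a4, a3] at v2
  funext i
  fin_cases i <;> simp <;> linarith

end ASL2Coordinates

/-! ### The affine group transported along an equivalence with `y'' = 0` -/

section Admits

variable {f : ℝ × ℝ × ℝ → ℝ} {p : ℝ × ℝ × ℝ}

/-- An equation equivalent to `y'' = 0` admits the conjugate of the group of affine maps. -/
theorem EquivalentToFreeAt.admitsASL2At (hf : AnalyticAt ℝ f p) (h : EquivalentToFreeAt f p) :
    AdmitsASL2At f p := by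
  obtain ⟨q, h⟩ := h
  obtain ⟨Φ, HΦ, rfl⟩ := (areaEquivalentAt_iff hf).1 h
  obtain ⟨Ψ, hΨ, hl, hr, HΨ, -⟩ := CarriesAt.exists_inverse HΦ
  set z₀ := jetBase p with hz₀
  have hΦ : AnalyticAt ℝ Φ z₀ := HΦ.self_of_nhds.analytic
  have hΨ0 : Ψ (Φ z₀) = z₀ := hl.self_of_nhds
  have hinner : AnalyticAt ℝ (fun w : (Fin 5 → ℝ) × (ℝ × ℝ) => asl2Act w.1 (Φ w.2)) (0, z₀) :=
    AnalyticAt.comp (g := fun w : (Fin 5 → ℝ) × (ℝ × ℝ) => asl2Act w.1 w.2)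
      (f := fun w : (Fin 5 → ℝ) × (ℝ × ℝ) => (w.1, Φ w.2)) (analyticAt_asl2Act (Φ z₀))
      (analyticAt_fst.prod (AnalyticAt.comp (g := Φ) (f := fun w : (Fin 5 → ℝ) × (ℝ × ℝ) => w.2)
        hΦ analyticAt_snd))
  have hinner' : Tendsto (fun w : (Fin 5 → ℝ) × (ℝ × ℝ) => asl2Act w.1 (Φ w.2)) (𝓝 (0, z₀))
      (𝓝 (Φ z₀)) := by
    have := hinner.continuousAt.tendsto
    rwa [asl2Act_zero] at this
  -- The affine action conjugated by `Φ`; the action law holds because the inner `Φ ∘ Ψ` cancels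
  -- near `Φ z₀`.
  refine ⟨asl2Mul, fun g z => Ψ (asl2Act g (Φ z)),
    ⟨isLocalLieGroup_asl2Mul, ?_, ?_, ?_, ?_, ?_⟩, isLocallyASL2_asl2Mul⟩
  · exact AnalyticAt.comp (g := Ψ) (f := fun w : (Fin 5 → ℝ) × (ℝ × ℝ) => asl2Act w.1 (Φ w.2))
      (by rw [asl2Act_zero]; exact hΨ) hinner
  · filter_upwards [hl] with z hz
    rw [asl2Act_zero, hz]
  · have hc1 : Continuous fun w : (Fin 5 → ℝ) × (Fin 5 → ℝ) × (ℝ × ℝ) => (w.1, w.2.1) := by fun_prop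
    have hc2 : Continuous fun w : (Fin 5 → ℝ) × (Fin 5 → ℝ) × (ℝ × ℝ) => (w.2.1, w.2.2) := by
      fun_prop
    filter_upwards [(hc1.tendsto (0, 0, z₀)).eventually eventually_asl2Matrix_mul,
      (hc2.tendsto (0, 0, z₀)).eventually (hinner'.eventually hr)] with w h1 h2
    rw [h2, asl2Act_asl2Mul h1.1 h1.2.1 h1.2.2]
  · filter_upwards [(hinner'.eventually hr).curry_nhds] with g hg hfix
    refine eq_zero_of_asl2Act_eq (z := Φ z₀) ?_
    have hΨc : Tendsto Ψ (𝓝 (Φ z₀)) (𝓝 z₀) := by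
      have := hΨ.continuousAt.tendsto
      rwa [hΨ0] at this
    filter_upwards [hΨc.eventually hg, hΨc.eventually hfix, hr] with w k1 k2 k3
    rw [k2, k3] at k1
    exact k1.symm
  · have hΦp := continuousAt_prolongation HΦ.self_of_nhds.analytic HΦ.self_of_nhds.transversal
    have hA : ContinuousAt (fun w : (Fin 5 → ℝ) × (ℝ × ℝ × ℝ) => prolongation (asl2Act w.1) w.2)
        (0, prolongation Φ p) := by
      unfold asl2Act
      simp only [prolongation_affineMap]
      have hd : ContinuousAt (fun w : (Fin 5 → ℝ) × (ℝ × ℝ × ℝ) =>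
          (1 + w.1 3 * w.1 4) / (1 + w.1 2)) (0, prolongation Φ p) :=
        ContinuousAt.div (by fun_prop) (by fun_prop) (by simp)
      refine ContinuousAt.prodMk (by fun_prop) (ContinuousAt.prodMk (by fun_prop) ?_)
      exact ContinuousAt.div (by fun_prop) (by fun_prop) (by simp)
    have hpair : Tendsto (fun w : (Fin 5 → ℝ) × (ℝ × ℝ × ℝ) => (w.1, prolongation Φ w.2))
        (𝓝 (0, p)) (𝓝 (0, prolongation Φ p)) :=
      (continuous_fst.tendsto _).prodMk_nhds (hΦp.tendsto.comp (continuous_snd.tendsto _))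
    have hA' : Tendsto (fun w : (Fin 5 → ℝ) × (ℝ × ℝ × ℝ) => prolongation (asl2Act w.1) w.2)
        (𝓝 (0, prolongation Φ p)) (𝓝 (prolongation Φ p)) := by
      have h0 : prolongation (asl2Act 0) (prolongation Φ p) = prolongation Φ p := by
        rw [show asl2Act 0 = fun w => w from funext asl2Act_zero, prolongation_id]
      have := hA.tendsto
      rwa [h0] at this
    have hT : ∀ᶠ w in 𝓝 ((0, prolongation Φ p) : (Fin 5 → ℝ) × (ℝ × ℝ × ℝ)),
        1 + w.1 2 + w.2.2.2 * w.1 3 ≠ 0 := by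
      have hc : Continuous fun w : (Fin 5 → ℝ) × (ℝ × ℝ × ℝ) => 1 + w.1 2 + w.2.2.2 * w.1 3 := by
        fun_prop
      exact hc.continuousAt.eventually_ne (by simp)
    have hfst : Tendsto (fun w : (Fin 5 → ℝ) × (ℝ × ℝ × ℝ) => w.1) (𝓝 (0, p)) (𝓝 0) :=
      continuous_fst.tendsto _
    have hsnd : Tendsto (fun w : (Fin 5 → ℝ) × (ℝ × ℝ × ℝ) => w.2) (𝓝 (0, p)) (𝓝 p) :=
      continuous_snd.tendsto _
    have key : ∀ᶠ w in 𝓝 ((0, p) : (Fin 5 → ℝ) × (ℝ × ℝ × ℝ)),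
        CarriesAt (fun z => Ψ (asl2Act w.1 (Φ z))) f f w.2 := by
      filter_upwards [hsnd.eventually HΦ, hfst.eventually eventually_one_add_ne_zero,
        hpair.eventually hT, hpair.eventually (hA'.eventually HΨ)] with w k1 k2 k3 k4
      have hdet : (1 + w.1 2) * ((1 + w.1 3 * w.1 4) / (1 + w.1 2)) - w.1 3 * w.1 4 = 1 := by
        field_simp; ring
      have c1 : CarriesAt (fun z => Ψ (asl2Act w.1 z)) (fun _ => 0) f (prolongation Φ w.2) :=
        k4.comp (carriesAt_affineMap hdet k3)
      exact c1.comp k1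
    -- The statement holds near `(0, p)` jointly in group element and jet, so one neighbourhood of
    -- `p` serves all group elements near the identity.
    rw [nhds_prod_eq, eventually_prod_iff] at key
    obtain ⟨pa, ha, pb, hb, H⟩ := key
    exact ⟨{q | pb q}, hb, ha.mono fun g hg =>
      CarriesEquationOn.of_forall_carriesAt fun q hq => H hg hq⟩

theorem admitsASL2At_iff (hf : AnalyticAt ℝ f p) : AdmitsASL2At f p ↔ EquivalentToFreeAt f p :=
  ⟨fun ⟨_, _, h, _⟩ => equivalentToFreeAt_of_symmetryGroup hf h, fun h => h.admitsASL2At hf⟩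

end Admits

/-! ### Equations on domains of the jet space, and the equivalence class of `y'' = 0` -/

section Global

variable {f g h : ℝ × ℝ × ℝ → ℝ} {p q o : ℝ × ℝ × ℝ} {Ω : Set (ℝ × ℝ × ℝ)}

/-- The coefficients of a cubic equation are determined by the equation. -/
theorem coefficients_unique {A B C D A' B' C' D' : ℝ × ℝ → ℝ}
    (h : ∀ᶠ q in 𝓝 p, IsCubicAt A B C D f q) (h' : ∀ᶠ q in 𝓝 p, IsCubicAt A' B' C' D' f q) :
    A (jetBase p) = A' (jetBase p) ∧ B (jetBase p) = B' (jetBase p) ∧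
      C (jetBase p) = C' (jetBase p) ∧ D (jetBase p) = D' (jetBase p) := by
  have e : ∀ᶠ s in 𝓝 p.2.2, (D (jetBase p) - D' (jetBase p)) +
      3 * (C (jetBase p) - C' (jetBase p)) * s + 3 * (B (jetBase p) - B' (jetBase p)) * s ^ 2 +
      (A (jetBase p) - A' (jetBase p)) * s ^ 3 + 0 * s ^ 4 = 0 := by
    filter_upwards [(eventually_jet_of_base h).self_of_nhds,
      (eventually_jet_of_base h').self_of_nhds] with s h1 h2
    unfold IsCubicAt at h1 h2
    rw [h1] at h2
    simp only [jetBase] at h2 ⊢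
    linear_combination h2
  obtain ⟨e0, e1, e2, e3, -⟩ := quartic_coeff_eq_zero e
  exact ⟨by linarith, by linarith, by linarith, by linarith⟩

/-- Local coefficients glue to coefficients on a domain with connected vertical fibres. -/
theorem exists_global_coefficients (hΩ : IsOpen Ω)
    (hfib : ∀ x y : ℝ, IsPreconnected {y' : ℝ | (x, y, y') ∈ Ω})
    (H : ∀ p ∈ Ω, ∃ A B C D : ℝ × ℝ → ℝ,
      AnalyticAt ℝ A (jetBase p) ∧ AnalyticAt ℝ B (jetBase p) ∧
      AnalyticAt ℝ C (jetBase p) ∧ AnalyticAt ℝ D (jetBase p) ∧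
      (∀ᶠ p' in 𝓝 p, IsCubicAt A B C D f p') ∧
      (∀ᶠ z in 𝓝 (jetBase p), CoefficientRelationsAt A B C D z)) :
    ∃ A B C D : ℝ × ℝ → ℝ,
      AnalyticOnNhd ℝ A (jetBase '' Ω) ∧ AnalyticOnNhd ℝ B (jetBase '' Ω) ∧
      AnalyticOnNhd ℝ C (jetBase '' Ω) ∧ AnalyticOnNhd ℝ D (jetBase '' Ω) ∧
      (∀ p ∈ Ω, IsCubicAt A B C D f p) ∧
      (∀ z ∈ jetBase '' Ω, CoefficientRelationsAt A B C D z) := by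
  choose! A B C D hA hB hC hD hcub hrel using H
  let k : ℝ × ℝ × ℝ → ℝ × ℝ → ℝ × ℝ × ℝ × ℝ := fun p z => (A p z, B p z, C p z, D p z)
  have hk : ∀ p ∈ Ω, ∀ᶠ q in 𝓝 p, k q (jetBase q) = k p (jetBase q) := fun p hp => by
    filter_upwards [(hcub p hp).eventually_nhds, hΩ.mem_nhds hp] with q h1 h2
    obtain ⟨e1, e2, e3, e4⟩ := coefficients_unique (hcub q h2) h1
    simp only [k, e1, e2, e3, e4]
  -- The coefficient values over a fixed point are locally constant in the slope, by uniqueness, and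
  -- hence constant on the connected fibre.
  have hfibre : ∀ p ∈ Ω, ∀ q ∈ Ω, jetBase p = jetBase q → k p (jetBase p) = k q (jetBase q) := by
    rintro ⟨x, y, s⟩ hp ⟨x', y', t⟩ hq hpq
    obtain ⟨rfl, rfl⟩ : x = x' ∧ y = y' := Prod.mk.inj hpq
    refine (hfib x y).induction₂ (fun s t => k (x, y, s) (x, y) = k (x, y, t) (x, y))
      (fun s hs => ?_) (fun a b c _ _ _ h1 h2 => h1.trans h2) (fun a b _ _ h1 => h1.symm) hp hq
    have hc : Continuous fun t : ℝ => (x, y, t) := by fun_prop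
    filter_upwards [nhdsWithin_le_nhds ((hc.tendsto s).eventually (hk _ hs))] with t ht
    exact ht.symm
  -- An arbitrary section with no continuity; by `hfibre` the choice of jet over `z` does not affect
  -- the values.
  choose! σ hσ using fun (z : ℝ × ℝ) (hz : z ∈ jetBase '' Ω) => hz
  have key : ∀ p ∈ Ω, ∀ᶠ z in 𝓝 (jetBase p), k (σ z) z = k p z := fun p hp => by
    filter_upwards [eventually_jet_of_base (hk p hp), eventually_jet_of_base (hΩ.mem_nhds hp)]
      with z h1 h2
    have h2' : (z.1, z.2, p.2.2) ∈ Ω := h2.self_of_nhds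
    obtain ⟨m1, m2⟩ := hσ z ⟨_, h2', rfl⟩
    have h3 := hfibre _ m1 _ h2' m2
    rw [m2] at h3
    exact h3.trans h1.self_of_nhds
  have kA : ∀ p ∈ Ω, (fun z => A (σ z) z) =ᶠ[𝓝 (jetBase p)] A p := fun p hp =>
    (key p hp).mono fun z hz => congrArg (fun v => v.1) hz
  have kB : ∀ p ∈ Ω, (fun z => B (σ z) z) =ᶠ[𝓝 (jetBase p)] B p := fun p hp =>
    (key p hp).mono fun z hz => congrArg (fun v => v.2.1) hz
  have kC : ∀ p ∈ Ω, (fun z => C (σ z) z) =ᶠ[𝓝 (jetBase p)] C p := fun p hp =>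
    (key p hp).mono fun z hz => congrArg (fun v => v.2.2.1) hz
  have kD : ∀ p ∈ Ω, (fun z => D (σ z) z) =ᶠ[𝓝 (jetBase p)] D p := fun p hp =>
    (key p hp).mono fun z hz => congrArg (fun v => v.2.2.2) hz
  refine ⟨fun z => A (σ z) z, fun z => B (σ z) z, fun z => C (σ z) z, fun z => D (σ z) z,
    ?_, ?_, ?_, ?_, fun p hp => ?_, ?_⟩
  · rintro _ ⟨p, hp, rfl⟩; exact (hA p hp).congr (kA p hp).symm
  · rintro _ ⟨p, hp, rfl⟩; exact (hB p hp).congr (kB p hp).symm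
  · rintro _ ⟨p, hp, rfl⟩; exact (hC p hp).congr (kC p hp).symm
  · rintro _ ⟨p, hp, rfl⟩; exact (hD p hp).congr (kD p hp).symm
  · have := (hcub p hp).self_of_nhds
    unfold IsCubicAt at this ⊢
    rw [this, ← (kA p hp).self_of_nhds, ← (kB p hp).self_of_nhds, ← (kC p hp).self_of_nhds,
      ← (kD p hp).self_of_nhds]
  · rintro _ ⟨p, hp, rfl⟩
    have := (hrel p hp).self_of_nhds
    unfold CoefficientRelationsAt at this ⊢
    rw [(kA p hp).partialX_eq, (kB p hp).partialX_eq, (kB p hp).partialY_eq, (kC p hp).partialX_eq,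
      (kC p hp).partialY_eq, (kD p hp).partialY_eq, (kA p hp).self_of_nhds, (kB p hp).self_of_nhds,
      (kC p hp).self_of_nhds, (kD p hp).self_of_nhds]
    exact this

theorem equivalentToFreeAt_of_global_coefficients {A B C D : ℝ × ℝ → ℝ} (hΩ : IsOpen Ω)
    (hf : AnalyticOnNhd ℝ f Ω) (hA : AnalyticOnNhd ℝ A (jetBase '' Ω))
    (hB : AnalyticOnNhd ℝ B (jetBase '' Ω)) (hC : AnalyticOnNhd ℝ C (jetBase '' Ω))
    (hD : AnalyticOnNhd ℝ D (jetBase '' Ω)) (hcub : ∀ p ∈ Ω, IsCubicAt A B C D f p)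
    (hrel : ∀ z ∈ jetBase '' Ω, CoefficientRelationsAt A B C D z) (hp : p ∈ Ω) :
    EquivalentToFreeAt f p := by
  have hz : jetBase p ∈ jetBase '' Ω := ⟨p, hp, rfl⟩
  refine equivalentToFreeAt_of_coefficients (hf p hp) (hA _ hz) (hB _ hz) (hC _ hz) (hD _ hz) ?_ ?_
  · filter_upwards [hΩ.mem_nhds hp] with q hq using hcub q hq
  · filter_upwards [eventually_jet_of_base (hΩ.mem_nhds hp)] with z h1
    exact hrel z ⟨_, h1.self_of_nhds, rfl⟩

theorem AreaEquivalentAt.symm (hf : AnalyticAt ℝ f p) (hg : AnalyticAt ℝ g q)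
    (H : AreaEquivalentAt f p g q) : AreaEquivalentAt g q f p := by
  obtain ⟨Φ, HΦ, rfl⟩ := (areaEquivalentAt_iff hf).1 H
  obtain ⟨Ψ, -, -, -, HΨ, hp⟩ := CarriesAt.exists_inverse HΦ
  exact (areaEquivalentAt_iff hg).2 ⟨Ψ, HΨ, hp⟩

theorem AreaEquivalentAt.trans (hf : AnalyticAt ℝ f p) (hg : AnalyticAt ℝ g q)
    (H1 : AreaEquivalentAt f p g q) (H2 : AreaEquivalentAt g q h o) : AreaEquivalentAt f p h o := by
  obtain ⟨Φ, HΦ, rfl⟩ := (areaEquivalentAt_iff hf).1 H1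
  obtain ⟨Ψ, HΨ, rfl⟩ := (areaEquivalentAt_iff hg).1 H2
  have h0 := HΦ.self_of_nhds
  refine (areaEquivalentAt_iff hf).2 ⟨fun w => Ψ (Φ w), ?_,
    prolongation_comp HΨ.self_of_nhds.analytic h0.analytic h0.transversal⟩
  filter_upwards [HΦ, (continuousAt_prolongation h0.analytic h0.transversal).eventually HΨ]
    with r h1 h2
  exact h2.comp h1

/-- The special affine maps act transitively on the jets at which they are defined. -/
theorem areaEquivalentAt_free (p q : ℝ × ℝ × ℝ) :
    AreaEquivalentAt (fun _ => 0) p (fun _ => 0) q := by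
  refine (areaEquivalentAt_iff analyticAt_const).2
    -- A vertical shear adds `q.2.2 - p.2.2` to every slope, and a translation then matches the base
    -- points. As `χ` does not involve `y`, transversality holds at every jet.
    ⟨affineMap (q.1 - p.1) (q.2.1 - p.2.1 - (q.2.2 - p.2.2) * p.1) 1 0 (q.2.2 - p.2.2) 1,
      .of_forall fun r => carriesAt_affineMap (by ring) (by simp), ?_⟩
  rw [prolongation_affineMap]
  ext <;> simp

/-- Both equations are carried to `y'' = 0`, but possibly at different jets; an affine map in the
middle aligns them, so the composite sends `p` to `q`. -/
theorem EquivalentToFreeAt.areaEquivalentAt (hf : AnalyticAt ℝ f p) (hg : AnalyticAt ℝ g q)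
    (Hf : EquivalentToFreeAt f p) (Hg : EquivalentToFreeAt g q) : AreaEquivalentAt f p g q := by
  obtain ⟨a, ha⟩ := Hf
  obtain ⟨b, hb⟩ := Hg
  exact (ha.trans hf analyticAt_const (areaEquivalentAt_free a b)).trans hf analyticAt_const
    (hb.symm hg analyticAt_const)

end Global

theorem corollary3p3 :
    -- the characterization, near a jet at which the equation is real analytic
    (∀ (f : ℝ × ℝ × ℝ → ℝ) (p : ℝ × ℝ × ℝ), AnalyticAt ℝ f p →
      (EquivalentToFreeAt f p ↔
        ∃ A B C D : ℝ × ℝ → ℝ,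
          AnalyticAt ℝ A (jetBase p) ∧ AnalyticAt ℝ B (jetBase p) ∧
          AnalyticAt ℝ C (jetBase p) ∧ AnalyticAt ℝ D (jetBase p) ∧
          (∀ᶠ p' in 𝓝 p, IsCubicAt A B C D f p') ∧
          (∀ᶠ z in 𝓝 (jetBase p), CoefficientRelationsAt A B C D z))) ∧
    -- the characterization on a whole domain of the jet space with connected vertical fibres
    (∀ (Ω : Set (ℝ × ℝ × ℝ)) (f : ℝ × ℝ × ℝ → ℝ), IsOpen Ω →
      (∀ x y : ℝ, IsPreconnected {y' : ℝ | (x, y, y') ∈ Ω}) → AnalyticOnNhd ℝ f Ω →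
      ((∀ p ∈ Ω, EquivalentToFreeAt f p) ↔
        ∃ A B C D : ℝ × ℝ → ℝ,
          AnalyticOnNhd ℝ A (jetBase '' Ω) ∧ AnalyticOnNhd ℝ B (jetBase '' Ω) ∧
          AnalyticOnNhd ℝ C (jetBase '' Ω) ∧ AnalyticOnNhd ℝ D (jetBase '' Ω) ∧
          (∀ p ∈ Ω, IsCubicAt A B C D f p) ∧
          (∀ z ∈ jetBase '' Ω, CoefficientRelationsAt A B C D z))) ∧
    -- the symmetries of `y'' = 0` are the special affine transformations
    (∀ (Φ : ℝ × ℝ → ℝ × ℝ) (p : ℝ × ℝ × ℝ),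
      (∃ W ∈ 𝓝 p, CarriesEquationOn Φ (fun _ => 0) (fun _ => 0) W) ↔
        ∃ M ∈ ASL2, Φ =ᶠ[𝓝 (jetBase p)] affineAction M ∧
          alongJet (fun w => (affineAction M w).1) p ≠ 0) ∧
    -- five is the maximal dimension of a Lie group of symmetries
    (∀ (f : ℝ × ℝ × ℝ → ℝ) (p : ℝ × ℝ × ℝ), AnalyticAt ℝ f p →
      ∀ (r : ℕ) (m : (Fin r → ℝ) → (Fin r → ℝ) → (Fin r → ℝ))
        (α : (Fin r → ℝ) → ℝ × ℝ → ℝ × ℝ), IsLocalSymmetryGroup f p m α → r ≤ 5) ∧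
    -- it is attained, and `ASL(2, ℝ)` is admitted, exactly by the equations equivalent to `y'' = 0`
    (∀ (f : ℝ × ℝ × ℝ → ℝ) (p : ℝ × ℝ × ℝ), AnalyticAt ℝ f p →
      (AdmitsASL2At f p ↔ EquivalentToFreeAt f p) ∧
      ((∃ (m : (Fin 5 → ℝ) → (Fin 5 → ℝ) → (Fin 5 → ℝ)) (α : (Fin 5 → ℝ) → ℝ × ℝ → ℝ × ℝ),
          IsLocalSymmetryGroup f p m α) ↔ EquivalentToFreeAt f p)) ∧
    -- these equations form a single equivalence class
    (∀ (f g : ℝ × ℝ × ℝ → ℝ) (p q : ℝ × ℝ × ℝ), AnalyticAt ℝ f p → AnalyticAt ℝ g q →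
      AdmitsASL2At f p → AdmitsASL2At g q → AreaEquivalentAt f p g q) := by
  refine ⟨fun f p hf => ⟨fun h => h.exists_coefficients hf, ?_⟩, fun Ω f hΩ hfib hf => ⟨fun H => ?_, ?_⟩,
    carriesEquationOn_free_iff, fun f p hf r m α h => h.dim_le_five hf, fun f p hf =>
    ⟨admitsASL2At_iff hf, ?_, fun h => ?_⟩, fun f g p q hf hg Hf Hg => ?_⟩
  · rintro ⟨A, B, C, D, hA, hB, hC, hD, hcub, hrel⟩
    exact equivalentToFreeAt_of_coefficients hf hA hB hC hD hcub hrel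
  · exact exists_global_coefficients hΩ hfib fun p hp => (H p hp).exists_coefficients (hf p hp)
  · rintro ⟨A, B, C, D, hA, hB, hC, hD, hcub, hrel⟩ p hp
    exact equivalentToFreeAt_of_global_coefficients hΩ hf hA hB hC hD hcub hrel hp
  · rintro ⟨m, α, h⟩
    exact equivalentToFreeAt_of_symmetryGroup hf h
  · obtain ⟨m, α, h, -⟩ := h.admitsASL2At hf
    exact ⟨m, α, h⟩
  · exact ((admitsASL2At_iff hf).1 Hf).areaEquivalentAt hf hg ((admitsASL2At_iff hg).1 Hg)
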